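/- **Conventions.** All fields have characteristic $0$. A difference ring $(A,\sigma)$ is a commutative ring with a ring automorphism; $\mathrm{const}(A,\sigma)=\{c\in A\mid\sigma(c)=c\}$. Let $(F,\sigma)$ be a difference field with constant field $K=\mathrm{const}(F,\sigma)$. $S(K)$ is the ring of sequences $\mathbb N\to K$ modulo eventual equality, with the shift $S(a_0,a_1,\dots)=(a_1,a_2,\dots)$. For a difference ring extension $(A,\sigma)$ of $(F,\sigma)$, a *$K$-homomorphism* is a ring homomorphism $\tau:A\to S(K)$ with $\tau(\sigma(f))=S(\tau(f))$ for $f\in A$ and $\tau(c)=(c,c,\dots)$ for $c\in K$; a *$K$-embedding* is an injective one. An *evaluation function* for $(A,\sigma)$ is a map $\mathrm{ev}:A\times\mathbb N\to K$ such that, for all $f,g\in A$, $c\in K$, $l\in\mathbb Z$, the equations $\mathrm{ev}(c,n)=c$, $\mathrm{ev}(f+g,n)=\mathrm{ev}(f,n)+\mathrm{ev}(g,n)$, $\mathrm{ev}(fg,n)=\mathrm{ev}(f,n)\,\mathrm{ev}(g,n)$, $\mathrm{ev}(\sigma^l(f),n)=\mathrm{ev}(f,n+l)$ hold for all sufficiently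 large $n$; it is an evaluation function *for $\tau$* if $\tau(f)=(\mathrm{ev}(f,n))_{n\ge0}$ for all $f$. A map $L:A\to\mathbb N$ is an *$o^\sigma$-function* for $\mathrm{ev}$ if the second and third equation hold for $n\ge\max(L(f),L(g))$ and the fourth one for $n\ge L(f)+\max(0,-l)$; a map $Z:A\to\mathbb N$ is a *$z$-function* if $\mathrm{ev}(f,n)\ne0$ for all $f\ne0$ and $n\ge Z(f)$. $F\langle x_1\rangle\dots\langle x_s\rangle[z_1]\dots[z_l]$ denotes the ring of Laurent polynomials over $F$ in $x_1,\dots,x_s$ with adjoined generators $z_j$ subject to $z_j^{\lambda_j}=1$, $\lambda_j=\mathrm{ord}(z_j)>1$. An *$R\Pi$-extension* of $(F,\sigma)$ is here a difference ring extension of $(F,\sigma)$ of this form with $\sigma(x_i)/x_i\in F\langle x_1\rangle\dots\langle x_{i-1}\rangle^*$, $\sigma(z_j)/z_j\in K^*$, whose set of constants is $K$; then the $x_i$ are called $\Pi$-monomials and the $z_j$ $R$-monomials of order $\lambda_j$. A *$P$-extension* $(F\langle \hat x_1\rangle\dots\langle\hat x_r\rangle,\sigma)$ with $\hat\alpha_i=\sigma(\hat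 x_i)/\hat x_i\in F^*$ is a difference ring extension of $(F,\sigma)$ with no condition on its constants. Let $H_{(F,\sigma)}=\{\sigma(g)/g\mid g\in F^*\}$. $(F,\sigma)$ is *radical-stable* if for all $a\in F^*$ and $m\ge1$ with $a^m\in H_{(F,\sigma)}$ there is $\rho\in K^*$ with $\rho^m=1$ and $a\rho\in H_{(F,\sigma)}$. Let $M((\alpha_1,\dots,\alpha_r),F)=\{n\in\mathbb Z^r\mid\alpha_1^{n_1}\cdots\alpha_r^{n_r}\in H_{(F,\sigma)}\}$, a submodule of $\mathbb Z^r$. The *largest divisor* of a nonzero submodule of $\mathbb Z^r$ of rank $u$ is the last entry $d_u$ of the Smith normal form $\mathrm{diag}(d_1,\dots,d_u)\in\mathbb Z^{u\times r}$, $d_1\mid\dots\mid d_u$, $d_i>0$, of a matrix whose rows form a basis of the submodule. **Theorem.** Let $(F,\sigma)$ be a radical-stable difference field with $K=\mathrm{const}(F,\sigma)$ and let $\bar\tau:F\to S(K)$ be a $K$-embedding. Let $(F\langle\hat x_1\rangle\dots\langle\hat x_r\rangle,\sigma)$ be a $P$-extension of $(F,\sigma)$ with $\hat\alpha_i=\sigma(\hat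 x_i)/\hat x_i\in F^*$, and let $\hat\tau:F\langle\hat x_1\rangle\dots\langle\hat x_r\rangle\to S(K)$ be a $K$-homomorphism with $\hat\tau|_F=\bar\tau$. Assume $M((\hat\alpha_1,\dots,\hat\alpha_r),F)\ne\{0\}$, and let $u\ge1$ be its rank and $d\ge1$ its largest divisor. Then there are an $R\Pi$-extension $(H,\sigma)$ of $(F,\sigma)$, a $K$-embedding $\tau':H\to S(K)$ with $\tau'|_F=\bar\tau$ and a surjective difference ring homomorphism $\hat\lambda:F\langle\hat x_1\rangle\dots\langle\hat x_r\rangle\to H$ such that: 1. $\tau'(\hat\lambda(f))=\hat\tau(f)$ for all $f$. 2. If $d=1$, then $H=F\langle x_{u+1}\rangle\dots\langle x_r\rangle$ with $r-u$ $\Pi$-monomials $x_i$, $\alpha_i=\sigma(x_i)/x_i\in F^*$. Otherwise $H=F\langle x_{u+1}\rangle\dots\langle x_r\rangle[z]$ with such $\Pi$-monomials $x_i$ and one $R$-monomial $z$ of order $d$ with $\rho=\sigma(z)/z\in K^*$. 3. $\hat\lambda|_F=\mathrm{id}$ and $\hat\lambda(\hat x_i)=\gamma_i\,z^{o_i}x_{u+1}^{m_{i,u+1}}\cdots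 x_r^{m_{i,r}}$ for $1\le i\le r$, with $\gamma_i\in F^*$, $0\le o_i<d$, $m_{i,j}\in\mathbb Z$ (without the factor $z^{o_i}$ if $d=1$). 4. For every evaluation function $\overline{\mathrm{ev}}$ for $\bar\tau$ there are $\kappa_i\in K^*$ and integers $l_i\ge1$ ($u+1\le i\le r$) and an evaluation function $\mathrm{ev}'$ for $\tau'$ with $\mathrm{ev}'|_{F\times\mathbb N}=\overline{\mathrm{ev}}$, $\mathrm{ev}'(x_i,n)=\kappa_i\prod_{k=l_i}^n\overline{\mathrm{ev}}(\alpha_i,k-1)$ and, if $d>1$, $\mathrm{ev}'(z,n)=\rho^n$. 5. Let $(H',\sigma)$ with $H'=F\langle y_1\rangle\dots\langle y_e\rangle[z_1]\dots[z_l]$ be any $R\Pi$-extension of $(F,\sigma)$ with a $K$-embedding $\tau'':H'\to S(K)$, $\tau''|_F=\bar\tau$, and a (not necessarily surjective) difference ring homomorphism $\lambda':F\langle\hat x_1\rangle\dots\langle\hat x_r\rangle\to H'$ with $\tau''\circ\lambda'=\hat\tau$. Then $r-u\le e$; and if $d>1$, then $l\ge1$ and $d\le\mathrm{lcm}(\mathrm{ord}(z_1),\dots,\mathrm{ord}(z_l))=\mathrm{ord}(z_1)\cdots\mathrm{ord}(z_l)$.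 6. There is a matrix $(n_{i,j})\in\mathbb Z^{u\times r}$ with linearly independent rows such that $g_i:=\hat\lambda(\hat x_1^{n_{i,1}}\cdots\hat x_r^{n_{i,r}})\in F^*$ for $1\le i\le u$ and $$\ker\hat\tau=\ker\hat\lambda=\big\langle \hat x_1^{n_{1,1}}\cdots\hat x_r^{n_{1,r}}-g_1,\dots,\hat x_1^{n_{u,1}}\cdots\hat x_r^{n_{u,r}}-g_u\big\rangle .$$ Moreover, suppose that the elements of $F$ are encoded such that addition, multiplication, inversion and $\sigma$ are computable; that $\bar\tau$ has a computable evaluation function $\overline{\mathrm{ev}}$ with a computable $o^\sigma$-function and a computable $z$-function; that for $w\in F^*$ one can compute, if it exists, a $g\in F^*$ with $\sigma(g)=w\,g$; and that for $\alpha_1,\dots,\alpha_r\in F^*$ one can compute a $\mathbb Z$-basis of $M((\alpha_1,\dots,\alpha_r),F)$. Then there is an algorithm that, given $\hat\alpha_1,\dots,\hat\alpha_r\in F^*$ with $M((\hat\alpha_1,\dots,\hat\alpha_r),F)\neq\{0\}$, and programs for an evaluation function $\widehat{\mathrm{ev}}$ for $\hat\tau$ with $\widehat{\mathrm{ev}}|_{F\times\mathbb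 N}=\overline{\mathrm{ev}}$ and for an $o^\sigma$-function for $\widehat{\mathrm{ev}}$, computes $d$, the $\alpha_i$ and (if $d>1$) $\rho$ defining $(H,\sigma)$; the $\gamma_i,o_i,m_{i,j}$ defining $\hat\lambda$; the $n_{i,j},g_i$ defining the generators of $\ker\hat\lambda$; and the $\kappa_i,l_i$ defining $\mathrm{ev}'$ for $\overline{\mathrm{ev}}$, such that all of the above holds. -/

import Mathlib

noncomputable section

namespace DiffRing

open Filter

variable {F : Type*} [Field F]

/-! ### Difference fields -/

/-- The constant field `K = {c ∈ F | σ c = c}` of a difference field `(F, σ)`. -/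
def constField (σ : RingAut F) : Subfield F where
  carrier := {c | σ c = c}
  mul_mem' {a b} ha hb := by
    simp only [Set.mem_ofPred_eq] at ha hb ⊢
    rw [map_mul, ha, hb]
  one_mem' := map_one σ
  add_mem' {a b} ha hb := by
    simp only [Set.mem_ofPred_eq] at ha hb ⊢
    rw [map_add, ha, hb]
  zero_mem' := map_zero σ
  neg_mem' {a} ha := by
    simp only [Set.mem_ofPred_eq] at ha ⊢
    rw [map_neg, ha]
  inv_mem' a ha := by
    simp only [Set.mem_ofPred_eq] at ha ⊢
    rw [map_inv₀, ha]

/-- `a` lies in the homogeneous group `{σ g / g | g ∈ F*}`. -/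
def InHomogGroup (σ : RingAut F) (a : F) : Prop :=
  ∃ g : F, g ≠ 0 ∧ a = σ g / g

/-- Radical-stability: if `a ^ m` (with `m > 0`) is in the homogeneous group, then so is `a * ρ`
for some `m`-th root of unity `ρ` in the constant field. -/
def RadicalStable (σ : RingAut F) : Prop :=
  ∀ (a : F) (m : ℕ), a ≠ 0 → 0 < m → InHomogGroup σ (a ^ m) →
    ∃ ρ ∈ constField σ, ρ ^ m = 1 ∧ InHomogGroup σ (a * ρ)

/-- The `ℤ`-module `M((α₁,…,α_r), F)` of all exponent vectors `n` such that
`α₁^{n₁} ⋯ α_r^{n_r} = σ g / g` for some `g ∈ F*`. -/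
def multRel (σ : RingAut F) {r : ℕ} (α : Fin r → Fˣ) : Submodule ℤ (Fin r → ℤ) where
  carrier := {n | InHomogGroup σ (∏ i, (α i : F) ^ n i)}
  add_mem' {a b} := by
    rintro ⟨g, hg, hga⟩ ⟨h, hh, hhb⟩
    refine ⟨g * h, mul_ne_zero hg hh, ?_⟩
    have : (∏ i, (α i : F) ^ (a + b) i) = (∏ i, (α i : F) ^ a i) * ∏ i, (α i : F) ^ b i := by
      rw [← Finset.prod_mul_distrib]
      exact Finset.prod_congr rfl fun i _ => zpow_add₀ (α i).ne_zero _ _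
    rw [this, hga, hhb, map_mul, div_mul_div_comm]
  zero_mem' := ⟨1, one_ne_zero, by simp⟩
  smul_mem' c n := by
    rintro ⟨g, hg, hgn⟩
    refine ⟨g ^ c, zpow_ne_zero _ hg, ?_⟩
    have : (∏ i, (α i : F) ^ (c • n) i) = (∏ i, (α i : F) ^ n i) ^ c := by
      rw [← Finset.prod_zpow]
      refine Finset.prod_congr rfl fun i _ => ?_
      rw [← zpow_mul, Pi.smul_apply, smul_eq_mul, mul_comm]
    rw [this, hgn, map_zpow₀, div_zpow]

/-! ### Largest divisor of a submodule of `ℤ^r` -/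

/-- The rows of the integer matrix `Z` form a `ℤ`-basis of `V`. -/
def RowsAreBasis {r u : ℕ} (V : Submodule ℤ (Fin r → ℤ)) (Z : Matrix (Fin u) (Fin r) ℤ) : Prop :=
  LinearIndependent ℤ Z.row ∧ Submodule.span ℤ (Set.range Z.row) = V

/-- `d` is the largest divisor of the nonzero submodule `V` of `ℤ^r`: for a matrix `Z` whose rows
are a basis of `V`, there are matrices `A`, `B`, invertible over `ℤ`, such that `A Z B` is the
diagonal matrix (Smith normal form) with positive entries `d₁ ∣ d₂ ∣ ⋯ ∣ d_u`, and `d = d_u`. -/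
def IsLargestDivisor {r : ℕ} (V : Submodule ℤ (Fin r → ℤ)) (d : ℕ) : Prop :=
  ∃ (u : ℕ) (hu : 0 < u) (Z : Matrix (Fin u) (Fin r) ℤ) (A : Matrix (Fin u) (Fin u) ℤ)
    (B : Matrix (Fin r) (Fin r) ℤ) (δ : Fin u → ℕ),
    RowsAreBasis V Z ∧ IsUnit A.det ∧ IsUnit B.det ∧
    A * Z * B = Matrix.of (fun (i : Fin u) (j : Fin r) => if i.val = j.val then (δ i : ℤ) else 0) ∧
    (∀ i, 0 < δ i) ∧ (∀ i j, i ≤ j → δ i ∣ δ j) ∧ d = δ ⟨u - 1, Nat.sub_lt hu one_pos⟩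

/-! ### The ring of sequences, `K`-homomorphisms and evaluation functions -/

/-- Sequences with entries in `K`, where two sequences are identified if they agree from some
point on. -/
abbrev SeqRing (K : Type*) : Type _ := Germ (atTop : Filter ℕ) K

/-- The class of a sequence. -/
def toSeq {K : Type*} (a : ℕ → K) : SeqRing K := (a : Germ (atTop : Filter ℕ) K)

/-- The shift `(a₀, a₁, a₂, …) ↦ (a₁, a₂, …)`. -/
def shift {K : Type*} (a : SeqRing K) : SeqRing K :=
  a.compTendsto (fun n => n + 1) (tendsto_add_atTop_nat 1)

/-- `τ : A → S(K)` is a `K`-homomorphism from the difference ring `(A, σA)`, an extension of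
`(F, σ)`, where `K` is the constant field of `(F, σ)`. -/
structure IsKHom (σ : RingAut F) {A : Type*} [CommRing A] [Algebra F A] (σA : RingAut A)
    (τ : A →+* SeqRing (constField σ)) : Prop where
  map_shift : ∀ a, τ (σA a) = shift (τ a)
  map_const : ∀ c : constField σ, τ (algebraMap F A c) = toSeq (fun _ => c)

/-- An injective `K`-homomorphism. -/
structure IsKEmbedding (σ : RingAut F) {A : Type*} [CommRing A] [Algebra F A] (σA : RingAut A)
    (τ : A →+* SeqRing (constField σ)) : Prop extends IsKHom σ σA τ where
  injective : Function.Injective τ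

/-- `ev` is an evaluation function for the difference ring `(A, σA)`, with values in the constant
field of `(F, σ)`. -/
structure IsEvalFun (σ : RingAut F) {A : Type*} [CommRing A] [Algebra F A] (σA : RingAut A)
    (ev : A → ℕ → constField σ) : Prop where
  map_const : ∀ c : constField σ, ∃ N : ℕ, ∀ n : ℕ, N ≤ n → ev (algebraMap F A c) n = c
  map_add : ∀ f g, ∃ N : ℕ, ∀ n : ℕ, N ≤ n → ev (f + g) n = ev f n + ev g n
  map_mul : ∀ f g, ∃ N : ℕ, ∀ n : ℕ, N ≤ n → ev (f * g) n = ev f n * ev g n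
  map_shift : ∀ (f : A) (k : ℤ), ∃ N : ℕ, ∀ n : ℕ, N ≤ n → ∀ m : ℕ, (m : ℤ) = n + k →
    ev ((σA ^ k) f) n = ev f m

/-- `L` is an `o^σ`-function for `ev`: it provides explicit bounds from which on `ev` is compatible
with the ring operations and with the automorphism. -/
structure IsOSigmaFun {K A : Type*} [Field K] [CommRing A] (σA : RingAut A)
    (ev : A → ℕ → K) (L : A → ℕ) : Prop where
  map_add : ∀ f g, ∀ n : ℕ, max (L f) (L g) ≤ n → ev (f + g) n = ev f n + ev g n
  map_mul : ∀ f g, ∀ n : ℕ, max (L f) (L g) ≤ n → ev (f * g) n = ev f n * ev g n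
  map_shift : ∀ (f : A) (k : ℤ), ∀ n : ℕ, L f + (-k).toNat ≤ n → ∀ m : ℕ, (m : ℤ) = n + k →
    ev ((σA ^ k) f) n = ev f m

/-- `Z` is a `z`-function for `ev`. -/
def IsZFun {K A : Type*} [Field K] [CommRing A] (ev : A → ℕ → K) (Z : A → ℕ) : Prop :=
  ∀ f, f ≠ 0 → ∀ n : ℕ, Z f ≤ n → ev f n ≠ 0

/-- `ev` is an evaluation function for `τ`, i.e. `τ f = (ev(f, n))_{n ≥ 0}` for all `f`. -/
def Represents {K A : Type*} [Field K] [CommRing A] (ev : A → ℕ → K)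
    (τ : A →+* SeqRing K) : Prop :=
  ∀ f, τ f = toSeq (ev f)

/-! ### `AP`-extensions -/

/-- The ring `F⟨x₁⟩…⟨x_s⟩[z₁]…[z_l]` with Laurent polynomial variables `x_i` and with generators
`z_j` subject to `z_j ^ ord j = 1`: the group algebra over `F` of the group
`ℤ^s × ∏_j ℤ/(ord j)` of exponents. -/
abbrev APRing (F : Type*) [Field F] (s : ℕ) {l : ℕ} (ord : Fin l → ℕ) : Type _ :=
  AddMonoidAlgebra F ((Fin s → ℤ) × ((j : Fin l) → ZMod (ord j)))

/-- The Laurent polynomial ring `F⟨x₁⟩…⟨x_r⟩`. -/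
abbrev PRing (F : Type*) [Field F] (r : ℕ) : Type _ :=
  APRing F r (fun j : Fin 0 => j.elim0)

section Generators

variable {s l : ℕ} {ord : Fin l → ℕ}

/-- The monomial `x₁^{m₁} ⋯ x_s^{m_s} z₁^{k₁} ⋯ z_l^{k_l}`. -/
def mono (m : Fin s → ℤ) (k : (j : Fin l) → ZMod (ord j)) : APRing F s ord :=
  AddMonoidAlgebra.single (m, k) 1

/-- The Laurent variable `x_i`. -/
def xVar (i : Fin s) : APRing F s ord := mono (Pi.single i 1) 0

/-- The generator `z_j` of multiplicative order `ord j`. -/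
def zVar (j : Fin l) : APRing F s ord := mono 0 (Pi.single j 1)

/-- The subring `F⟨x₁⟩…⟨x_{i-1}⟩` of `F⟨x₁⟩…⟨x_s⟩[z₁]…[z_l]`. -/
def lowerRing (F : Type*) [Field F] {s l : ℕ} (ord : Fin l → ℕ) (i : Fin s) :
    Subalgebra F (APRing F s ord) :=
  Algebra.adjoin F {f | ∃ m : Fin s → ℤ, (∀ j, i ≤ j → m j = 0) ∧ f = mono m 0}

/-- `(F⟨x₁⟩…⟨x_s⟩[z₁]…[z_l], σE)` is a (nested) `AP`-extension of `(F, σ)` in which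
`σE x_i / x_i` is a unit of `F⟨x₁⟩…⟨x_{i-1}⟩` and the `z_j` are `A`-monomials with
`σE z_j / z_j` in the constant field of `(F, σ)`. -/
structure IsAPExtension (σ : RingAut F) (σE : RingAut (APRing F s ord)) : Prop where
  one_lt_ord : ∀ j, 1 < ord j
  map_base : ∀ f : F, σE (algebraMap F _ f) = algebraMap F _ (σ f)
  map_x : ∀ i, ∃ β ∈ lowerRing F ord i, ∃ β' ∈ lowerRing F ord i,
    β * β' = 1 ∧ σE (xVar i) = β * xVar i
  map_z : ∀ j, ∃ ρ : constField σ, ρ ≠ 0 ∧ σE (zVar j) = algebraMap F _ ρ * zVar j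

/-- An `RΠ`-extension (of the same shape): an `AP`-extension with the same constants. -/
structure IsRPiExtension (σ : RingAut F) (σE : RingAut (APRing F s ord)) : Prop
    extends IsAPExtension σ σE where
  const_eq : ∀ f, σE f = f ↔ ∃ c ∈ constField σ, algebraMap F _ c = f

end Generators

/-- `(F⟨x₁⟩…⟨x_r⟩, σE)` is the `P`-extension of `(F, σ)` with `σE x_i = α_i x_i`, `α_i ∈ F*`. -/
structure IsPExtension (σ : RingAut F) {r : ℕ} (α : Fin r → Fˣ) (σE : RingAut (PRing F r)) :
    Prop where
  map_base : ∀ f : F, σE (algebraMap F _ f) = algebraMap F _ (σ f)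
  map_x : ∀ i, σE (xVar i) = algebraMap F _ (α i : F) * xVar i

/-! ### Representation of products -/

/-- The ring `F⟨x₁⟩…⟨x_s⟩` if `d = 1`, and `F⟨x₁⟩…⟨x_s⟩[z]` with `z ^ d = 1` otherwise. -/
abbrev HRing (F : Type*) [Field F] (s d : ℕ) : Type _ :=
  APRing F s (fun _ : Fin (if d = 1 then 0 else 1) => d)

/-- The finite data describing the difference ring `(H, σ)`, the homomorphism `λ` and the generators
of its kernel. The value of `ρ` is relevant for `d > 1` only. -/
structure RepData (F : Type*) [Field F] (r s u : ℕ) where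
  /-- the order of the `R`-monomial (`d = 1`: there is none) -/
  d : ℕ
  /-- the quotients `σ x_i / x_i` of the `Π`-monomials -/
  α : Fin s → Fˣ
  /-- the quotient `σ z / z` of the `R`-monomial -/
  ρ : F
  /-- the coefficient of `λ x̂_i` -/
  γ : Fin r → Fˣ
  /-- the exponent of `z` in `λ x̂_i` -/
  o : Fin r → ℕ
  /-- the exponents of the `Π`-monomials in `λ x̂_i` -/
  m : Fin r → Fin s → ℤ
  /-- the exponent vectors of the generators `x̂^{n_i} - g_i` of the kernel -/
  n : Fin u → Fin r → ℤ
  /-- the elements `g_i` in the generators `x̂^{n_i} - g_i` of the kernel -/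
  g : Fin u → Fˣ

/-- No representation in an `RΠ`-extension needs fewer than `s` many `Π`-monomials, and, if `d > 1`,
every such representation needs at least one `R`-monomial and the product of the orders of its
`R`-monomials (which equals their least common multiple) is at least `d`. -/
def IsMinimal (σ : RingAut F) (τ₀ : F →+* SeqRing (constField σ)) {r : ℕ}
    (σE : RingAut (PRing F r)) (τE : PRing F r →+* SeqRing (constField σ)) (s d : ℕ) : Prop :=
  ∀ (e l : ℕ) (ord : Fin l → ℕ) (σ' : RingAut (APRing F e ord))
    (τ' : APRing F e ord →+* SeqRing (constField σ)) (lam' : PRing F r →+* APRing F e ord),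
    IsRPiExtension σ σ' →
    IsKEmbedding σ σ' τ' → (∀ f : F, τ' (algebraMap F _ f) = τ₀ f) →
    (∀ f, lam' (σE f) = σ' (lam' f)) → (∀ f, τ' (lam' f) = τE f) →
    s ≤ e ∧
    (1 < d → 1 ≤ l ∧ d ≤ Finset.univ.lcm ord ∧ Finset.univ.lcm ord = ∏ j, ord j)

/-- `(H, σH)` with the embedding `τH` and the map `lam`, all described by the data `D`, is an
optimal representation of the `P`-extension `(F⟨x̂₁⟩…⟨x̂_r⟩, σE)` with its `K`-homomorphism `τE`. -/
structure IsOptimalRep (σ : RingAut F) (τ₀ : F →+* SeqRing (constField σ)) {r : ℕ}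
    (σE : RingAut (PRing F r)) (τE : PRing F r →+* SeqRing (constField σ)) {s u : ℕ}
    (D : RepData F r s u) (σH : RingAut (HRing F s D.d))
    (τH : HRing F s D.d →+* SeqRing (constField σ)) (lam : PRing F r →+* HRing F s D.d) :
    Prop where
  rpi : IsRPiExtension σ σH
  embedding : IsKEmbedding σ σH τH
  embedding_base : ∀ f : F, τH (algebraMap F _ f) = τ₀ f
  lam_shift : ∀ f, lam (σE f) = σH (lam f)
  lam_surjective : Function.Surjective lam
  commutes : ∀ f, τH (lam f) = τE f
  map_x : ∀ i, σH (xVar i) = algebraMap F _ (D.α i : F) * xVar i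
  map_z : ∀ j, D.ρ ∈ constField σ ∧ σH (zVar j) = algebraMap F _ D.ρ * zVar j
  lam_base : ∀ f : F, lam (algebraMap F _ f) = algebraMap F _ f
  o_lt : ∀ i, D.o i < D.d
  lam_x : ∀ i, lam (xVar i) =
    algebraMap F _ (D.γ i : F) * mono (D.m i) (fun _ => (D.o i : ZMod D.d))
  minimal : IsMinimal σ τ₀ σE τE s D.d
  n_indep : LinearIndependent ℤ D.n
  lam_n : ∀ i, lam (mono (D.n i) 0) = algebraMap F _ (D.g i : F)
  ker_eq : RingHom.ker τE = RingHom.ker lam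
  ker_lam : RingHom.ker lam =
    Ideal.span (Set.range fun i => mono (D.n i) 0 - algebraMap F _ (D.g i : F))

/-- Given an evaluation function `ev` of the ground field, there is an evaluation function of `τH`
that extends `ev`, with `x_i ↦ κ_i ∏_{k = l_i}^n ev(α_i, k - 1)` and `z ↦ ρ^n`. -/
def HasProductEval (σ : RingAut F) (ev : F → ℕ → constField σ) {r s u : ℕ}
    (D : RepData F r s u) (σH : RingAut (HRing F s D.d))
    (τH : HRing F s D.d →+* SeqRing (constField σ)) (κ : Fin s → constField σ)
    (l : Fin s → ℕ) : Prop :=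
  (∀ i, κ i ≠ 0) ∧ (∀ i, 1 ≤ l i) ∧
  ∃ ev' : HRing F s D.d → ℕ → constField σ,
    IsEvalFun σ σH ev' ∧ Represents ev' τH ∧
    (∀ (f : F) (n : ℕ), ev' (algebraMap F _ f) n = ev f n) ∧
    (∀ i n, ev' (xVar i) n = κ i * ∏ k ∈ Finset.Icc (l i) n, ev (D.α i : F) (k - 1)) ∧
    (∀ j n, (ev' (zVar j) n : F) = D.ρ ^ n)

/-! ### Algorithmic aspects -/

/-- The required algorithmic properties of the ground field `(F, σ)` with the embedding `τ₀`: the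
field operations and `σ` are computable; `ev` is a computable evaluation function for `τ₀`
with a computable `o^σ`-function `L` and a computable `z`-function `Z`; one can solve the equations
`σ g = w g`; one can compute bases of the modules `M((α₁,…,α_r), F)`. -/
structure IsAlgorithmic [Primcodable F] (σ : RingAut F) (τ₀ : F →+* SeqRing (constField σ))
    (ev : F → ℕ → constField σ) (L Z : F → ℕ) : Prop where
  add : Computable₂ fun a b : F => a + b
  mul : Computable₂ fun a b : F => a * b
  inv : Computable fun a : F => a⁻¹
  aut : Computable fun a : F => σ a
  evalFun : IsEvalFun σ σ ev
  represents : Represents ev τ₀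
  ev_computable : Computable₂ fun (f : F) (n : ℕ) => (ev f n : F)
  oFun : IsOSigmaFun σ ev L
  oFun_computable : Computable L
  zFun : IsZFun ev Z
  zFun_computable : Computable Z
  radicalStable : RadicalStable σ
  solve : ∃ sol : F → Option F, Computable sol ∧ ∀ w, w ≠ 0 →
    (∀ g, sol w = some g → g ≠ 0 ∧ σ g = w * g) ∧
    (sol w = none → ¬ ∃ g, g ≠ 0 ∧ σ g = w * g)
  basis : ∃ bas : List F → List (List ℤ), Computable bas ∧ ∀ (r : ℕ) (α : Fin r → Fˣ),
    ∃ (u : ℕ) (Z : Matrix (Fin u) (Fin r) ℤ), RowsAreBasis (multRel σ α) Z ∧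
      bas (List.ofFn fun i => (α i : F)) = List.ofFn fun i => List.ofFn (Z i)

/-- The element of `F⟨x₁⟩…⟨x_r⟩` that is given by a list of terms (coefficient and list of
exponents). -/
def ofTerms (F : Type*) [Field F] (r : ℕ) (t : List (F × List ℤ)) : PRing F r :=
  (t.map fun p => algebraMap F _ p.1 * mono (fun i : Fin r => p.2.getD i 0) 0).sum

/-- The program `c` computes the function `f`. -/
def Computes {α β : Type*} [Primcodable α] [Primcodable β] (c : Nat.Partrec.Code) (f : α → β) :
    Prop :=
  ∀ a, c.eval (Encodable.encode a) = Part.some (Encodable.encode (f a))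

/-- The pair of programs `(c₁, c₂)` computes the evaluation function `ev` on `F⟨x₁⟩…⟨x_r⟩` and the
function `L`, where the elements of this ring are given by lists of terms. -/
def ComputesEval [Primcodable F] (σ : RingAut F) {r : ℕ} (ev : PRing F r → ℕ → constField σ)
    (L : PRing F r → ℕ) (c₁ c₂ : Nat.Partrec.Code) : Prop :=
  Computes c₁ (fun p : List (F × List ℤ) × ℕ => (ev (ofTerms F r p.1) p.2 : F)) ∧
  Computes c₂ (fun t : List (F × List ℤ) => L (ofTerms F r t))

/-- Input of the algorithm: the quotients `σ x̂_i / x̂_i`, and programs for an evaluation function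
and an `o^σ`-function on `F⟨x̂₁⟩…⟨x̂_r⟩`. -/
abbrev AlgInput (F : Type*) : Type _ := List F × Nat.Partrec.Code × Nat.Partrec.Code

/-- Output of the algorithm: `d`, `ρ`, the `α_i`, the triples `(γ_i, o_i, (m_{ij})_j)`, the pairs
`((n_{ij})_j, g_i)` and the pairs `(κ_i, l_i)`. -/
abbrev AlgOutput (F : Type*) : Type _ :=
  ℕ × F × List F × List (F × ℕ × List ℤ) × List (List ℤ × F) × List (F × ℕ)

/-- The explicit description of the data as an output of an algorithm. -/
def RepData.toOutput {r s u : ℕ} (D : RepData F r s u) (κ : Fin s → F) (l : Fin s → ℕ) :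
    AlgOutput F :=
  (D.d, D.ρ, List.ofFn (fun i => (D.α i : F)),
    List.ofFn (fun i => ((D.γ i : F), D.o i, List.ofFn (D.m i))),
    List.ofFn (fun i => (List.ofFn (D.n i), (D.g i : F))),
    List.ofFn (fun i => (κ i, l i)))

end DiffRing

end

/-! Write M for the module of relations. By the Smith normal form there is a basis C_1, …, C_r of
ℤ^r such that M is spanned by δ_i C_i for i ≤ u, where δ_1 ∣ … ∣ δ_u = d. For i ≤ u the δ_i-th power
of α̂^{C_i} has the form σ(g)/g, so radical-stability gives α̂^{C_i} = η_i σ(γ_i)/γ_i with η_i^{δ_i}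
= 1. The sequences τ̂(x̂^{C_i}) and τ̄(γ_i)·(η_i^n)_n then solve the same first-order recurrence, so
they differ by a constant, which is absorbed into γ_i (`exists_root`). As C_i has exact order δ_i
modulo M, η_i is a primitive δ_i-th root of unity, and all η_i are powers η_u^{c_i} of the last one.
Hence λ̂ should send x̂^{C_i} to γ_i z^{c_i} for i ≤ u, with z standing for (η_u^n)_n, and
x̂^{C_{u+j}} to a new Π-monomial; rewriting the standard basis in terms of the C_k gives the data D
(`exists_cert`).

Why this works: the automorphism of H is diagonal on monomials. A fixed term c·y^g, with g the
exponent of λ̂(x̂^n), forces n ∈ M and hence g = 0, so all constants lie in K. The kernel of λ̂ is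
generated by the binomials of a basis of M (`ker_monHom`) and is killed by τ̂, so τ̂ descends to τ'.
A shortest nonzero element of ker τ' would lead to a shorter one or to a nonzero scalar, so τ' is
injective (`injective_of_const`).

Minimality: in any RΠ-extension the automorphism permutes monomials up to scalars, through a
unipotent map on the Laurent exponents. The support of a solution of σ w = a w is finite and stable
under this map, and a unipotent map fixes vectors with finite orbit, so a single term of w is
already a solution (`IsAPExtension.exists_single`). Consequently M is the kernel of a homomorphism
from ℤ^r to ℤ^e × ∏ ℤ/ord(z_j) (`IsRPiExtension.exists_ker_eq`); comparing ranks and orders of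
torsion elements gives both bounds. The torsion group embeds into F^* by a character, so it is
cyclic, which makes the lcm of the orders equal to their product.

Algorithm: everything needed for D is put into a finite certificate, consisting of equations in F,
linear conditions over ℤ and values of the evaluation function at one point N. One point suffices
because the elements involved satisfy first-order recurrences that are valid from N on. Certificates
exist and can be tested, so unbounded search finds one (`exists_search`); every certificate that
passes is correct. That its d is the largest divisor follows by playing the minimality of two
representations against each other. -/

noncomputable section

namespace DiffRing

open Filter AddMonoidAlgebra

variable {F : Type*} [Field F]

/-! ### Laurent monomials in a commutative group -/

/-- The power product `a₁^{n₁} ⋯ a_r^{n_r}`. -/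
def pw {G : Type*} [CommGroup G] {r : ℕ} (a : Fin r → G) (n : Fin r → ℤ) : G := ∏ i, a i ^ n i

section pw

variable {G G₂ : Type*} [CommGroup G] [CommGroup G₂] {r s : ℕ}

theorem pw_add (a : Fin r → G) (m n : Fin r → ℤ) : pw a (m + n) = pw a m * pw a n := by
  simp [pw, zpow_add, Finset.prod_mul_distrib]

theorem pw_zero (a : Fin r → G) : pw a 0 = 1 := by simp [pw]

theorem pw_mul (a b : Fin r → G) (n : Fin r → ℤ) : pw (a * b) n = pw a n * pw b n := by
  simp [pw, mul_zpow, Finset.prod_mul_distrib]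

theorem pw_zsmul (a : Fin r → G) (c : ℤ) (n : Fin r → ℤ) : pw a (c • n) = pw a n ^ c := by
  simp only [pw, Pi.smul_apply, smul_eq_mul, ← Finset.prod_zpow]
  exact Finset.prod_congr rfl fun i _ => by rw [mul_comm, zpow_mul]

theorem pw_single (a : Fin r → G) (i : Fin r) (c : ℤ) : pw a (Pi.single i c) = a i ^ c := by
  rw [pw, Finset.prod_eq_single i] <;> simp +contextual

theorem map_pw (f : G →* G₂) (a : Fin r → G) (n : Fin r → ℤ) :
    f (pw a n) = pw (fun i => f (a i)) n := by
  simp [pw]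

/-- This is the change of basis in the exponent lattice: it translates between power products of the
given elements and power products along the rows of a matrix. -/
theorem pw_vecMul (a : Fin r → G) (y : Fin s → ℤ) (C : Matrix (Fin s) (Fin r) ℤ) :
    pw a (Matrix.vecMul y C) = pw (fun j => pw a (C j)) y := by
  simp only [pw, ← Finset.prod_zpow, Matrix.vecMul, dotProduct]
  rw [Finset.prod_comm]
  refine Finset.prod_congr rfl fun i _ => ?_
  have h := map_prod (zpowersHom G (a i)) (fun x => Multiplicative.ofAdd (y x * C x i))
    Finset.univ
  rw [← ofAdd_sum] at h
  simp only [zpowersHom_apply, toAdd_ofAdd] at h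
  rw [h]
  exact Finset.prod_congr rfl fun j _ => by rw [mul_comm, zpow_mul]

/-- `pw` as a homomorphism on exponents. -/
def pwHom (a : Fin r → G) : Multiplicative (Fin r → ℤ) →* G where
  toFun n := pw a n.toAdd
  map_one' := pw_zero a
  map_mul' m n := pw_add a m.toAdd n.toAdd

end pw

theorem coe_pw {r : ℕ} (α : Fin r → Fˣ) (n : Fin r → ℤ) :
    ((pw α n : Fˣ) : F) = ∏ i, (α i : F) ^ n i := by
  simp [pw]

/-- The action of an automorphism on units. -/
abbrev onUnits {A : Type*} [CommRing A] (σ : RingAut A) : Aˣ →* Aˣ :=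
  Units.map (σ : A →* A)

/-- Stated with units, so that all later manipulations of relations take place in commutative
groups. -/
theorem mem_multRel {σ : RingAut F} {r : ℕ} {α : Fin r → Fˣ} {n : Fin r → ℤ} :
    n ∈ multRel σ α ↔ ∃ g : Fˣ, onUnits σ g = pw α n * g := by
  change InHomogGroup σ _ ↔ _
  rw [← coe_pw]
  constructor
  · rintro ⟨g, hg, h⟩
    refine ⟨Units.mk0 g hg, Units.ext ?_⟩
    simp [h, hg]
  · rintro ⟨g, h⟩
    refine ⟨g, g.ne_zero, ?_⟩
    have := congrArg Units.val h
    simp only [Units.coe_map, Units.val_mul, MonoidHom.coe_coe] at this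
    rw [this, mul_div_cancel_right₀ _ g.ne_zero]

/-! ### Monomial homomorphisms between group algebras -/

section MonHom

variable {G G₂ : Type*} [AddCommGroup G] [AddCommGroup G₂]

/-- The ring homomorphism `c g ↦ φ(c) γ(g) π(g)` between group algebras. -/
def monHom (φ : F →+* F) (π : G →+ G₂) (γ : Multiplicative G →* Fˣ) :
    AddMonoidAlgebra F G →+* AddMonoidAlgebra F G₂ :=
  liftNCRingHom ((algebraMap F (AddMonoidAlgebra F G₂)).comp φ)
    { toFun := fun g => single (π g.toAdd) (γ g : F)
      map_one' := by simp [AddMonoidAlgebra.one_def]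
      map_mul' := fun a b => by simp [AddMonoidAlgebra.single_mul_single] }
    fun _ _ => Commute.all _ _

theorem monHom_single (φ : F →+* F) (π : G →+ G₂) (γ : Multiplicative G →* Fˣ) (g : G) (c : F) :
    monHom φ π γ (single g c) = single (π g) (φ c * γ (.ofAdd g)) := by
  simp [monHom, liftNCRingHom_single, AddMonoidAlgebra.single_mul_single]

/-- The automorphism `c g ↦ σ(c) χ(g) g` of a group algebra. -/
def twist (σ : RingAut F) (χ : Multiplicative G →* Fˣ) : RingAut (AddMonoidAlgebra F G) :=
  RingEquiv.ofRingHom (monHom (σ : F →+* F) (AddMonoidHom.id G) χ)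
    (monHom ((σ⁻¹ : RingAut F) : F →+* F) (AddMonoidHom.id G)
      ((onUnits σ⁻¹).comp χ⁻¹))
    (by
      refine AddMonoidAlgebra.ringHom_ext (fun c => ?_) fun g => ?_ <;>
        simp [monHom_single])
    (by
      refine AddMonoidAlgebra.ringHom_ext (fun c => ?_) fun g => ?_ <;>
        simp [monHom_single])

theorem twist_single (σ : RingAut F) (χ : Multiplicative G →* Fˣ) (g : G) (c : F) :
    twist σ χ (single g c) = single g (σ c * χ (.ofAdd g)) :=
  monHom_single _ _ _ g c

theorem coeff_twist (σ : RingAut F) (χ : Multiplicative G →* Fˣ) (f : AddMonoidAlgebra F G)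
    (g : G) : (twist σ χ f).coeff g = σ (f.coeff g) * χ (.ofAdd g) := by
  induction f using AddMonoidAlgebra.induction_linear with
  | zero => simp
  | add a b ha hb => simp [ha, hb, add_mul]
  | single h c =>
    rw [twist_single]
    by_cases hg : h = g
    · subst hg; simp
    · simp [hg]

/-- The kernel of a monomial homomorphism that is surjective on exponents. -/
theorem ker_monHom {π : G →+ G₂} (hπ : Function.Surjective π) (γ : Multiplicative G →* Fˣ)
    {ι : Type*} (n : ι → G) (hn : AddSubgroup.closure (Set.range n) = π.ker) :
    RingHom.ker (monHom (RingHom.id F) π γ) =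
      Ideal.span (Set.range fun i => single (n i) (1 : F) -
        algebraMap F (AddMonoidAlgebra F G) (γ (.ofAdd (n i)))) := by
  set I := Ideal.span (Set.range fun i => single (n i) (1 : F) -
        algebraMap F (AddMonoidAlgebra F G) (γ (.ofAdd (n i)))) with hI
  apply le_antisymm
  · -- every monomial is congruent modulo `I` to a chosen representative
    let q := Ideal.Quotient.mk I
    -- The binomial generators only concern the vectors n_i. Exponents v for which the monomial is
    -- congruent to its scalar γ(v) form a subgroup, so the congruence spreads to the whole kernel
    -- of π.
    have hq : ∀ v ∈ π.ker, q (single v 1) = q (single 0 (γ (.ofAdd v) : F)) := by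
      intro v hv
      rw [← hn] at hv
      induction hv using AddSubgroup.closure_induction with
      | mem x hx =>
        obtain ⟨i, rfl⟩ := hx
        refine Ideal.Quotient.eq.mpr (Ideal.subset_span ⟨i, ?_⟩)
        simp
      | zero => simp
      | add x y _ _ hx hy =>
        have e1 : (single (x + y) 1 : AddMonoidAlgebra F G) = single x 1 * single y 1 := by
          simp [AddMonoidAlgebra.single_mul_single]
        have e2 : (single 0 (γ (.ofAdd (x + y)) : F) : AddMonoidAlgebra F G) =
            single 0 (γ (.ofAdd x) : F) * single 0 (γ (.ofAdd y) : F) := by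
          simp [AddMonoidAlgebra.single_mul_single]
        rw [e1, e2, map_mul, map_mul, hx, hy]
      | neg x _ hx =>
        have e1 : q (single (-x) 1) * q (single x 1) = 1 := by
          rw [← map_mul, AddMonoidAlgebra.single_mul_single, neg_add_cancel, one_mul,
            ← AddMonoidAlgebra.one_def, map_one]
        have e2 : q (single 0 (γ (.ofAdd x) : F)) * q (single 0 (γ (.ofAdd (-x)) : F)) = 1 := by
          rw [← map_mul, AddMonoidAlgebra.single_mul_single]
          simp [← AddMonoidAlgebra.one_def]
        rw [hx] at e1
        exact left_inv_eq_right_inv e1 e2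
    obtain ⟨sec, hsec⟩ := hπ.hasRightInverse
    -- An additive section modulo I: a term at w is sent to the class of a term at the chosen
    -- preimage of w, with γ divided out. The quotient map factors as ψ after the monomial
    -- homomorphism, which forces the kernel of the latter into I.
    let ψ : AddMonoidAlgebra F G₂ →+ AddMonoidAlgebra F G ⧸ I :=
      (Finsupp.liftAddHom fun w : G₂ =>
        ((q : _ →+ _).comp (singleAddHom (sec w) : F →+ AddMonoidAlgebra F G)).comp
          (AddMonoidHom.mulLeft (((γ (.ofAdd (sec w)))⁻¹ : Fˣ) : F))).comp
        (coeffAddEquiv : AddMonoidAlgebra F G₂ ≃+ _).toAddMonoidHom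
    have hψ : ∀ w c, ψ (single w c) =
        q (single (sec w) ((((γ (.ofAdd (sec w)))⁻¹ : Fˣ) : F) * c)) := by
      intro w c
      simp only [ψ, AddMonoidHom.comp_apply, AddEquiv.toAddMonoidHom_eq_coe,
        AddMonoidHom.coe_coe, coeffAddEquiv_apply, coeff_single, Finsupp.liftAddHom_apply_single]
      rfl
    have key : ∀ f, q f = ψ (monHom (RingHom.id F) π γ f) := by
      intro f
      induction f using AddMonoidAlgebra.induction_linear with
      | zero => simp
      | add a b ha hb => rw [map_add, ha, hb, map_add, map_add]
      | single v c =>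
        rw [monHom_single]
        have h1 := hq (v - sec (π v)) (by rw [AddMonoidHom.mem_ker, map_sub, hsec, sub_self])
        have e : (single v c : AddMonoidAlgebra F G) =
            single (v - sec (π v)) 1 * single (sec (π v)) c := by
          simp [AddMonoidAlgebra.single_mul_single]
        rw [e, map_mul, h1, ← map_mul, AddMonoidAlgebra.single_mul_single]
        rw [hψ, zero_add]
        congr 2
        simp only [ofAdd_sub, map_div, Units.val_div_eq_div_val, RingHom.id_apply,
          Units.val_inv_eq_inv_val]
        field_simp
    intro f hf
    have := key f
    rw [RingHom.mem_ker.mp hf, map_zero] at this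
    exact Ideal.Quotient.eq_zero_iff_mem.mp this
  · rw [hI, Ideal.span_le]
    rintro _ ⟨i, rfl⟩
    have : π (n i) = 0 := by
      rw [← AddMonoidHom.mem_ker, ← hn]
      exact AddSubgroup.subset_closure ⟨i, rfl⟩
    simp [monHom_single, this]

/-- A ring homomorphism from a group algebra with a diagonal automorphism, all of whose constants
are scalars, is injective if its kernel is stable and contains no nonzero scalar. -/
theorem injective_of_const {R : Type*} [CommRing R] {σ : RingAut F} {χ : Multiplicative G →* Fˣ}
    (hconst : ∀ f, twist σ χ f = f → ∃ c, f = algebraMap F _ c)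
    (τ : AddMonoidAlgebra F G →+* R) (hτ : ∀ f, τ f = 0 → τ (twist σ χ f) = 0)
    (hF : ∀ c : F, τ (algebraMap F _ c) = 0 → c = 0) : Function.Injective τ := by
  rw [injective_iff_map_eq_zero]
  intro f
  induction hN : f.coeff.support.card using Nat.strong_induction_on generalizing f with
  | _ N ih =>
  intro hf
  by_contra hne
  obtain ⟨g, hg⟩ : f.coeff.support.Nonempty := by
    rw [Finsupp.support_nonempty_iff]; simpa using hne
  have hg' : f.coeff g ≠ 0 := Finsupp.mem_support_iff.mp hg
  -- normalise the coefficient at `0`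
  set f₁ := single (-g) (f.coeff g)⁻¹ * f with hf₁
  have hc : ∀ h, f₁.coeff h = (f.coeff g)⁻¹ * f.coeff (g + h) := by
    intro h
    rw [hf₁, coeff_single_mul_apply, neg_neg]
  have hcard : f₁.coeff.support.card = N := by
    rw [← hN]
    refine Finset.card_bij (fun h _ => g + h) ?_ ?_ ?_
    · intro h hh
      simp only [Finsupp.mem_support_iff, hc] at hh ⊢
      exact right_ne_zero_of_mul hh
    · intro a _ b _ hab
      exact add_left_cancel hab
    · intro h hh
      refine ⟨h - g, ?_, by abel⟩
      simp only [Finsupp.mem_support_iff, hc] at hh ⊢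
      rw [add_sub_cancel]
      exact mul_ne_zero (inv_ne_zero hg') hh
  have hτ₁ : τ f₁ = 0 := by rw [hf₁, map_mul, hf, mul_zero]
  have h0 : f₁.coeff 0 = 1 := by rw [hc, add_zero, inv_mul_cancel₀ hg']
  -- The coefficient 1 at exponent 0 is fixed and cancels, and no new exponents arise because
  -- `twist` is diagonal. The shorter element is zero by induction, so f₁ is a constant, hence a
  -- scalar in the kernel.
  have hlt : (twist σ χ f₁ - f₁).coeff.support.card < N := by
    rw [← hcard]
    refine Finset.card_lt_card ⟨?_, ?_⟩
    · intro h hh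
      simp only [coeff_sub, Finsupp.mem_support_iff, Finsupp.sub_apply, coeff_twist] at hh ⊢
      intro h'
      simp [h'] at hh
    · intro hsub
      have : (0 : G) ∈ (twist σ χ f₁ - f₁).coeff.support := hsub (by simp [h0])
      simp [coeff_twist, h0] at this
  have hz := ih _ hlt (twist σ χ f₁ - f₁) rfl (by rw [map_sub, hτ _ hτ₁, hτ₁, sub_zero])
  obtain ⟨c, hc'⟩ := hconst f₁ (sub_eq_zero.mp hz)
  have : c = 0 := hF c (hc' ▸ hτ₁)
  rw [hc', this] at h0
  simp at h0

end MonHom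

end DiffRing

end

noncomputable section

namespace DiffRing

open Filter AddMonoidAlgebra

variable {F : Type*} [Field F]

/-! ### Sequences -/

section Seq

variable {K : Type*}

theorem toSeq_eq_iff {a b : ℕ → K} : toSeq a = toSeq b ↔ ∃ N, ∀ n, N ≤ n → a n = b n := by
  rw [toSeq, toSeq, Germ.coe_eq, EventuallyEq, eventually_atTop]

theorem exists_toSeq (x : SeqRing K) : ∃ a, x = toSeq a := by
  induction x using Quotient.inductionOn with
  | _ a => exact ⟨a, rfl⟩

theorem shift_toSeq (a : ℕ → K) : shift (toSeq a) = toSeq fun n => a (n + 1) := rfl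

theorem exists_const_of_shift_eq {x : SeqRing K} (h : shift x = x) :
    ∃ c : K, x = toSeq fun _ => c := by
  obtain ⟨a, rfl⟩ := exists_toSeq x
  rw [shift_toSeq, toSeq_eq_iff] at h
  obtain ⟨N, hN⟩ := h
  refine ⟨a N, toSeq_eq_iff.mpr ⟨N, fun n hn => ?_⟩⟩
  induction n, hn using Nat.le_induction with
  | base => rfl
  | succ n hn ih => rw [hN n hn, ih]

variable [Field K]

theorem toSeq_add (a b : ℕ → K) : toSeq (fun n => a n + b n) = toSeq a + toSeq b := rfl

theorem toSeq_mul (a b : ℕ → K) : toSeq (fun n => a n * b n) = toSeq a * toSeq b := rfl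

theorem toSeq_one : toSeq (fun _ => (1 : K)) = 1 := rfl

theorem shift_mul (x y : SeqRing K) : shift (x * y) = shift x * shift y := by
  obtain ⟨a, rfl⟩ := exists_toSeq x
  obtain ⟨b, rfl⟩ := exists_toSeq y
  rfl

theorem shift_one : shift (1 : SeqRing K) = 1 := rfl

/-- The shift as a monoid homomorphism. -/
def shiftHom : SeqRing K →* SeqRing K where
  toFun := shift
  map_one' := shift_one
  map_mul' := shift_mul

theorem shiftHom_apply (x : SeqRing K) : shiftHom x = shift x := rfl

theorem toSeq_const_ne_zero {c : K} (hc : c ≠ 0) : toSeq (fun _ : ℕ => c) ≠ 0 := by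
  intro h
  obtain ⟨N, hN⟩ := (toSeq_eq_iff (b := fun _ => 0)).mp h
  exact hc (hN N le_rfl)

/-- The unit `(1, ρ, ρ², …)`. -/
def geom (ρ : Kˣ) : (SeqRing K)ˣ where
  val := toSeq fun n => (ρ : K) ^ n
  inv := toSeq fun n => ((ρ⁻¹ : Kˣ) : K) ^ n
  val_inv := by rw [← toSeq_mul, ← toSeq_one]; congr 1; funext n; simp
  inv_val := by rw [← toSeq_mul, ← toSeq_one]; congr 1; funext n; simp

theorem val_geom (ρ : Kˣ) : (geom ρ : SeqRing K) = toSeq fun n => (ρ : K) ^ n := rfl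

/-- `geom` as a homomorphism. -/
def geomHom : Kˣ →* (SeqRing K)ˣ where
  toFun := geom
  map_one' := Units.ext (by rw [val_geom]; simp [toSeq_one])
  map_mul' a b := Units.ext (by
    rw [Units.val_mul, val_geom, val_geom, val_geom, ← toSeq_mul]
    congr 1; funext n; simp [mul_pow])

/-- The unit `(c, c, …)`. -/
def constSeq : Kˣ →* (SeqRing K)ˣ :=
  Units.map { toFun := fun c => toSeq fun _ => c, map_one' := rfl, map_mul' := fun _ _ => rfl }

theorem val_constSeq (c : Kˣ) : (constSeq c : SeqRing K) = toSeq fun _ => (c : K) := rfl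

theorem shift_geom (ρ : Kˣ) : Units.map shiftHom (geom ρ) = constSeq ρ * geom ρ := by
  refine Units.ext ?_
  rw [Units.coe_map, shiftHom_apply, val_geom, shift_toSeq, Units.val_mul, val_constSeq, val_geom,
    ← toSeq_mul]
  congr 1; funext n; rw [pow_succ']

theorem exists_constSeq_of_shift_eq {x : (SeqRing K)ˣ} (h : Units.map shiftHom x = x) :
    ∃ c : Kˣ, x = constSeq c := by
  obtain ⟨c, hc⟩ := exists_const_of_shift_eq (congrArg Units.val h)
  have hc0 : c ≠ 0 := by
    rintro rfl
    have h1 : (x : SeqRing K) = 0 := hc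
    have h2 := x.mul_inv
    rw [h1, zero_mul] at h2
    exact toSeq_const_ne_zero (one_ne_zero (α := K)) h2.symm
  exact ⟨Units.mk0 c hc0, Units.ext hc⟩

/-- The product starts at N + 1 and its factor with index k is a (k - 1), so the first factor is a N
and at n = N the product is empty. -/
theorem eq_prod_of_recurrence {a x : ℕ → K} {N : ℕ} (h : ∀ n, N ≤ n → x (n + 1) = a n * x n)
    {n : ℕ} (hn : N ≤ n) : x n = x N * ∏ k ∈ Finset.Icc (N + 1) n, a (k - 1) := by
  induction n, hn using Nat.le_induction with
  | base => simp
  | succ n hn ih =>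
    rw [h n hn, ih, ← Finset.insert_Icc_right_eq_Icc_add_one (by omega), Finset.prod_insert (by simp)]
    simp only [Nat.add_sub_cancel]
    ring

theorem ne_zero_of_isUnit_toSeq_mul {c : K} {p : ℕ → K} (h : IsUnit (toSeq fun n => c * p n)) :
    c ≠ 0 := by
  rintro rfl
  obtain ⟨y, hy⟩ := h.exists_right_inv
  obtain ⟨b, rfl⟩ := exists_toSeq y
  rw [← toSeq_mul, ← toSeq_one, toSeq_eq_iff] at hy
  obtain ⟨N, hN⟩ := hy
  simpa using hN N le_rfl

/-- The recurrence holds from some N on and is unrolled from there, with κ the value at N and l = N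
+ 1. Invertibility of X excludes κ = 0. -/
theorem exists_product_form {X : SeqRing K} (hX : IsUnit X) {a : ℕ → K}
    (h : shift X = toSeq a * X) : ∃ (κ : K) (l : ℕ), κ ≠ 0 ∧ 1 ≤ l ∧
      X = toSeq fun n => κ * ∏ k ∈ Finset.Icc l n, a (k - 1) := by
  obtain ⟨x, rfl⟩ := exists_toSeq X
  rw [shift_toSeq, ← toSeq_mul, toSeq_eq_iff] at h
  obtain ⟨N, hN⟩ := h
  have hx : toSeq x = toSeq fun n => x N * ∏ k ∈ Finset.Icc (N + 1) n, a (k - 1) :=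
    toSeq_eq_iff.mpr ⟨N, fun n hn => eq_prod_of_recurrence hN hn⟩
  exact ⟨x N, N + 1, ne_zero_of_isUnit_toSeq_mul (hx ▸ hX), by omega, hx⟩

end Seq

/-! ### Evaluation functions -/

section Eval

variable {σ : RingAut F} {A : Type*} [CommRing A] [Algebra F A] {σA : RingAut A}
  {τ : A →+* SeqRing (constField σ)} {ev : A → ℕ → constField σ}

theorem IsKHom.toSeq_pow (hτ : IsKHom σ σA τ) (hev : Represents ev τ) (f : A) (m : ℕ) :
    toSeq (ev ((σA ^ m) f)) = toSeq fun n => ev f (n + m) := by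
  induction m with
  | zero => simp
  | succ m ih =>
    rw [pow_succ', RingAut.mul_apply, ← hev, hτ.map_shift, hev, ih, shift_toSeq]
    congr 1; funext n; congr 1; omega

/-- An identity in the ring of sequences is an identity of representatives from some point on, so
any choice of representatives is an evaluation function. -/
theorem IsKHom.isEvalFun (hτ : IsKHom σ σA τ) (hev : Represents ev τ) : IsEvalFun σ σA ev where
  map_const c := by
    rw [← toSeq_eq_iff (b := fun _ => c), ← hev, hτ.map_const]
  map_add f g := by
    rw [← toSeq_eq_iff (b := fun n => ev f n + ev g n), ← hev, map_add, hev, hev, toSeq_add]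
  map_mul f g := by
    rw [← toSeq_eq_iff (b := fun n => ev f n * ev g n), ← hev, map_mul, hev, hev, toSeq_mul]
  map_shift f k := by
    obtain ⟨m, rfl | rfl⟩ := k.eq_nat_or_neg
    · obtain ⟨N, hN⟩ := toSeq_eq_iff.mp (hτ.toSeq_pow hev f m)
      refine ⟨N, fun n hn m' hm' => ?_⟩
      rw [zpow_natCast, hN n hn]
      congr 1; omega
    -- A negative power is handled by applying the nonnegative case to g = σ^{-m} f and reading the
    -- result backwards; the bound N + m keeps the shifted index at least N.
    · set g := (σA ^ (-(m : ℤ))) f with hg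
      have hfg : (σA ^ m) g = f := by
        rw [hg, ← zpow_natCast, ← RingAut.mul_apply, ← zpow_add, add_neg_cancel, zpow_zero]
        rfl
      obtain ⟨N, hN⟩ := toSeq_eq_iff.mp (hτ.toSeq_pow hev g m)
      rw [hfg] at hN
      refine ⟨N + m, fun n hn m' hm' => ?_⟩
      rw [hN m' (by omega)]
      congr 1; omega

end Eval

theorem algebraMap_eq_single {s l : ℕ} {ord : Fin l → ℕ} (f : F) :
    algebraMap F (APRing F s ord) f = single 0 f := by
  simp

/-- Representatives may be chosen freely for each element separately, so the prescribed ones can be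
taken on F, on the x_i and on z. The prescriptions do not conflict because scalars, Laurent
variables and z are pairwise distinct. -/
theorem hasProductEval_of_toSeq {σ : RingAut F} {τ₀ : F →+* SeqRing (constField σ)}
    {ev : F → ℕ → constField σ} (hev : Represents ev τ₀) {r s u : ℕ} {D : RepData F r s u}
    {σH : RingAut (HRing F s D.d)} {τH : HRing F s D.d →+* SeqRing (constField σ)}
    (hτ : IsKHom σ σH τH) (hτ₀ : ∀ f : F, τH (algebraMap F _ f) = τ₀ f)
    {ρ : constField σ} (hρ : (ρ : F) = D.ρ)
    (hz : ∀ j, τH (zVar j) = toSeq fun n => ρ ^ n)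
    {κ : Fin s → constField σ} {l : Fin s → ℕ} (hκ : ∀ i, κ i ≠ 0) (hl : ∀ i, 1 ≤ l i)
    (hx : ∀ i, τH (xVar i) =
      toSeq fun n => κ i * ∏ k ∈ Finset.Icc (l i) n, ev (D.α i : F) (k - 1)) :
    HasProductEval σ ev D σH τH κ l := by
  refine ⟨hκ, hl, ?_⟩
  -- An index j exists only if d ≠ 1, and then 1 ≠ 0 in ℤ/d; hence z is neither a scalar nor
  -- confused with a Laurent monomial.
  have hzne : ∀ j : Fin (if D.d = 1 then 0 else 1),
      (Pi.single j (1 : ZMod D.d) : (j : Fin (if D.d = 1 then 0 else 1)) → ZMod D.d) ≠ 0 := by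
    intro j h
    have h1 : (1 : ZMod D.d) = 0 := by simpa using congrFun h j
    have hd : D.d ≠ 1 := by
      intro hd
      have := j.isLt
      simp [hd] at this
    exact hd (ZMod.one_eq_zero_iff.mp h1)
  have key : ∀ f : HRing F s D.d, ∃ a : ℕ → constField σ, τH f = toSeq a ∧
      (∀ c : F, f = algebraMap F _ c → a = ev c) ∧
      (∀ i, f = xVar i → a = fun n => κ i * ∏ k ∈ Finset.Icc (l i) n, ev (D.α i : F) (k - 1)) ∧
      (∀ j, f = zVar j → a = fun n => ρ ^ n) := by
    intro f
    by_cases h1 : ∃ c : F, f = algebraMap F _ c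
    · obtain ⟨c, rfl⟩ := h1
      refine ⟨ev c, by rw [hτ₀, hev], ?_, ?_, ?_⟩
      · intro c' h
        rw [algebraMap_eq_single, algebraMap_eq_single, single_right_inj] at h
        rw [h]
      · intro i h
        rw [algebraMap_eq_single, xVar, mono, single_inj] at h
        simp only [Prod.ext_iff, Prod.fst_zero, one_ne_zero, and_false, or_false] at h
        exact absurd (congrFun h.1.1 i) (by simp)
      · intro j h
        rw [algebraMap_eq_single, zVar, mono, single_inj] at h
        simp only [Prod.ext_iff, Prod.fst_zero, Prod.snd_zero, one_ne_zero, and_false, or_false]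
          at h
        exact absurd h.1.2.symm (hzne j)
    by_cases h2 : ∃ i, f = xVar i
    · obtain ⟨i, rfl⟩ := h2
      refine ⟨_, hx i, fun c h => absurd ⟨c, h⟩ h1, ?_, ?_⟩
      · intro i' h
        rw [xVar, xVar, mono, mono, single_left_inj one_ne_zero, Prod.ext_iff] at h
        have : i = i' := by
          by_contra hne
          have := congrFun h.1 i
          simp [hne] at this
        rw [this]
      · intro j h
        rw [xVar, zVar, mono, mono, single_left_inj one_ne_zero, Prod.ext_iff] at h
        exact absurd h.2.symm (hzne j)
    by_cases h3 : ∃ j, f = zVar j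
    · obtain ⟨j, rfl⟩ := h3
      exact ⟨_, hz j, fun c h => absurd ⟨c, h⟩ h1, fun i h => absurd ⟨i, h⟩ h2, fun _ _ => rfl⟩
    obtain ⟨a, ha⟩ := exists_toSeq (τH f)
    exact ⟨a, ha, fun c h => absurd ⟨c, h⟩ h1, fun i h => absurd ⟨i, h⟩ h2,
      fun j h => absurd ⟨j, h⟩ h3⟩
  choose ev' h0 h1 h2 h3 using key
  have hrep : Represents ev' τH := h0
  refine ⟨ev', hτ.isEvalFun hrep, hrep, fun f n => ?_, fun i n => ?_, fun j n => ?_⟩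
  · rw [h1 _ f rfl]
  · rw [h2 _ i rfl]
  · rw [h3 _ j rfl, ← hρ]
    simp

end DiffRing

end

noncomputable section

namespace DiffRing

open Filter AddMonoidAlgebra

variable {F : Type*} [Field F]

/-! ### Unipotent maps of `ℤ^e` -/

section Unipotent

variable {e : ℕ} {T : Matrix (Fin e) (Fin e) ℤ}

/-- The map `m ↦ m + m T`; it is unipotent if `T` is strictly lower triangular. -/
def unip (T : Matrix (Fin e) (Fin e) ℤ) : (Fin e → ℤ) →+ (Fin e → ℤ) :=
  AddMonoidHom.mk' (fun m => m + Matrix.vecMul m T) fun a b => by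
    rw [Matrix.add_vecMul]; abel

theorem unip_apply (m : Fin e → ℤ) : unip T m = m + Matrix.vecMul m T := rfl

/-- Strict lower triangularity lets row k influence only coordinates below k. If v vanishes above i,
nothing reaches the coordinates from i upwards. -/
theorem unip_apply_of_top (hT : ∀ i j, i ≤ j → T i j = 0) {v : Fin e → ℤ} {i : Fin e}
    (hv : ∀ j, i < j → v j = 0) {j : Fin e} (hj : i ≤ j) : unip T v j = v j := by
  rw [unip_apply, Pi.add_apply, add_eq_left]
  change ∑ k, v k * T k j = 0
  refine Finset.sum_eq_zero fun k _ => ?_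
  rcases le_or_gt k j with h | h
  · rw [hT k j h, mul_zero]
  · rw [hv k (hj.trans_lt h), zero_mul]

theorem exists_top {v : Fin e → ℤ} (hv : v ≠ 0) : ∃ i, v i ≠ 0 ∧ ∀ j, i < j → v j = 0 := by
  classical
  have hne : (Finset.univ.filter fun i => v i ≠ 0).Nonempty := by
    obtain ⟨i, hi⟩ := Function.ne_iff.mp hv
    exact ⟨i, by simpa using hi⟩
  refine ⟨_, (Finset.mem_filter.mp (Finset.max'_mem _ hne)).2, fun j hj => ?_⟩
  by_contra h
  exact absurd (Finset.le_max' _ j (by simpa using h)) (not_le.mpr hj)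

theorem unip_injective (hT : ∀ i j, i ≤ j → T i j = 0) : Function.Injective (unip T) := by
  rw [injective_iff_map_eq_zero]
  intro v hv
  by_contra hne
  obtain ⟨i, hi, htop⟩ := exists_top hne
  have := unip_apply_of_top hT htop le_rfl
  rw [hv] at this
  exact hi this.symm

/-- A unipotent integer matrix fixes every vector with a finite orbit. -/
theorem unip_eq_self (hT : ∀ i j, i ≤ j → T i j = 0) {S : Set (Fin e → ℤ)} (hS : S.Finite)
    {m : Fin e → ℤ} (hm : ∀ n : ℕ, (unip T)^[n] m ∈ S) : unip T m = m := by
  by_contra hne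
  set v := unip T m - m with hv
  have hv0 : v ≠ 0 := sub_ne_zero.mpr hne
  obtain ⟨i, hi, htop⟩ := exists_top hv0
  -- The top nonzero coordinate of v = T m survives all iterations. Therefore coordinate i of the
  -- orbit of m grows linearly in n, and the orbit is infinite.
  have h1 : ∀ (n : ℕ) (j : Fin e), i ≤ j → (unip T)^[n] v j = v j := by
    intro n
    induction n with
    | zero => intro j _; rfl
    | succ n ih =>
      intro j hj
      rw [Function.iterate_succ_apply', unip_apply_of_top hT (fun k hk => ?_) hj, ih j hj]
      rw [ih k hk.le, htop k hk]
  have h2 : ∀ n : ℕ, (unip T)^[n] m i = m i + n * v i := by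
    intro n
    induction n with
    | zero => simp
    | succ n ih =>
      have : unip T m = m + v := by rw [hv]; abel
      rw [Function.iterate_succ_apply, this, iterate_map_add, Pi.add_apply, ih, h1 n i le_rfl]
      push_cast; ring
  have hinj : Function.Injective fun n : ℕ => (unip T)^[n] m := by
    intro a b hab
    have := congrFun hab i
    simp only [h2] at this
    have := mul_right_cancel₀ hi (add_left_cancel this)
    exact_mod_cast this
  exact Set.infinite_of_injective_forall_mem hinj hm hS

end Unipotent

/-! ### Nested `RΠ`-extensions -/

section Nested

variable {s l : ℕ} {ord : Fin l → ℕ}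

/-- The subalgebra is generated by monomials whose exponents form a subgroup, so supports stay
inside that subgroup. -/
theorem coeff_eq_zero_of_mem_lowerRing {i : Fin s} {β : APRing F s ord}
    (hβ : β ∈ lowerRing F ord i) :
    ∀ g ∈ β.coeff.support, g.2 = 0 ∧ ∀ j, i ≤ j → g.1 j = 0 := by
  classical
  induction hβ using Algebra.adjoin_induction with
  | mem x hx =>
    obtain ⟨m, hm, rfl⟩ := hx
    intro g hg
    have := Finsupp.support_single_subset hg
    rw [Finset.mem_singleton] at this
    subst this
    exact ⟨rfl, hm⟩
  | algebraMap c =>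
    intro g hg
    rw [algebraMap_eq_single] at hg
    have := Finsupp.support_single_subset hg
    rw [Finset.mem_singleton] at this
    subst this
    exact ⟨rfl, fun _ _ => rfl⟩
  | add x y _ _ hx hy =>
    intro g hg
    rcases Finset.mem_union.mp (Finsupp.support_add hg) with h | h
    · exact hx g h
    · exact hy g h
  | mul x y _ _ hx hy =>
    intro g hg
    obtain ⟨a, ha, b, hb, rfl⟩ := Finset.mem_add.mp (support_coeff_mul_subset x y hg)
    refine ⟨by simp [(hx a ha).1, (hy b hb).1], fun j hj => ?_⟩
    simp [(hx a ha).2 j hj, (hy b hb).2 j hj]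

/-- The units of `F⟨x₁⟩…⟨x_{i-1}⟩` are the monomials. -/
theorem eq_single_of_mul_eq_one {i : Fin s} {β β' : APRing F s ord} (hβ : β ∈ lowerRing F ord i)
    (hβ' : β' ∈ lowerRing F ord i) (h : β * β' = 1) :
    ∃ (t : Fin s → ℤ) (b : Fˣ), (∀ j, i ≤ j → t j = 0) ∧ β = single (t, 0) (b : F) := by
  classical
  have h1 := coeff_eq_zero_of_mem_lowerRing hβ
  have h2 := coeff_eq_zero_of_mem_lowerRing hβ'
  have hne : β ≠ 0 := left_ne_zero_of_mul_eq_one h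
  have hne' : β' ≠ 0 := right_ne_zero_of_mul_eq_one h
  have hpos : 0 < β.coeff.support.card := by
    rw [Finset.card_pos, Finsupp.support_nonempty_iff]; simpa using hne
  have hpos' : 0 < β'.coeff.support.card := by
    rw [Finset.card_pos, Finsupp.support_nonempty_iff]; simpa using hne'
  -- Unique sums are available in ℤ^s but not in its product with a torsion group. On these supports
  -- the torsion component is 0, so nothing is lost by projecting to ℤ^s.
  have hinj : ∀ {γ : APRing F s ord}, (∀ g ∈ γ.coeff.support, g.2 = 0 ∧ ∀ j, i ≤ j → g.1 j = 0) →
      Set.InjOn Prod.fst (γ.coeff.support : Set _) :=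
    fun hγ a ha b hb hab => Prod.ext hab ((hγ a ha).1.trans (hγ b hb).1.symm)
  have hcard : β.coeff.support.card ≤ 1 := by
    by_contra hcard
    -- With more than one term in β there are two distinct pairs of exponents whose sums are
    -- attained only once. Each contributes a nonzero coefficient to β β' = 1, so both sums are 0,
    -- contradicting uniqueness.
    obtain ⟨p, hp, q, hq, hpq, up, uq⟩ := TwoUniqueSums.uniqueAdd_of_one_lt_card
      (A := β.coeff.support.image Prod.fst) (B := β'.coeff.support.image Prod.fst) (by
        rw [Finset.card_image_of_injOn (hinj h1), Finset.card_image_of_injOn (hinj h2)]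
        nlinarith)
    have key : ∀ p ∈ β.coeff.support.image Prod.fst ×ˢ β'.coeff.support.image Prod.fst,
        UniqueAdd (β.coeff.support.image Prod.fst) (β'.coeff.support.image Prod.fst) p.1 p.2 →
        p.1 + p.2 = 0 := by
      rintro ⟨p1, p2⟩ hp up
      simp only [Finset.mem_product, Finset.mem_image] at hp
      obtain ⟨⟨a, ha, rfl⟩, ⟨b, hb, rfl⟩⟩ := hp
      have hu : UniqueAdd β.coeff.support β'.coeff.support a b := by
        intro x y hx hy hxy
        obtain ⟨e1, e2⟩ := up (Finset.mem_image_of_mem _ hx) (Finset.mem_image_of_mem _ hy)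
          (congrArg Prod.fst hxy)
        exact ⟨hinj h1 hx ha e1, hinj h2 hy hb e2⟩
      have hco := coeff_mul_add_of_uniqueAdd hu
      rw [h, AddMonoidAlgebra.one_def, coeff_single] at hco
      by_contra hab
      rw [Finsupp.single_eq_of_ne (by
        intro h0
        exact hab (congrArg Prod.fst h0))] at hco
      exact mul_ne_zero (Finsupp.mem_support_iff.mp ha) (Finsupp.mem_support_iff.mp hb) hco.symm
    have hp0 := key p hp up
    have hq0 := key q hq uq
    obtain ⟨e1, e2⟩ := up (Finset.mem_product.mp hq).1 (Finset.mem_product.mp hq).2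
      (hq0.trans hp0.symm)
    exact hpq (Prod.ext e1.symm e2.symm)
  obtain ⟨g, hg⟩ := Finset.card_eq_one.mp (le_antisymm hcard hpos)
  have hgm : g ∈ β.coeff.support := hg ▸ Finset.mem_singleton_self g
  have hg0 : β.coeff g ≠ 0 := Finsupp.mem_support_iff.mp hgm
  refine ⟨g.1, Units.mk0 (β.coeff g) hg0, (h1 g hgm).2, ?_⟩
  have : ((g.1, 0) : (Fin s → ℤ) × ((j : Fin l) → ZMod (ord j))) = g :=
    Prod.ext rfl (h1 g hgm).1.symm
  rw [this, ← AddMonoidAlgebra.coeff_inj, coeff_single, Units.val_mk0]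
  exact Finsupp.support_eq_singleton.mp hg |>.2

variable {σ : RingAut F} {σ' : RingAut (APRing F s ord)}

/-- The action of the automorphism of a nested extension on monomials. -/
theorem IsAPExtension.exists_unip (h : IsAPExtension σ σ') :
    ∃ T : Matrix (Fin s) (Fin s) ℤ, (∀ i j, i ≤ j → T i j = 0) ∧
      ∀ g, ∃ c : Fˣ, σ' (single g 1) = single (unip T g.1, g.2) (c : F) := by
  have hx : ∀ i, ∃ (t : Fin s → ℤ) (b : Fˣ), (∀ j, i ≤ j → t j = 0) ∧
      σ' (xVar i) = single (t + Pi.single i 1, 0) (b : F) := by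
    intro i
    obtain ⟨β, hβ, β', hβ', h1, h2⟩ := h.map_x i
    obtain ⟨t, b, ht, rfl⟩ := eq_single_of_mul_eq_one hβ hβ' h1
    refine ⟨t, b, ht, ?_⟩
    rw [h2, xVar, mono, AddMonoidAlgebra.single_mul_single]
    simp
  obtain ⟨T, b, hT, hσ⟩ : ∃ (T : Matrix (Fin s) (Fin s) ℤ) (b : Fin s → Fˣ),
      (∀ i j, i ≤ j → T i j = 0) ∧
        ∀ i, σ' (xVar i) = single (T.row i + Pi.single i 1, 0) (b i : F) := by
    choose T b hT hσ using hx
    exact ⟨T, b, hT, hσ⟩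
  refine ⟨T, hT, ?_⟩
  -- The exponents with the claimed property form a subgroup, so it suffices to treat the exponents
  -- of the x_i and the z_j.
  let Q : AddSubgroup ((Fin s → ℤ) × ((j : Fin l) → ZMod (ord j))) :=
    { carrier := {g | ∃ c : Fˣ, σ' (single g 1) = single (unip T g.1, g.2) (c : F)}
      zero_mem' := ⟨1, by
        have h0 : ((unip T 0, 0) : (Fin s → ℤ) × ((j : Fin l) → ZMod (ord j))) = 0 := by simp
        change σ' (single 0 1) = single (unip T 0, 0) _
        rw [h0]
        simp [← AddMonoidAlgebra.one_def]⟩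
      add_mem' := by
        rintro a a' ⟨c, hc⟩ ⟨c', hc'⟩
        refine ⟨c * c', ?_⟩
        have : (single (a + a') 1 : APRing F s ord) = single a 1 * single a' 1 := by
          simp [AddMonoidAlgebra.single_mul_single]
        rw [this, map_mul, hc, hc', AddMonoidAlgebra.single_mul_single]
        simp
      neg_mem' := by
        rintro a ⟨c, hc⟩
        refine ⟨c⁻¹, ?_⟩
        have e1 : σ' (single (-a) 1) * σ' (single a 1) = 1 := by
          rw [← map_mul, AddMonoidAlgebra.single_mul_single]
          simp [← AddMonoidAlgebra.one_def]
        have e2 : (single (unip T a.1, a.2) (c : F) : APRing F s ord) *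
            single (unip T (-a).1, (-a).2) ((c⁻¹ : Fˣ) : F) = 1 := by
          rw [AddMonoidAlgebra.single_mul_single, AddMonoidAlgebra.one_def]
          congr 1 <;> simp
        rw [hc] at e1
        exact left_inv_eq_right_inv e1 e2 }
  intro g
  have hxQ : ∀ i, ((Pi.single i 1, 0) : (Fin s → ℤ) × ((j : Fin l) → ZMod (ord j))) ∈ Q := by
    intro i
    refine ⟨b i, ?_⟩
    have := hσ i
    rw [xVar, mono] at this
    rw [this]
    change _ = single (unip T (Pi.single i 1), 0) _
    rw [unip_apply, Matrix.single_one_vecMul, add_comm]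
  have hzQ : ∀ j, ((0, Pi.single j 1) : (Fin s → ℤ) × ((j : Fin l) → ZMod (ord j))) ∈ Q := by
    intro j
    obtain ⟨ρ, hρ, h2⟩ := h.map_z j
    have hρ' : (ρ : F) ≠ 0 := by simpa using hρ
    refine ⟨Units.mk0 (ρ : F) hρ', ?_⟩
    rw [zVar, mono] at h2
    rw [h2, algebraMap_eq_single, AddMonoidAlgebra.single_mul_single]
    simp
  have hg : g = ∑ i, g.1 i • ((Pi.single i 1, 0) : (Fin s → ℤ) × ((j : Fin l) → ZMod (ord j))) +
      ∑ j, ((g.2 j).cast : ℤ) • ((0, Pi.single j 1) : (Fin s → ℤ) × ((j : Fin l) → ZMod (ord j))) := by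
    refine Prod.ext ?_ ?_
    · simp only [Prod.fst_add, Prod.fst_sum, Prod.smul_fst, smul_zero, Finset.sum_const_zero,
        add_zero]
      funext k
      simp [Finset.sum_apply, Pi.single_apply]
    · simp only [Prod.snd_add, Prod.snd_sum, Prod.smul_snd, smul_zero, Finset.sum_const_zero,
        zero_add]
      funext k
      rw [Finset.sum_apply, Finset.sum_eq_single k]
      · simp
      · intro j _ hj
        simp [hj.symm]
      · simp
  have : g ∈ Q := by
    rw [hg]
    exact Q.add_mem (Q.sum_mem fun i _ => Q.zsmul_mem (hxQ i) _)
      (Q.sum_mem fun j _ => Q.zsmul_mem (hzQ j) _)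
  exact this

/-- Every solution of `σ' w = a w` in a nested extension has a monomial that is itself a solution. -/
theorem IsAPExtension.exists_single (h : IsAPExtension σ σ') {a : Fˣ} {w : APRing F s ord}
    (hw : w ≠ 0) (haw : σ' w = algebraMap F _ (a : F) * w) :
    ∃ g, ∃ f : Fˣ, σ' (single g (f : F)) = single g (a * f : F) := by
  obtain ⟨T, hT, hσ⟩ := h.exists_unip
  choose c hc using hσ
  have hsingle : ∀ g x, σ' (single g x) = single (unip T g.1, g.2) (σ x * c g) := by
    intro g x
    have : (single g x : APRing F s ord) = algebraMap F _ x * single g 1 := by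
      rw [algebraMap_eq_single, AddMonoidAlgebra.single_mul_single]; simp
    rw [this, map_mul, h.map_base, hc, algebraMap_eq_single, AddMonoidAlgebra.single_mul_single]
    simp
  have hinj : Function.Injective fun g : (Fin s → ℤ) × ((j : Fin l) → ZMod (ord j)) =>
      (unip T g.1, g.2) := by
    intro g g' hg
    obtain ⟨h1, h2⟩ := Prod.mk.inj hg
    exact Prod.ext (unip_injective hT h1) h2
  have hcoeff : ∀ (f : APRing F s ord) g,
      (σ' f).coeff (unip T g.1, g.2) = σ (f.coeff g) * c g := by
    intro f g
    induction f using AddMonoidAlgebra.induction_linear with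
    | zero => simp
    | add a b ha hb => simp [ha, hb, add_mul]
    | single k x =>
      rw [hsingle]
      by_cases hk : k = g
      · subst hk; simp
      · have : (unip T k.1, k.2) ≠ (unip T g.1, g.2) := fun h => hk (hinj h)
        rw [coeff_single, coeff_single, Finsupp.single_eq_of_ne this.symm,
          Finsupp.single_eq_of_ne (Ne.symm hk)]
        simp
  -- Comparison of coefficients in σ' w = a w. It shows that the support of w is closed under g ↦
  -- (`unip T g.1`, g.2), so the orbit of the Laurent part of an exponent is finite and that part is
  -- fixed.
  have hrel : ∀ g, σ (w.coeff g) * c g = a * w.coeff (unip T g.1, g.2) := by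
    intro g
    rw [← hcoeff, haw, algebraMap_eq_single, coeff_single_mul_apply]
    simp
  obtain ⟨g, hg⟩ : w.coeff.support.Nonempty := by
    rw [Finsupp.support_nonempty_iff]; simpa using hw
  have hclosed : ∀ n : ℕ, ((unip T)^[n] g.1, g.2) ∈ w.coeff.support := by
    intro n
    induction n with
    | zero => exact hg
    | succ n ih =>
      rw [Finsupp.mem_support_iff] at ih ⊢
      rw [Function.iterate_succ_apply']
      have := hrel ((unip T)^[n] g.1, g.2)
      intro h0
      rw [h0, mul_zero] at this
      exact mul_ne_zero ((map_ne_zero σ).mpr ih) (c _).ne_zero this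
  have hfix : unip T g.1 = g.1 := by
    refine unip_eq_self hT (S := Prod.fst '' (w.coeff.support : Set _))
      (w.coeff.support.finite_toSet.image _) fun n => ⟨((unip T)^[n] g.1, g.2), hclosed n, rfl⟩
  refine ⟨g, Units.mk0 _ (Finsupp.mem_support_iff.mp hg), ?_⟩
  rw [hsingle, Units.val_mk0, hrel, hfix]

/-- Representing solutions of `σ x_i = α_i x_i` in an `RΠ`-extension realizes the module of
multiplicative relations as the kernel of a map to the exponents. -/
theorem IsRPiExtension.exists_ker_eq (h : IsRPiExtension σ σ') {r : ℕ} {α : Fin r → Fˣ}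
    {w : Fin r → APRing F s ord} (hw : ∀ i, w i ≠ 0)
    (haw : ∀ i, σ' (w i) = algebraMap F _ (α i : F) * w i) :
    ∃ ψ : (Fin r → ℤ) →+ (Fin s → ℤ) × ((j : Fin l) → ZMod (ord j)),
      ∀ n, n ∈ multRel σ α ↔ ψ n = 0 := by
  choose g f hgf using fun i => h.exists_single (hw i) (haw i)
  -- Terms c·y^g with c ≠ 0 are units and depend multiplicatively on (c, g); power products of the
  -- chosen term solutions can thus be computed separately in coefficients and exponents.
  let triv : Fˣ × Multiplicative ((Fin s → ℤ) × ((j : Fin l) → ZMod (ord j))) →*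
      (APRing F s ord)ˣ :=
    MonoidHom.toHomUnits
      { toFun := fun p => single p.2.toAdd (p.1 : F)
        map_one' := rfl
        map_mul' := fun p q => by simp [AddMonoidAlgebra.single_mul_single] }
  have htriv : ∀ p, (triv p : APRing F s ord) = single p.2.toAdd (p.1 : F) := fun _ => rfl
  let ψ : (Fin r → ℤ) →+ (Fin s → ℤ) × ((j : Fin l) → ZMod (ord j)) :=
    AddMonoidHom.toMultiplicative.symm (pwHom fun i => Multiplicative.ofAdd (g i))
  have hpw : ∀ n, pw (fun i => triv (f i, .ofAdd (g i))) n = triv (pw f n, .ofAdd (ψ n)) := by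
    intro n
    rw [← map_pw]
    congr 1
    refine Prod.ext ?_ ?_
    · simp [pw, Prod.fst_prod]
    · simp only [pw, Prod.snd_prod]
      rfl
  have hσ : ∀ n, σ' (single (ψ n) ((pw f n : Fˣ) : F)) =
      single (ψ n) (((pw α n : Fˣ) : F) * ((pw f n : Fˣ) : F)) := by
    intro n
    have h1 : ∀ i, onUnits σ' (triv (f i, .ofAdd (g i))) =
        triv (α i, 1) * triv (f i, .ofAdd (g i)) := by
      intro i
      refine Units.ext ?_
      rw [Units.coe_map, ← map_mul, htriv, htriv]
      simpa using hgf i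
    have h2 := map_pw (onUnits σ') (fun i => triv (f i, .ofAdd (g i))) n
    simp only [h1] at h2
    have h3 : pw (fun i => triv (α i, 1) * triv (f i, .ofAdd (g i))) n =
        pw (fun i => triv (α i, 1)) n * pw (fun i => triv (f i, .ofAdd (g i))) n := pw_mul _ _ n
    have h4 : pw (fun i => triv (α i, 1)) n = triv (pw α n, 1) := by
      have := map_pw (triv.comp (MonoidHom.inl _ _)) α n
      exact this.symm
    rw [h3, h4, hpw, ← map_mul] at h2
    have h5 := congrArg Units.val h2
    rw [Units.coe_map, htriv, htriv] at h5
    simpa using h5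
  refine ⟨ψ, fun n => ?_⟩
  rw [mem_multRel]
  constructor
  · rintro ⟨x, hx⟩
    -- If x ∈ F^* solves the same equation as the term with exponent ψ n, their quotient is a
    -- constant of the extension. It then lies in K, which forces ψ n = 0.
    have hconst : σ' (single (ψ n) (((pw f n : Fˣ) : F) * (x⁻¹ : Fˣ))) =
        single (ψ n) (((pw f n : Fˣ) : F) * (x⁻¹ : Fˣ)) := by
      have e : (single (ψ n) (((pw f n : Fˣ) : F) * (x⁻¹ : Fˣ)) : APRing F s ord) =
          algebraMap F _ ((x⁻¹ : Fˣ) : F) * single (ψ n) ((pw f n : Fˣ) : F) := by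
        rw [algebraMap_eq_single, AddMonoidAlgebra.single_mul_single, zero_add, mul_comm]
      rw [e, map_mul, h.map_base, hσ, algebraMap_eq_single, algebraMap_eq_single,
        AddMonoidAlgebra.single_mul_single, AddMonoidAlgebra.single_mul_single]
      congr 1
      have hx' := congrArg Units.val hx
      simp only [Units.coe_map, MonoidHom.coe_coe, Units.val_mul] at hx'
      rw [Units.val_inv_eq_inv_val, map_inv₀, hx']
      field_simp
    obtain ⟨k, _, hk⟩ := (h.const_eq _).mp hconst
    rw [algebraMap_eq_single, single_inj] at hk
    rcases hk with hk | hk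
    · exact hk.1.symm
    · exact absurd hk.2 (mul_ne_zero (Units.ne_zero _) (Units.ne_zero _))
  -- When the exponent is 0 the term solution is a scalar, and its coefficient witnesses the
  -- relation in F.
  · intro hn
    refine ⟨pw f n, Units.ext ?_⟩
    have := hσ n
    rw [hn, ← algebraMap_eq_single, h.map_base, algebraMap_eq_single, single_right_inj] at this
    simpa using this

/-- In an `RΠ`-extension the orders of the `R`-monomials are pairwise coprime. -/
theorem IsRPiExtension.lcm_eq_prod (h : IsRPiExtension σ σ') :
    Finset.univ.lcm ord = ∏ j, ord j := by
  have hord : ∀ j, NeZero (ord j) := fun j => ⟨(zero_lt_one.trans (h.one_lt_ord j)).ne'⟩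
  obtain ⟨T, -, hσ⟩ := h.exists_unip
  have hc' : ∀ k : (j : Fin l) → ZMod (ord j), ∃ c : Fˣ,
      σ' (single (0, k) 1) = single (0, k) (c : F) := by
    intro k
    obtain ⟨c, hc⟩ := hσ (0, k)
    exact ⟨c, by simpa using hc⟩
  choose c hc using hc'
  -- The character k ↦ σ'(z^k)/z^k. An element of its kernel gives a constant monomial, which lies
  -- in K only for k = 0.
  let f : Multiplicative ((j : Fin l) → ZMod (ord j)) →* F :=
    { toFun := fun k => c k.toAdd
      map_one' := by
        have := hc 0
        have h0 : ((0, 0) : (Fin s → ℤ) × ((j : Fin l) → ZMod (ord j))) = 0 := rfl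
        rw [h0, ← AddMonoidAlgebra.one_def, map_one, AddMonoidAlgebra.one_def,
          single_right_inj] at this
        exact this.symm
      map_mul' := fun a b => by
        have h1 := hc (a.toAdd + b.toAdd)
        have : (single (0, a.toAdd + b.toAdd) 1 : APRing F s ord) =
            single (0, a.toAdd) 1 * single (0, b.toAdd) 1 := by
          simp [AddMonoidAlgebra.single_mul_single]
        rw [this, map_mul, hc, hc, AddMonoidAlgebra.single_mul_single, Prod.mk_add_mk, zero_add,
          single_right_inj] at h1
        exact h1.symm }
  have hf : Function.Injective f := by
    rw [injective_iff_map_eq_one]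
    intro k hk
    have h1 := hc k.toAdd
    have h2 : (c k.toAdd : F) = 1 := hk
    rw [h2] at h1
    obtain ⟨x, _, hx⟩ := (h.const_eq _).mp h1
    rw [algebraMap_eq_single, single_inj] at hx
    rcases hx with hx | hx
    · have := (congrArg Prod.snd hx.1).symm
      exact this
    · exact absurd hx.2 one_ne_zero
  -- A finite group embedded in the multiplicative monoid of a field is cyclic, so its exponent
  -- equals its order; the exponent divides the lcm.
  have hcyc : IsCyclic (Multiplicative ((j : Fin l) → ZMod (ord j))) :=
    isCyclic_of_injective_ringHom f hf
  have hcard : Nat.card (Multiplicative ((j : Fin l) → ZMod (ord j))) = ∏ j, ord j := by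
    rw [Nat.card_congr Multiplicative.toAdd, Nat.card_pi]
    simp
  refine Nat.dvd_antisymm (Finset.lcm_dvd fun j hj => Finset.dvd_prod_of_mem ord hj) ?_
  rw [← hcard, ← IsCyclic.exponent_eq_card]
  refine Monoid.exponent_dvd_of_forall_pow_eq_one fun k => ?_
  rw [← toAdd_eq_zero, toAdd_pow]
  funext j
  have : ord j ∣ Finset.univ.lcm ord := Finset.dvd_lcm (Finset.mem_univ j)
  rw [Pi.smul_apply, nsmul_eq_mul, (ZMod.natCast_eq_zero_iff _ _).mpr this, zero_mul]
  rfl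

end Nested

/-- A criterion for the minimality of a representation. -/
theorem isMinimal_of_rel {σ : RingAut F} {τ₀ : F →+* SeqRing (constField σ)} {r : ℕ}
    {α : Fin r → Fˣ} {σE : RingAut (PRing F r)} {τE : PRing F r →+* SeqRing (constField σ)}
    (hE : IsPExtension σ α σE) (hτE : ∀ f : F, τE (algebraMap F _ f) = τ₀ f) {s d : ℕ}
    (M : (Fin r → ℤ) →+ (Fin s → ℤ)) (hM : ∀ n ∈ multRel σ α, M n = 0)
    (v : Fin s → Fin r → ℤ) (hv : ∀ j, M (v j) = Pi.single j 1)
    (vz : Fin r → ℤ) (hvz : (d : ℤ) • vz ∈ multRel σ α)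
    (hvz' : ∀ k : ℕ, (k : ℤ) • vz ∈ multRel σ α → d ∣ k) :
    IsMinimal σ τ₀ σE τE s d := by
  intro e l ord σ' τ' lam' hR hemb hτ' hlam hcomm
  -- Injectivity of τ' forces any such λ' to be the identity on F.
  have hbase : ∀ f : F, lam' (algebraMap F _ f) = algebraMap F _ f := fun f =>
    hemb.injective (by rw [hcomm, hτE, hτ'])
  have hunit : ∀ i, IsUnit (xVar i : PRing F r) := by
    intro i
    refine IsUnit.of_mul_eq_one (mono (-Pi.single i 1) 0) ?_
    rw [xVar, mono, mono, AddMonoidAlgebra.single_mul_single, AddMonoidAlgebra.one_def]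
    congr 1 <;> simp
  obtain ⟨ψ, hψ⟩ := hR.exists_ker_eq (α := α) (w := fun i => lam' (xVar i))
    (fun i => ((hunit i).map lam').ne_zero) (fun i => by
      rw [← hlam, hE.map_x, map_mul, hbase])
  set Λ := Finset.univ.lcm ord with hΛ
  have hΛ0 : Λ ≠ 0 := by
    rw [hΛ, hR.lcm_eq_prod, Finset.prod_ne_zero_iff]
    exact fun j _ => (zero_lt_one.trans (hR.one_lt_ord j)).ne'
  -- If the Laurent part of ψ n vanishes, then Λ also kills the torsion part, so Λ n is a relation.
  have htors : ∀ n, (ψ n).1 = 0 → (Λ : ℤ) • n ∈ multRel σ α := by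
    intro n hn
    rw [hψ, map_zsmul]
    refine Prod.ext (by simp [hn]) (funext fun j => ?_)
    have : ord j ∣ Λ := Finset.dvd_lcm (Finset.mem_univ j)
    simp [(ZMod.natCast_eq_zero_iff _ _).mpr this]
  refine ⟨?_, fun hd => ?_⟩
  -- A dependency between the Laurent parts of the ψ (v j) becomes, after multiplication by Λ, a
  -- relation in M. Applying `M` returns its coefficients times Λ ≠ 0, so they vanish.
  · have hli : LinearIndependent ℤ fun j => (ψ (v j)).1 := by
      rw [Fintype.linearIndependent_iff]
      intro c hc
      have h1 : (ψ (∑ j, c j • v j)).1 = 0 := by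
        rw [map_sum, Prod.fst_sum, ← hc]
        exact Finset.sum_congr rfl fun j _ => by rw [map_zsmul, Prod.smul_fst]
      have h2 := hM _ (htors _ h1)
      rw [map_zsmul, map_sum] at h2
      intro i
      have h3 := congrFun h2 i
      simp only [map_zsmul, hv, Pi.smul_apply, Finset.sum_apply, Pi.single_apply, smul_eq_mul,
        mul_ite, mul_one, mul_zero, Finset.sum_ite_eq, Finset.mem_univ, if_true,
        Pi.zero_apply, mul_eq_zero] at h3
      rcases h3 with h3 | h3
      · exact absurd (by exact_mod_cast h3) hΛ0
      · exact h3
    simpa using hli.fintype_card_le_finrank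
  -- d·vz is a relation and ℤ^e is torsion-free, so ψ vz is pure torsion. Then Λ·vz is a relation,
  -- and d divides Λ because vz has exact order d modulo M.
  · have h1 : (ψ vz).1 = 0 := by
      have h := (hψ _).mp hvz
      rw [map_zsmul] at h
      have h2 := congrArg Prod.fst h
      rw [Prod.smul_fst] at h2
      refine (smul_eq_zero.mp h2).resolve_left ?_
      exact_mod_cast (zero_lt_one.trans hd).ne'
    have hdvd : d ∣ Λ := hvz' _ (htors _ h1)
    have hle := Nat.le_of_dvd (Nat.pos_of_ne_zero hΛ0) hdvd
    refine ⟨?_, hle, hR.lcm_eq_prod⟩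
    by_contra hl
    have : l = 0 := by omega
    subst this
    simp [hΛ] at hle
    omega

end DiffRing

end

noncomputable section

namespace DiffRing

open Filter AddMonoidAlgebra

variable {F : Type*} [Field F]

/-! ### Certificates for representations -/

theorem hom_eq_pw {G : Type*} [CommGroup G] {r : ℕ} (f : Multiplicative (Fin r → ℤ) →* G)
    (n : Fin r → ℤ) : f (.ofAdd n) = pw (fun i => f (.ofAdd (Pi.single i 1))) n := by
  have hn : n = ∑ i, n i • (Pi.single i 1 : Fin r → ℤ) := by
    funext k
    simp [Finset.sum_apply, Pi.single_apply]
  conv_lhs => rw [hn, ofAdd_sum, map_prod]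
  exact Finset.prod_congr rfl fun i _ => by rw [ofAdd_zsmul, map_zpow]

section Mono

variable {s l : ℕ} {ord : Fin l → ℕ}

/-- The monomials in the Laurent variables as units. -/
def monoUnit : Multiplicative (Fin s → ℤ) →* (APRing F s ord)ˣ :=
  MonoidHom.toHomUnits
    { toFun := fun n => mono n.toAdd 0
      map_one' := rfl
      map_mul' := fun a b => by simp [mono, AddMonoidAlgebra.single_mul_single] }

theorem algebraMap_mul_mono (c : F) (n : Fin s → ℤ) (k : (j : Fin l) → ZMod (ord j)) :
    algebraMap F (APRing F s ord) c * mono n k = single (n, k) c := by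
  rw [algebraMap_eq_single, mono, AddMonoidAlgebra.single_mul_single]
  simp

end Mono

theorem IsPExtension.map_mono {σ : RingAut F} {r : ℕ} {α : Fin r → Fˣ} {σE : RingAut (PRing F r)}
    (h : IsPExtension σ α σE) (n : Fin r → ℤ) :
    σE (mono n 0) = algebraMap F _ ((pw α n : Fˣ) : F) * mono n 0 := by
  have h1 := hom_eq_pw ((onUnits σE).comp monoUnit) n
  have h2 : ∀ i, ((onUnits σE).comp monoUnit) (.ofAdd (Pi.single i 1)) =
      Units.map (algebraMap F (PRing F r) : F →* PRing F r) (α i) *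
        monoUnit (.ofAdd (Pi.single i 1)) :=
    fun i => Units.ext (h.map_x i)
  simp only [h2] at h1
  have h3 := h1.trans (pw_mul (fun i => Units.map (algebraMap F (PRing F r) : F →* PRing F r) (α i))
    (fun i => monoUnit (.ofAdd (Pi.single i 1))) n)
  rw [← map_pw] at h3
  rw [← hom_eq_pw (monoUnit : Multiplicative (Fin r → ℤ) →* (PRing F r)ˣ) n] at h3
  exact congrArg Units.val h3

/-- The exponent map of the Laurent variables. -/
def expM {r s : ℕ} (m : Fin r → Fin s → ℤ) : (Fin r → ℤ) →+ (Fin s → ℤ) :=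
  AddMonoidHom.mk' (fun n j => ∑ i, n i * m i j) fun a b => by
    funext j; simp [add_mul, Finset.sum_add_distrib]

/-- The exponent map of the root of unity. -/
def expO {r : ℕ} (o : Fin r → ℕ) : (Fin r → ℤ) →+ ℤ :=
  AddMonoidHom.mk' (fun n => ∑ i, n i * o i) fun a b => by
    simp [add_mul, Finset.sum_add_distrib]

theorem expM_apply {r s : ℕ} (m : Fin r → Fin s → ℤ) (n : Fin r → ℤ) (j : Fin s) :
    expM m n j = ∑ i, n i * m i j := rfl

theorem expO_apply {r : ℕ} (o : Fin r → ℕ) (n : Fin r → ℤ) : expO o n = ∑ i, n i * o i := rfl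

/-- The root of unity as a unit of `F`. -/
def rootUnit {σ : RingAut F} (ρ : (constField σ)ˣ) : Fˣ :=
  Units.map ((constField σ).subtype : constField σ →* F) ρ

theorem onUnits_rootUnit {σ : RingAut F} (ρ : (constField σ)ˣ) :
    onUnits σ (rootUnit ρ) = rootUnit ρ :=
  Units.ext (ρ : constField σ).2

theorem rootUnit_zpow_of_dvd {σ : RingAut F} {ρ : (constField σ)ˣ} {d : ℕ} (hρ : ρ ^ d = 1) {k : ℤ}
    (hk : (d : ℤ) ∣ k) : rootUnit ρ ^ k = 1 := by
  obtain ⟨c, rfl⟩ := hk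
  rw [zpow_mul, zpow_natCast, rootUnit, ← map_pow, hρ, map_one, one_zpow]

/-- The hypothesis says that λ commutes with the automorphisms on each x̂_i. All ingredients are
multiplicative, so this extends to every monomial x̂^n. -/
theorem RepData.compat_pw {σ : RingAut F} {r s u : ℕ} {α : Fin r → Fˣ} {D : RepData F r s u}
    {ρ : (constField σ)ˣ} (hρ : ((ρ : constField σ) : F) = D.ρ)
    (h : ∀ i, σ (D.γ i) * ((∏ j, (D.α j : F) ^ D.m i j) * D.ρ ^ D.o i) = α i * D.γ i)
    (n : Fin r → ℤ) :
    onUnits σ (pw D.γ n) * (pw D.α (expM D.m n) * rootUnit ρ ^ expO D.o n) =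
      pw α n * pw D.γ n := by
  have h1 : ∀ i, onUnits σ (D.γ i) * (pw D.α (D.m i) * rootUnit ρ ^ D.o i) = α i * D.γ i := by
    intro i
    refine Units.ext ?_
    have := h i
    rw [← hρ, ← coe_pw] at this
    simpa [rootUnit] using this
  have h2 : pw D.α (expM D.m n) = pw (fun i => pw D.α (D.m i)) n :=
    pw_vecMul D.α n (Matrix.of D.m)
  have h3 : rootUnit ρ ^ expO D.o n = pw (fun i => rootUnit ρ ^ D.o i) n := by
    have := pw_vecMul (r := 1) (fun _ => rootUnit ρ) n (Matrix.of fun i _ => (D.o i : ℤ))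
    simpa [pw, expO_apply, Matrix.vecMul, dotProduct] using this
  rw [map_pw, h2, h3, ← pw_mul, ← pw_mul, ← pw_mul]
  congr 1
  exact funext h1

/-- The algebraic conditions on the data `D` of a representation; the vectors `v j` and `vz` are the
exponents of preimages of the generators. -/
structure IsAlgCert (σ : RingAut F) {r : ℕ} (α : Fin r → Fˣ) {s u : ℕ} (D : RepData F r s u)
    (ρ : (constField σ)ˣ) (v : Fin s → Fin r → ℤ) (vz : Fin r → ℤ) : Prop where
  basis : RowsAreBasis (multRel σ α) (Matrix.of D.n)
  d_pos : 0 < D.d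
  o_lt : ∀ i, D.o i < D.d
  rho : ((ρ : constField σ) : F) = D.ρ
  rho_pow : ρ ^ D.d = 1
  compat : ∀ i, σ (D.γ i) * ((∏ j, (D.α j : F) ^ D.m i j) * D.ρ ^ D.o i) = α i * D.γ i
  m_n : ∀ k, expM D.m (D.n k) = 0
  o_n : ∀ k, (D.d : ℤ) ∣ expO D.o (D.n k)
  m_v : ∀ j, expM D.m (v j) = Pi.single j 1
  o_v : ∀ j, (D.d : ℤ) ∣ expO D.o (v j)
  m_vz : expM D.m vz = 0
  o_vz : (D.d : ℤ) ∣ expO D.o vz - 1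
  g_eq : ∀ k, D.g k = pw D.γ (D.n k)

/-- Finitely many conditions on the data `D` which imply that `D` describes an optimal
representation. -/
structure IsCert (σ : RingAut F) {r : ℕ} (α : Fin r → Fˣ) (τ₀ : F →+* SeqRing (constField σ))
    (τE : PRing F r →+* SeqRing (constField σ)) {s u : ℕ} (D : RepData F r s u)
    (ρ : (constField σ)ˣ) (v : Fin s → Fin r → ℤ) (vz : Fin r → ℤ) : Prop
    extends IsAlgCert σ α D ρ v vz where
  tau_n : ∀ k, τE (mono (D.n k) 0) = τ₀ (D.g k : F)
  tau_vz : τE (mono vz 0) = τ₀ ((pw D.γ vz : Fˣ) : F) * geom ρ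

/-- The conditions on the data `D` that concern values of evaluation functions at the single
point `N`. -/
structure IsEvalCert {σ : RingAut F} {r : ℕ} (evE : PRing F r → ℕ → constField σ)
    (LE : PRing F r → ℕ) {s u : ℕ} (D : RepData F r s u) (ρ : (constField σ)ˣ)
    (v : Fin s → Fin r → ℤ) (vz : Fin r → ℤ) (κ : Fin s → constField σ) (N : ℕ) : Prop where
  bound_n : ∀ k, LE (algebraMap F _ ((D.g k : F)⁻¹) * mono (D.n k) 0) ≤ N
  eval_n : ∀ k, evE (algebraMap F _ ((D.g k : F)⁻¹) * mono (D.n k) 0) N = 1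
  bound_v : ∀ j, LE (algebraMap F _ (((pw D.γ (v j) : Fˣ) : F)⁻¹) * mono (v j) 0) ≤ N
  eval_v : ∀ j, evE (algebraMap F _ (((pw D.γ (v j) : Fˣ) : F)⁻¹) * mono (v j) 0) N = κ j
  bound_α : ∀ j, LE (algebraMap F _ (D.α j : F)) ≤ N
  bound_vz : LE (algebraMap F _ (((pw D.γ vz : Fˣ) : F)⁻¹) * mono vz 0) ≤ N
  eval_vz : evE (algebraMap F _ (((pw D.γ vz : Fˣ) : F)⁻¹) * mono vz 0) N = (ρ : constField σ) ^ N
  bound_ρ : LE (algebraMap F _ D.ρ) ≤ N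

/-! ### Construction of the representation from a certificate -/

namespace IsCert

variable {σ : RingAut F} {r : ℕ} {α : Fin r → Fˣ} {τ₀ : F →+* SeqRing (constField σ)}
  {τE : PRing F r →+* SeqRing (constField σ)} {s u : ℕ} {D : RepData F r s u}
  {ρ : (constField σ)ˣ} {v : Fin s → Fin r → ℤ} {vz : Fin r → ℤ}

theorem rootUnit_pow (h : IsCert σ α τ₀ τE D ρ v vz) : rootUnit ρ ^ D.d = 1 := by
  rw [rootUnit, ← map_pow, h.rho_pow, map_one]

theorem rootUnit_zpow_of_dvd (h : IsCert σ α τ₀ τE D ρ v vz) {k : ℤ} (hk : (D.d : ℤ) ∣ k) :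
    rootUnit ρ ^ k = 1 := DiffRing.rootUnit_zpow_of_dvd h.rho_pow hk

theorem compat_pw (h : IsCert σ α τ₀ τE D ρ v vz) (n : Fin r → ℤ) :
    onUnits σ (pw D.γ n) * (pw D.α (expM D.m n) * rootUnit ρ ^ expO D.o n) =
      pw α n * pw D.γ n := RepData.compat_pw h.rho h.compat n

/-- The module of relations is the kernel of the exponent map of λ. One inclusion is checked on the
basis n_k; for the other, once the monomial part is trivial, `compat_pw` exhibits γ^n as the
required element of F^*. -/
theorem mem_iff (h : IsCert σ α τ₀ τE D ρ v vz) (n : Fin r → ℤ) :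
    n ∈ multRel σ α ↔ expM D.m n = 0 ∧ (D.d : ℤ) ∣ expO D.o n := by
  constructor
  · intro hn
    rw [← h.basis.2] at hn
    induction hn using Submodule.span_induction with
    | mem x hx =>
      obtain ⟨k, rfl⟩ := hx
      exact ⟨h.m_n k, h.o_n k⟩
    | zero => simp
    | add x y _ _ hx hy =>
      rw [map_add, map_add, hx.1, hy.1]
      exact ⟨add_zero 0, dvd_add hx.2 hy.2⟩
    | smul c x _ hx =>
      rw [map_zsmul, map_zsmul, hx.1]
      exact ⟨smul_zero c, hx.2.mul_left c⟩
  · rintro ⟨h1, h2⟩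
    rw [mem_multRel]
    refine ⟨pw D.γ n, ?_⟩
    have := h.compat_pw n
    rwa [h1, pw_zero, h.rootUnit_zpow_of_dvd h2, mul_one, mul_one] at this

/-- The character of the root of unity. -/
def rootChar (h : IsCert σ α τ₀ τE D ρ v vz) : ZMod D.d →+ Additive Fˣ :=
  ZMod.lift D.d ⟨(zmultiplesHom (Additive Fˣ)) (Additive.ofMul (rootUnit ρ)), by
    rw [zmultiplesHom_apply, ← ofMul_zpow, zpow_natCast, h.rootUnit_pow, ofMul_one]⟩

theorem rootChar_intCast (h : IsCert σ α τ₀ τE D ρ v vz) (k : ℤ) :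
    h.rootChar (k : ZMod D.d) = Additive.ofMul (rootUnit ρ ^ k) := by
  rw [rootChar, ZMod.lift_coe]
  simp

/-- The quotients `σ(y)/y` for the monomials `y`. -/
def char (h : IsCert σ α τ₀ τE D ρ v vz) :
    Multiplicative ((Fin s → ℤ) × (Fin (if D.d = 1 then 0 else 1) → ZMod D.d)) →* Fˣ :=
  ((pwHom D.α).comp (AddMonoidHom.toMultiplicative (AddMonoidHom.fst _ _))) *
    AddMonoidHom.toMultiplicativeLeft
      (∑ j, h.rootChar.comp ((Pi.evalAddMonoidHom _ j).comp (AddMonoidHom.snd _ _)))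

theorem char_apply (h : IsCert σ α τ₀ τE D ρ v vz) (n : Fin s → ℤ) (k : ℤ) :
    h.char (.ofAdd (n, fun _ => (k : ZMod D.d))) = pw D.α n * rootUnit ρ ^ k := by
  have h1 : (∑ j : Fin (if D.d = 1 then 0 else 1), h.rootChar (k : ZMod D.d)) =
      Additive.ofMul (rootUnit ρ ^ k) := by
    rw [Finset.sum_const, h.rootChar_intCast, Finset.card_univ, Fintype.card_fin]
    -- For d = 1 the sum is empty, which is consistent because ρ^1 = 1; for d ≠ 1 there is exactly
    -- one summand.
    split_ifs with hd
    · have := h.rootUnit_pow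
      rw [hd, pow_one] at this
      simp [this]
    · simp
  have h2 : h.char (.ofAdd (n, fun _ => (k : ZMod D.d))) = pw D.α n *
      (∑ j : Fin (if D.d = 1 then 0 else 1), h.rootChar (k : ZMod D.d)).toMul := by
    simp only [char, MonoidHom.mul_apply]
    congr 1
    change Additive.toMul ((∑ j, h.rootChar.comp ((Pi.evalAddMonoidHom _ j).comp
      (AddMonoidHom.snd _ _))) _) = _
    rw [AddMonoidHom.finsetSum_apply]
    rfl
  rw [h2, h1]
  rfl

/-- The map on exponents. -/
def expHom (D : RepData F r s u) :
    (Fin r → ℤ) × ((j : Fin 0) → ZMod (j.elim0 : ℕ)) →+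
      (Fin s → ℤ) × (Fin (if D.d = 1 then 0 else 1) → ZMod D.d) :=
  AddMonoidHom.mk' (fun g => (expM D.m g.1, fun _ => (expO D.o g.1 : ZMod D.d))) fun a b => by
    refine Prod.ext (by simp) (funext fun j => by simp)

theorem expHom_apply (D : RepData F r s u) (n : Fin r → ℤ) (k) :
    expHom D (n, k) = (expM D.m n, fun _ => (expO D.o n : ZMod D.d)) := rfl

theorem expHom_eq_zero (D : RepData F r s u) (n : Fin r → ℤ) (k) :
    expHom D (n, k) = 0 ↔ expM D.m n = 0 ∧ (D.d : ℤ) ∣ expO D.o n := by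
  rw [expHom_apply, Prod.mk_eq_zero]
  refine and_congr Iff.rfl ?_
  rw [← ZMod.intCast_zmod_eq_zero_iff_dvd]
  constructor
  · intro h
    by_cases hd : D.d = 1
    · rw [hd]
      exact Subsingleton.elim (α := ZMod 1) _ _
    · exact congrFun h ⟨0, by simp [hd]⟩
  · intro h
    funext j
    exact h

/-- The vectors v j and vz are preimages of the exponents of the x_j and of z, which generate the
target. -/
theorem expHom_surjective (h : IsCert σ α τ₀ τE D ρ v vz) : Function.Surjective (expHom D) := by
  rintro ⟨n, k⟩
  obtain ⟨c, hc⟩ : ∃ c : ℤ, k = fun _ => (c : ZMod D.d) := by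
    by_cases hd : D.d = 1
    · refine ⟨0, funext fun j => ?_⟩
      have := j.isLt
      simp [hd] at this
    · obtain ⟨c, hc⟩ := ZMod.intCast_surjective (k ⟨0, by simp [hd]⟩)
      refine ⟨c, funext fun j => ?_⟩
      rw [hc]
      congr 1
      have := j.isLt
      simp only [hd, if_false] at this
      exact Fin.ext (by simp; omega)
  refine ⟨(∑ j, n j • v j + c • vz, 0), ?_⟩
  rw [expHom_apply, hc]
  refine Prod.ext ?_ (funext fun _ => ?_)
  · simp only [map_add, map_sum, map_zsmul, h.m_v, h.m_vz, smul_zero, add_zero]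
    funext i
    simp [Finset.sum_apply, Pi.single_apply]
  · have h1 : ∀ j, ((expO D.o (v j) : ℤ) : ZMod D.d) = 0 := fun j =>
      (ZMod.intCast_zmod_eq_zero_iff_dvd _ _).mpr (h.o_v j)
    have h2 : ((expO D.o vz : ℤ) : ZMod D.d) = 1 := by
      have := (ZMod.intCast_zmod_eq_zero_iff_dvd _ _).mpr h.o_vz
      rwa [Int.cast_sub, Int.cast_one, sub_eq_zero] at this
    simp only [map_add, map_sum, map_zsmul, smul_eq_mul, Int.cast_add, Int.cast_sum, Int.cast_mul,
      h1, h2, mul_zero, Finset.sum_const_zero, zero_add, mul_one]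

theorem closure_eq_ker (h : IsCert σ α τ₀ τE D ρ v vz) :
    AddSubgroup.closure (Set.range fun k => (D.n k, (0 : (j : Fin 0) → ZMod (j.elim0 : ℕ)))) =
      (expHom D).ker := by
  apply le_antisymm
  · rw [AddSubgroup.closure_le]
    rintro _ ⟨k, rfl⟩
    exact (expHom_eq_zero D _ _).mpr ⟨h.m_n k, h.o_n k⟩
  · rintro ⟨n, k⟩ hn
    have hk : k = 0 := Subsingleton.elim _ _
    subst hk
    have hn' := (h.mem_iff n).mpr ((expHom_eq_zero D _ _).mp hn)
    rw [← h.basis.2] at hn'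
    clear hn
    induction hn' using Submodule.span_induction with
    | mem x hx =>
      obtain ⟨k, rfl⟩ := hx
      exact AddSubgroup.subset_closure ⟨k, rfl⟩
    | zero => exact AddSubgroup.zero_mem _
    | add x y _ _ hx hy => simpa using AddSubgroup.add_mem _ hx hy
    | smul c x _ hx => simpa using AddSubgroup.zsmul_mem _ hx c

/-- The character of the coefficients `γ`. -/
def coeffChar (D : RepData F r s u) :
    Multiplicative ((Fin r → ℤ) × ((j : Fin 0) → ZMod (j.elim0 : ℕ))) →* Fˣ :=
  (pwHom D.γ).comp (AddMonoidHom.toMultiplicative (AddMonoidHom.fst _ _))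

theorem coeffChar_apply (D : RepData F r s u) (n : Fin r → ℤ) (k) :
    coeffChar D (.ofAdd (n, k)) = pw D.γ n := rfl

/-- The homomorphism `λ` described by `D`. -/
def lam (D : RepData F r s u) : PRing F r →+* HRing F s D.d :=
  monHom (RingHom.id F) (expHom D) (coeffChar D)

theorem lam_single (D : RepData F r s u) (n : Fin r → ℤ) (k) (c : F) :
    lam D (single (n, k) c) =
      single (expM D.m n, fun _ => (expO D.o n : ZMod D.d)) (c * (pw D.γ n : Fˣ)) := by
  rw [lam, monHom_single, expHom_apply, coeffChar_apply, RingHom.id_apply]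

theorem lam_base (D : RepData F r s u) (c : F) : lam D (algebraMap F _ c) = algebraMap F _ c := by
  rw [algebraMap_eq_single, lam, monHom_single, map_zero, algebraMap_eq_single]
  simp

theorem char_expHom (h : IsCert σ α τ₀ τE D ρ v vz) (n : Fin r → ℤ) (k) :
    onUnits σ (pw D.γ n) * h.char (.ofAdd (expHom D (n, k))) = pw α n * pw D.γ n := by
  rw [expHom_apply, h.char_apply, h.compat_pw]

theorem lam_surjective (h : IsCert σ α τ₀ τE D ρ v vz) : Function.Surjective (lam D) := by
  intro f
  induction f using AddMonoidAlgebra.induction_linear with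
  | zero => exact ⟨0, map_zero _⟩
  | add a b ha hb =>
    obtain ⟨x, rfl⟩ := ha
    obtain ⟨y, rfl⟩ := hb
    exact ⟨x + y, map_add _ _ _⟩
  | single g c =>
    obtain ⟨⟨n, k⟩, rfl⟩ := h.expHom_surjective g
    refine ⟨single (n, k) (c * ((pw D.γ n)⁻¹ : Fˣ)), ?_⟩
    rw [lam, monHom_single, coeffChar_apply]
    simp

theorem lam_shift (h : IsCert σ α τ₀ τE D ρ v vz) {σE : RingAut (PRing F r)}
    (hE : IsPExtension σ α σE) (f : PRing F r) :
    lam D (σE f) = twist σ h.char (lam D f) := by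
  induction f using AddMonoidAlgebra.induction_linear with
  | zero => simp
  | add a b ha hb => simp only [map_add, ha, hb]
  | single g c =>
    obtain ⟨n, k⟩ := g
    have hk : k = 0 := Subsingleton.elim _ _
    subst hk
    have e : (single (n, 0) c : PRing F r) = algebraMap F _ c * mono n 0 :=
      (algebraMap_mul_mono c n 0).symm
    rw [e, map_mul, hE.map_base, hE.map_mono, ← mul_assoc, ← map_mul, algebraMap_mul_mono,
      algebraMap_mul_mono, lam, monHom_single, monHom_single, twist_single, coeffChar_apply]
    congr 1
    have := congrArg Units.val (h.char_expHom n 0)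
    simp only [Units.val_mul, Units.coe_map, MonoidHom.coe_coe] at this
    rw [RingHom.id_apply, RingHom.id_apply, map_mul, mul_assoc, mul_assoc, this]

/-- This is why H has no new constants. Writing g as the exponent of λ(x̂^n), a fixed term x·y^g
makes γ^n/x a witness for n ∈ M, and relations have trivial exponent. -/
theorem eq_zero_of_fixed (h : IsCert σ α τ₀ τE D ρ v vz)
    (g : (Fin s → ℤ) × (Fin (if D.d = 1 then 0 else 1) → ZMod D.d)) {x : F} (hx : x ≠ 0)
    (hfix : σ x * h.char (.ofAdd g) = x) : g = 0 := by
  obtain ⟨⟨n, k⟩, rfl⟩ := h.expHom_surjective g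
  rw [expHom_eq_zero, ← h.mem_iff, mem_multRel]
  refine ⟨pw D.γ n * (Units.mk0 x hx)⁻¹, ?_⟩
  have h1 : onUnits σ (Units.mk0 x hx) * h.char (.ofAdd (expHom D (n, k))) = Units.mk0 x hx :=
    Units.ext hfix
  have h2 := h.char_expHom n k
  rw [map_mul, map_inv, ← mul_assoc, ← h2]
  nth_rewrite 2 [← h1]
  rw [mul_inv, mul_mul_mul_comm, mul_inv_cancel, mul_one]

/-- The automorphism is diagonal, so a fixed element consists of fixed terms, each treated by
`eq_zero_of_fixed`. -/
theorem eq_algebraMap_of_fixed (h : IsCert σ α τ₀ τE D ρ v vz) (f : HRing F s D.d)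
    (hf : twist σ h.char f = f) : ∃ c ∈ constField σ, algebraMap F _ c = f := by
  have hco : ∀ g, σ (f.coeff g) * h.char (.ofAdd g) = f.coeff g := by
    intro g
    rw [← coeff_twist, hf]
  refine ⟨f.coeff 0, ?_, ?_⟩
  · have := hco 0
    change σ _ = _
    simpa using this
  · rw [algebraMap_eq_single]
    ext g
    rw [coeff_single]
    by_cases hg : g = 0
    · simp [hg]
    · rw [Finsupp.single_eq_of_ne hg]
      by_contra hne
      exact hg (h.eq_zero_of_fixed g (Ne.symm hne) (hco g))

theorem single_one_eq {d : ℕ} (j : Fin (if d = 1 then 0 else 1)) :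
    (Pi.single j 1 : Fin (if d = 1 then 0 else 1) → ZMod d) = fun _ => ((1 : ℤ) : ZMod d) := by
  funext i
  have h1 := j.isLt
  have h2 := i.isLt
  have : i = j := by
    refine Fin.ext ?_
    split_ifs at h1 h2 <;> omega
  subst this
  simp

theorem isRPiExtension (h : IsCert σ α τ₀ τE D ρ v vz) :
    IsRPiExtension (s := s) (ord := fun _ : Fin (if D.d = 1 then 0 else 1) => D.d) σ
      (twist σ h.char) where
  one_lt_ord j := by
    have h1 := j.isLt
    have h2 := h.d_pos
    by_contra hd
    have : D.d = 1 := by omega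
    simp [this] at h1
  map_base f := by
    rw [algebraMap_eq_single, algebraMap_eq_single, twist_single]
    simp
  map_x i := by
    refine ⟨algebraMap F _ (D.α i : F), Subalgebra.algebraMap_mem _ _,
      algebraMap F _ ((D.α i)⁻¹ : Fˣ), Subalgebra.algebraMap_mem _ _, ?_, ?_⟩
    · rw [← map_mul, Units.mul_inv, map_one]
    · rw [xVar, algebraMap_mul_mono, mono, twist_single]
      congr 1
      have := h.char_apply (Pi.single i 1) 0
      simp only [Int.cast_zero, zpow_zero, mul_one, pw_single, zpow_one] at this
      have h2 := congrArg Units.val this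
      rw [map_one, one_mul]
      exact h2
  map_z j := by
    refine ⟨ρ, ρ.ne_zero, ?_⟩
    rw [zVar, algebraMap_mul_mono, mono, twist_single, single_one_eq]
    congr 1
    have := congrArg Units.val (h.char_apply 0 1)
    rw [pw_zero, one_mul, zpow_one] at this
    rw [map_one, one_mul]
    exact this
  const_eq f := by
    refine ⟨h.eq_algebraMap_of_fixed f, ?_⟩
    rintro ⟨c, hc, rfl⟩
    rw [algebraMap_eq_single, twist_single]
    have : σ c = c := hc
    simp [this]

/-- The data of a certificate describe an optimal representation. -/
theorem exists_rep (h : IsCert σ α τ₀ τE D ρ v vz) {σE : RingAut (PRing F r)}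
    (hE : IsPExtension σ α σE) (hτE : IsKHom σ σE τE) (hbase : ∀ f : F, τE (algebraMap F _ f) = τ₀ f) :
    ∃ (σH : RingAut (HRing F s D.d)) (τH : HRing F s D.d →+* SeqRing (constField σ)),
      IsOptimalRep σ τ₀ σE τE D σH τH (lam D) ∧
      (∀ j, τH (xVar j) =
        τE (algebraMap F _ (((pw D.γ (v j))⁻¹ : Fˣ) : F) * mono (v j) 0)) ∧
      ∀ j, τH (zVar j) = toSeq fun n => (ρ : constField σ) ^ n := by
  have hker : RingHom.ker (lam D) =
      Ideal.span (Set.range fun i => mono (D.n i) 0 - algebraMap F _ (D.g i : F)) := by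
    rw [lam, ker_monHom h.expHom_surjective _ _ h.closure_eq_ker]
    simp only [coeffChar_apply, h.g_eq]
    rfl
  have hle : RingHom.ker (lam D) ≤ RingHom.ker τE := by
    rw [hker, Ideal.span_le]
    rintro _ ⟨k, rfl⟩
    simp only [SetLike.mem_coe, RingHom.mem_ker]
    rw [map_sub, h.tau_n, hbase, sub_self]
  -- Since λ is surjective and τE kills the binomials generating its kernel, τE descends along λ.
  let τH : HRing F s D.d →+* SeqRing (constField σ) :=
    (lam D).liftOfSurjective h.lam_surjective ⟨τE, hle⟩
  have hcomm : ∀ f, τH (lam D f) = τE f :=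
    RingHom.liftOfRightInverse_comp_apply _ _ (Function.rightInverse_surjInv h.lam_surjective) ⟨τE, hle⟩
  have hτ₀ : ∀ f : F, τH (algebraMap F _ f) = τ₀ f := fun f => by
    rw [← lam_base, hcomm, hbase]
  have hshift : ∀ f, τH (twist σ h.char f) = shift (τH f) := by
    intro f
    obtain ⟨x, rfl⟩ := h.lam_surjective f
    rw [← h.lam_shift hE, hcomm, hcomm, hτE.map_shift]
  have hinj : Function.Injective τH := by
    refine injective_of_const (σ := σ) (χ := h.char) (fun f hf => ?_) τH (fun f hf => ?_) fun c hc => ?_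
    · obtain ⟨c, _, hc⟩ := h.eq_algebraMap_of_fixed f hf
      exact ⟨c, hc.symm⟩
    · rw [hshift, hf]; rfl
    · have hc' : τ₀ c = 0 := (hτ₀ c).symm.trans hc
      by_contra hne
      have : τ₀ (c * c⁻¹) = 0 := by rw [map_mul, hc', zero_mul]
      rw [mul_inv_cancel₀ hne, map_one] at this
      exact toSeq_const_ne_zero (one_ne_zero (α := constField σ)) this
  have hR := h.isRPiExtension
  refine ⟨twist σ h.char, τH, ?_, ?_, ?_⟩
  · exact
    { rpi := hR
      embedding :=
        { map_shift := hshift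
          map_const := fun c => by
            rw [hτ₀, ← hbase, hτE.map_const]
          injective := hinj }
      embedding_base := hτ₀
      lam_shift := h.lam_shift hE
      lam_surjective := h.lam_surjective
      commutes := hcomm
      map_x := fun i => by
        rw [xVar, algebraMap_mul_mono, mono, twist_single]
        congr 1
        have := congrArg Units.val (h.char_apply (Pi.single i 1) 0)
        rw [Int.cast_zero, zpow_zero, mul_one, pw_single, zpow_one] at this
        rw [map_one, one_mul]
        exact this
      map_z := fun j => by
        refine ⟨h.rho ▸ (ρ : constField σ).2, ?_⟩
        rw [zVar, algebraMap_mul_mono, mono, twist_single, single_one_eq]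
        congr 1
        have := congrArg Units.val (h.char_apply 0 1)
        rw [pw_zero, one_mul, zpow_one] at this
        rw [map_one, one_mul, ← h.rho]
        exact this
      lam_base := lam_base D
      o_lt := h.o_lt
      lam_x := fun i => by
        rw [algebraMap_mul_mono, xVar, mono, lam_single]
        congr 1
        · refine Prod.ext (funext fun j => ?_) (funext fun j => ?_)
          · simp [expM_apply, Pi.single_apply]
          · simp [expO_apply, Pi.single_apply]
        · simp [pw_single]
      minimal := by
        refine isMinimal_of_rel hE hbase (expM D.m) (fun n hn => ((h.mem_iff n).mp hn).1) v h.m_v vz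
          ?_ fun k hk => ?_
        · rw [h.mem_iff, map_zsmul, map_zsmul, h.m_vz]
          exact ⟨smul_zero _, dvd_mul_right _ _⟩
        -- The z-exponent of vz is 1 modulo d, so k·vz can only be a relation if d divides k.
        · have h1 := ((h.mem_iff _).mp hk).2
          rw [map_zsmul, smul_eq_mul] at h1
          have h2 := dvd_sub h1 (h.o_vz.mul_left (k : ℤ))
          rw [mul_sub, mul_one, sub_sub_cancel] at h2
          exact_mod_cast h2
      n_indep := h.basis.1
      lam_n := fun k => by
        rw [mono, lam_single, h.m_n, (ZMod.intCast_zmod_eq_zero_iff_dvd _ _).mpr (h.o_n k), h.g_eq,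
          algebraMap_eq_single, one_mul]
        rfl
      ker_eq := by
        ext f
        rw [RingHom.mem_ker, RingHom.mem_ker, ← hcomm, map_eq_zero_iff τH hinj]
      ker_lam := hker }
  · intro j
    rw [← hcomm]
    congr 1
    rw [algebraMap_mul_mono, lam_single, h.m_v,
      (ZMod.intCast_zmod_eq_zero_iff_dvd _ _).mpr (h.o_v j), xVar, mono]
    simp
    rfl
  · intro j
    -- The value of z is obtained from λ(x̂^{vz}) = γ^{vz} z by cancelling the unit τ₀(γ^{vz})
    -- against the certified value of τE(x̂^{vz}).
    have h1 : lam D (mono vz 0) = algebraMap F _ ((pw D.γ vz : Fˣ) : F) * zVar j := by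
      have h2 : ((expO D.o vz : ℤ) : ZMod D.d) = ((1 : ℤ) : ZMod D.d) := by
        have := (ZMod.intCast_zmod_eq_zero_iff_dvd _ _).mpr h.o_vz
        rwa [Int.cast_sub, sub_eq_zero] at this
      rw [zVar, algebraMap_mul_mono, mono, lam_single, h.m_vz, h2, single_one_eq, one_mul]
    have h2 := hcomm (mono vz 0)
    rw [h1, map_mul, hτ₀, h.tau_vz] at h2
    have hu : IsUnit (τ₀ ((pw D.γ vz : Fˣ) : F)) := (Units.isUnit _).map τ₀
    exact hu.mul_left_cancel h2

end IsCert

end DiffRing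

end

noncomputable section

namespace DiffRing

open Filter AddMonoidAlgebra

variable {F : Type*} [Field F]

/-! ### Existence of certificates -/

theorem RowsAreBasis.finrank_eq {r u : ℕ} {V : Submodule ℤ (Fin r → ℤ)}
    {Z : Matrix (Fin u) (Fin r) ℤ} (h : RowsAreBasis V Z) : Module.finrank ℤ V = u := by
  rw [← h.2, finrank_span_eq_card h.1, Fintype.card_fin]

theorem RowsAreBasis.le {r u : ℕ} {V : Submodule ℤ (Fin r → ℤ)}
    {Z : Matrix (Fin u) (Fin r) ℤ} (h : RowsAreBasis V Z) : u ≤ r := by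
  simpa using h.1.fintype_card_le_finrank

theorem RowsAreBasis.mem_iff {r u : ℕ} {V : Submodule ℤ (Fin r → ℤ)}
    {Z : Matrix (Fin u) (Fin r) ℤ} (h : RowsAreBasis V Z) (n : Fin r → ℤ) :
    n ∈ V ↔ ∃ c : Fin u → ℤ, Matrix.vecMul c Z = n := by
  rw [← h.2, Submodule.mem_span_range_iff_exists_fun]
  refine exists_congr fun c => ?_
  rw [Matrix.vecMul_eq_sum]
  rfl

/-- Coordinates in which a submodule of `ℤ^{u+s}` with Smith normal form is diagonal. -/
theorem IsLargestDivisor.exists_coords {u s d : ℕ} {V : Submodule ℤ (Fin (u + s) → ℤ)}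
    (hd : IsLargestDivisor V d) (hV : Module.finrank ℤ V = u) :
    ∃ (hu : 0 < u) (B C : Matrix (Fin (u + s)) (Fin (u + s)) ℤ) (δ : Fin u → ℕ),
      B * C = 1 ∧ C * B = 1 ∧
      (∀ n, n ∈ V ↔ (∀ i, (δ i : ℤ) ∣ Matrix.vecMul n B (Fin.castAdd s i)) ∧
        ∀ j, Matrix.vecMul n B (Fin.natAdd u j) = 0) ∧
      (∀ i, 0 < δ i) ∧ (∀ i, δ i ∣ d) ∧ d = δ ⟨u - 1, Nat.sub_lt hu one_pos⟩ := by
  obtain ⟨u', hu, Z, A, B, δ, hZ, hA, hB, hAZB, hpos, hdvd, hdδ⟩ := hd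
  have : u' = u := by rw [← hV, hZ.finrank_eq]
  subst this
  refine ⟨hu, B, B⁻¹, δ, Matrix.mul_nonsing_inv B hB, Matrix.nonsing_inv_mul B hB, fun n => ?_, hpos,
    fun i => hdδ ▸ hdvd i _ (Fin.le_def.mpr (by simp; omega)), hdδ⟩
  have hrow : ∀ (c : Fin u' → ℤ) (j : Fin (u' + s)), Matrix.vecMul c (A * Z * B) j =
      ∑ i : Fin u', c i * (if i.val = j.val then (δ i : ℤ) else 0) := by
    intro c j
    rw [hAZB]
    rfl
  have hleft : ∀ (c : Fin u' → ℤ) (i : Fin u'),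
      Matrix.vecMul c (A * Z * B) (Fin.castAdd s i) = c i * δ i := by
    intro c i
    rw [hrow, Finset.sum_eq_single i]
    · simp
    · intro k _ hk
      have : (k : ℕ) ≠ i := fun h => hk (Fin.ext h)
      simp [this]
    · simp
  have hright : ∀ (c : Fin u' → ℤ) (j : Fin s),
      Matrix.vecMul c (A * Z * B) (Fin.natAdd u' j) = 0 := by
    intro c j
    rw [hrow]
    refine Finset.sum_eq_zero fun k _ => ?_
    have : (k : ℕ) ≠ u' + j := by have := k.isLt; omega
    simp [this]
  rw [hZ.mem_iff]
  constructor
  · rintro ⟨c, rfl⟩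
    have h1 : Matrix.vecMul (Matrix.vecMul c Z) B = Matrix.vecMul (Matrix.vecMul c A⁻¹) (A * Z * B) := by
      rw [Matrix.vecMul_vecMul, Matrix.vecMul_vecMul, ← Matrix.mul_assoc, ← Matrix.mul_assoc,
        Matrix.nonsing_inv_mul A hA, Matrix.one_mul]
    rw [h1]
    exact ⟨fun i => by rw [hleft]; exact dvd_mul_left _ _, hright _⟩
  · rintro ⟨h1, h2⟩
    choose c hc using h1
    -- The coordinates c with respect to the diagonal form pull back to c A, because (c A) Z B =
    -- c·diag(δ).
    refine ⟨Matrix.vecMul c A, ?_⟩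
    have h3 : Matrix.vecMul c (A * Z * B) = Matrix.vecMul n B := by
      funext j
      refine Fin.addCases (fun i => ?_) (fun j => ?_) j
      · rw [hleft, hc, mul_comm]
      · rw [hright, h2]
    have h4 := congrArg (fun w => Matrix.vecMul w B⁻¹) h3
    simp only [Matrix.vecMul_vecMul, Matrix.mul_assoc, Matrix.mul_nonsing_inv B hB, Matrix.mul_one,
      Matrix.vecMul_one] at h4
    rw [Matrix.vecMul_vecMul, h4]

/-! ### Geometric sequences from radical-stability -/

section Cert

variable {σ : RingAut F} {r : ℕ} {α : Fin r → Fˣ} {τ₀ : F →+* SeqRing (constField σ)}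
  {σE : RingAut (PRing F r)} {τE : PRing F r →+* SeqRing (constField σ)}

/-- The images of the monomials as units. -/
def monoSeq (τE : PRing F r →+* SeqRing (constField σ)) :
    Multiplicative (Fin r → ℤ) →* (SeqRing (constField σ))ˣ :=
  (Units.map (τE : PRing F r →* SeqRing (constField σ))).comp monoUnit

theorem val_monoSeq (n : Fin r → ℤ) :
    (monoSeq τE (.ofAdd n) : SeqRing (constField σ)) = τE (mono n 0) := rfl

/-- The images of the nonzero elements of `F` as units. -/
abbrev baseSeq (τ₀ : F →+* SeqRing (constField σ)) : Fˣ →* (SeqRing (constField σ))ˣ :=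
  Units.map (τ₀ : F →* SeqRing (constField σ))

theorem shift_baseSeq (hτ₀ : IsKHom σ σ τ₀) (f : Fˣ) :
    Units.map shiftHom (baseSeq τ₀ f) = baseSeq τ₀ (onUnits σ f) :=
  Units.ext (hτ₀.map_shift f).symm

theorem baseSeq_rootUnit (hτ₀ : IsKHom σ σ τ₀) (c : (constField σ)ˣ) :
    baseSeq τ₀ (rootUnit c) = constSeq c :=
  Units.ext (hτ₀.map_const c)

theorem shift_monoSeq (hE : IsPExtension σ α σE) (hτE : IsKHom σ σE τE)
    (hbase : ∀ f : F, τE (algebraMap F _ f) = τ₀ f) (n : Fin r → ℤ) :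
    Units.map shiftHom (monoSeq τE (.ofAdd n)) = baseSeq τ₀ (pw α n) * monoSeq τE (.ofAdd n) := by
  refine Units.ext ?_
  rw [Units.coe_map, shiftHom_apply, val_monoSeq, ← hτE.map_shift, hE.map_mono, map_mul, hbase]
  rfl

/-- A power product some power of which lies in the homogeneous group is, up to a constant, the
product of an element of `F` and a geometric sequence given by a root of unity. -/
theorem exists_root (hσ : RadicalStable σ) (hτ₀ : IsKHom σ σ τ₀) (hE : IsPExtension σ α σE)
    (hτE : IsKHom σ σE τE) (hbase : ∀ f : F, τE (algebraMap F _ f) = τ₀ f) {ε : Fin r → ℤ} {δ : ℕ}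
    (hδ : 0 < δ) (hε : (δ : ℤ) • ε ∈ multRel σ α) :
    ∃ (η : (constField σ)ˣ) (γ : Fˣ), η ^ δ = 1 ∧
      onUnits σ γ * rootUnit η = pw α ε * γ ∧
      monoSeq τE (.ofAdd ε) = baseSeq τ₀ γ * geom η := by
  have h1 : InHomogGroup σ (((pw α ε : Fˣ) : F) ^ δ) := by
    have : InHomogGroup σ _ := hε
    rwa [← coe_pw, pw_zsmul, zpow_natCast, Units.val_pow_eq_pow_val] at this
  obtain ⟨ρ, hρ, hρδ, h, hh, hρh⟩ := hσ _ δ (Units.ne_zero _) hδ h1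
  have hρ0 : ρ ≠ 0 := by
    rintro rfl
    rw [zero_pow hδ.ne'] at hρδ
    exact zero_ne_one hρδ
  let ρ' : (constField σ)ˣ := Units.mk0 ⟨ρ, hρ⟩ (by simpa [Subtype.ext_iff] using hρ0)
  have hρ' : ρ' ^ δ = 1 := Units.ext (Subtype.ext (by simpa [ρ'] using hρδ))
  -- Radical-stability gives α^ε ρ = σ(h)/h, so the root of unity that accompanies h in a
  -- description of α^ε is the inverse of ρ.
  set η := ρ'⁻¹ with hη
  set h' := Units.mk0 h hh
  have hrel : onUnits σ h' * rootUnit η = pw α ε * h' := by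
    have : onUnits σ h' = pw α ε * h' * rootUnit ρ' := by
      refine Units.ext ?_
      change σ h = ((pw α ε : Fˣ) : F) * h * ρ
      rw [eq_div_iff hh] at hρh
      rw [← hρh]; ring
    rw [this, mul_assoc, hη, rootUnit, rootUnit, map_inv, mul_inv_cancel, mul_one]
  -- The image of x̂^ε and h·(η^n)_n obey the same recurrence, so their quotient is shift-invariant
  -- and hence constant. Multiplying h by this constant κ ∈ K does not change σ(h)/h.
  obtain ⟨κ, hκ⟩ := exists_constSeq_of_shift_eq
    (x := monoSeq τE (.ofAdd ε) * (baseSeq τ₀ h' * geom η)⁻¹) (by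
      rw [map_mul, map_inv, map_mul, shift_monoSeq hE hτE hbase, shift_baseSeq hτ₀, shift_geom,
        ← baseSeq_rootUnit hτ₀, ← mul_assoc (baseSeq τ₀ (onUnits σ h')), ← map_mul, hrel, map_mul,
        mul_inv, mul_inv, mul_inv]
      generalize baseSeq τ₀ (pw α ε) = a
      generalize monoSeq τE (.ofAdd ε) = b
      generalize (baseSeq τ₀ h')⁻¹ = c
      generalize (geom η)⁻¹ = e
      rw [mul_assoc a⁻¹ c e, mul_mul_mul_comm, mul_inv_cancel, one_mul])
  refine ⟨η, rootUnit κ * h', by rw [hη, inv_pow, hρ', inv_one], ?_, ?_⟩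
  · rw [map_mul, onUnits_rootUnit, mul_assoc, hrel]
    simp only [mul_left_comm]
  · rw [map_mul, baseSeq_rootUnit hτ₀, ← hκ, mul_assoc, mul_assoc, inv_mul_cancel, mul_one]

end Cert

/-- Every Smith normal form of the module of relations leads to a certificate. -/
theorem exists_cert {σ : RingAut F} (hσ : RadicalStable σ) {τ₀ : F →+* SeqRing (constField σ)}
    (hτ₀ : IsKHom σ σ τ₀) {u s : ℕ} {α : Fin (u + s) → Fˣ} {σE : RingAut (PRing F (u + s))}
    {τE : PRing F (u + s) →+* SeqRing (constField σ)} (hE : IsPExtension σ α σE)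
    (hτE : IsKHom σ σE τE) (hbase : ∀ f : F, τE (algebraMap F _ f) = τ₀ f)
    {d : ℕ} (hd : IsLargestDivisor (multRel σ α) d) {n : Matrix (Fin u) (Fin (u + s)) ℤ}
    (hn : RowsAreBasis (multRel σ α) n) :
    ∃ D : RepData F (u + s) s u, D.n = n ∧ D.d = d ∧ ∃ ρ v vz, IsCert σ α τ₀ τE D ρ v vz := by
  obtain ⟨hu, B, C, δ, hBC, hCB, hmem, hδ, hδd, hdδ⟩ := hd.exists_coords hn.finrank_eq
  have hCrow : ∀ k, Matrix.vecMul (C k) B = Pi.single k 1 := by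
    intro k
    have : (C * B).row k = (1 : Matrix _ _ ℤ).row k := by rw [hCB]
    funext j
    have := congrFun this j
    simpa [Matrix.one_apply, Pi.single_apply, eq_comm, Matrix.mul_apply, Matrix.vecMul, dotProduct]
      using this
  -- The row C_i has exact order δ_i modulo M. This exactness makes η_i primitive below: η_i^l = 1
  -- would make γ_i^l a witness for l·C_i ∈ M.
  have hmemC : ∀ (i : Fin u) (c : ℤ), c • C (Fin.castAdd s i) ∈ multRel σ α ↔ (δ i : ℤ) ∣ c := by
    intro i c
    rw [hmem, Matrix.smul_vecMul, hCrow]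
    constructor
    · intro h
      simpa using h.1 i
    · intro h
      refine ⟨fun k => ?_, fun j => ?_⟩
      · by_cases hk : k = i
        · subst hk; simpa using h
        · have : Fin.castAdd s k ≠ Fin.castAdd s i := fun h => hk (Fin.castAdd_injective _ _ h)
          simp [this]
      · have : Fin.natAdd u j ≠ Fin.castAdd s i := by
          intro h
          have h1 : u + (j : ℕ) = i := congrArg Fin.val h
          omega
        simp [this]
  choose η γ hηδ hγ hseq using fun i : Fin u =>
    exists_root hσ hτ₀ hE hτE hbase (hδ i) ((hmemC i (δ i)).mpr dvd_rfl)
  have hprim : ∀ i, IsPrimitiveRoot (η i) (δ i) := by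
    refine fun i => ⟨hηδ i, fun l hl => ?_⟩
    have : (l : ℤ) • C (Fin.castAdd s i) ∈ multRel σ α := by
      rw [mem_multRel]
      refine ⟨γ i ^ l, ?_⟩
      have h1 := congrArg (· ^ l) (hγ i)
      simp only [mul_pow] at h1
      rw [rootUnit, ← map_pow (Units.map _) (η i), hl, map_one, mul_one] at h1
      rw [map_pow, h1, pw_zsmul, zpow_natCast]
    exact_mod_cast (hmemC i l).mp this
  set last : Fin u := ⟨u - 1, Nat.sub_lt hu one_pos⟩
  have hd0 : 0 < d := hdδ ▸ hδ last
  have hρ : IsPrimitiveRoot (η last) d := hdδ ▸ hprim last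
  -- As δ_i ∣ d, every η_i is a power of the primitive d-th root η_last. The exponent at `last` is
  -- taken to be exactly 1, so that C_last is an exponent of a preimage of z up to its coefficient.
  obtain ⟨c, hc, hclast⟩ : ∃ c : Fin u → ℕ, (∀ i, η i = η last ^ c i) ∧ c last = 1 := by
    have : ∀ i, ∃ c : ℕ, η i = η last ^ c ∧ (i = last → c = 1) := by
      intro i
      by_cases hi : i = last
      · exact ⟨1, by rw [hi, pow_one], fun _ => rfl⟩
      · have : NeZero d := ⟨hd0.ne'⟩
        have h1 : ((η i : constField σ)) ^ d = 1 := by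
          obtain ⟨k, hk⟩ := hδd i
          rw [← Units.val_pow_eq_pow_val, hk, pow_mul, hηδ, one_pow, Units.val_one]
        obtain ⟨c, _, hc⟩ := (IsPrimitiveRoot.coe_units_iff.mpr hρ).eq_pow_of_pow_eq_one h1
        exact ⟨c, Units.ext (by simpa using hc.symm), fun h => absurd h hi⟩
    choose c hc hcl using this
    exact ⟨c, hc, hcl last rfl⟩
  have hdvd : ∀ i, d ∣ δ i * c i := by
    intro i
    refine hρ.dvd_of_pow_eq_one _ ?_
    rw [mul_comm, pow_mul, ← hc, hηδ]
  let γt : Fin (u + s) → Fˣ := Fin.append γ 1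
  -- In the basis C the map is x̂^{C_k} ↦ γ_k z^{c_k} for k < u and x̂^{C_{u+j}} ↦ x_j. Row i of B
  -- expresses the i-th standard vector through the C_k; the exponent of z is reduced modulo d.
  let D : RepData F (u + s) s u :=
    { d := d
      α := fun j => pw α (C (Fin.natAdd u j))
      ρ := ((η last : constField σ) : F)
      γ := fun i => pw γt (B i)
      o := fun i => ((∑ k, B i (Fin.castAdd s k) * c k) % d).toNat
      m := fun i j => B i (Fin.natAdd u j)
      n := n
      g := fun k => pw (fun i => pw γt (B i)) (n k) }
  have hdz : (d : ℤ) ≠ 0 := by exact_mod_cast hd0.ne'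
  have ho : ∀ i, (D.o i : ℤ) = (∑ k, B i (Fin.castAdd s k) * c k) % d := fun i =>
    Int.toNat_of_nonneg (Int.emod_nonneg _ hdz)
  have hM : ∀ w j, expM D.m w j = Matrix.vecMul w B (Fin.natAdd u j) := fun _ _ => rfl
  -- Reducing each o_i modulo d changes the z-exponent of x̂^w only by a multiple of d.
  have hO : ∀ w, (d : ℤ) ∣ expO D.o w - ∑ k, Matrix.vecMul w B (Fin.castAdd s k) * c k := by
    intro w
    have h1 : ∑ k, Matrix.vecMul w B (Fin.castAdd s k) * c k =
        ∑ i, w i * ∑ k, B i (Fin.castAdd s k) * c k := by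
      simp only [Matrix.vecMul, dotProduct, Finset.sum_mul, Finset.mul_sum, mul_assoc]
      rw [Finset.sum_comm]
    rw [h1, expO_apply, ← Finset.sum_sub_distrib]
    refine Finset.dvd_sum fun i _ => ?_
    rw [← mul_sub, ho]
    refine Dvd.dvd.mul_left ?_ _
    rw [← dvd_neg, neg_sub]
    exact Int.dvd_self_sub_emod
  have hΓ : ∀ w, pw D.γ w = pw γ fun k => Matrix.vecMul w B (Fin.castAdd s k) := by
    intro w
    have h1 : pw D.γ w = pw γt (Matrix.vecMul w B) := (pw_vecMul γt w B).symm
    rw [h1, pw, Fin.prod_univ_add]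
    simp [γt, pw]
  have hdecomp : ∀ w, Matrix.vecMul (Matrix.vecMul w B) C = w := by
    intro w
    rw [Matrix.vecMul_vecMul, hBC, Matrix.vecMul_one]
  have hηpow : ∀ y : Fin u → ℤ, pw η y = η last ^ ∑ k, y k * c k := by
    intro y
    have := pw_vecMul (r := 1) (fun _ => η last) y (Matrix.of fun i _ => (c i : ℤ))
    simp only [pw, Finset.univ_unique, Finset.prod_singleton] at this
    rw [congrArg (fun a => pw a y) (funext hc)]
    simpa [pw, Matrix.vecMul, dotProduct] using this.symm
  have hηdvd : ∀ k l : ℤ, (d : ℤ) ∣ k - l → η last ^ k = η last ^ l := by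
    rintro k l ⟨e, he⟩
    have : k = d * e + l := by linarith
    rw [this, zpow_add, zpow_mul, zpow_natCast, hρ.pow_eq_one, one_zpow, one_mul]
  refine ⟨D, rfl, rfl, η last, fun j => C (Fin.natAdd u j), C (Fin.castAdd s last), ?_⟩
  have hne : ∀ (i : Fin u) (j : Fin s), Fin.natAdd u j ≠ Fin.castAdd s i := by
    intro i j h
    have h1 : u + (j : ℕ) = i := congrArg Fin.val h
    omega
  have hcompat : ∀ i, onUnits σ (D.γ i) * (pw D.α (D.m i) * rootUnit (η last) ^ D.o i) =
      α i * D.γ i := by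
    intro i
    have e1 : D.γ i = pw γ fun k => B i (Fin.castAdd s k) := by
      have := hΓ (Pi.single i 1)
      rwa [pw_single, zpow_one, Matrix.single_one_vecMul] at this
    have e2 : rootUnit (η last) ^ D.o i =
        pw (fun k => rootUnit (η k)) fun k => B i (Fin.castAdd s k) := by
      have h1 := map_pw (Units.map ((constField σ).subtype : constField σ →* F)) η
        fun k => B i (Fin.castAdd s k)
      rw [hηpow, ← hηdvd (D.o i) _ (by
        rw [ho, ← dvd_neg, neg_sub]
        exact Int.dvd_self_sub_emod), zpow_natCast, map_pow] at h1
      exact h1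
    have e3 : α i = (pw (fun k => pw α (C (Fin.castAdd s k))) fun k => B i (Fin.castAdd s k)) *
        pw D.α (D.m i) := by
      have h1 : α i = pw (fun k => pw α (C k)) (B i) := by
        rw [← pw_vecMul]
        have h2 := hdecomp (Pi.single i 1)
        rw [Matrix.single_one_vecMul] at h2
        have h3 : Matrix.vecMul (B i) C = Pi.single i 1 := h2
        rw [h3, pw_single, zpow_one]
      rw [h1, pw, Fin.prod_univ_add]
      rfl
    rw [e1, e2, e3, map_pw, mul_left_comm, ← pw_mul]
    have e4 : (fun k => onUnits σ (γ k)) * (fun k => rootUnit (η k)) =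
        (fun k => pw α (C (Fin.castAdd s k))) * γ := funext hγ
    rw [e4, pw_mul]
    simp only [mul_assoc, mul_left_comm]
  -- For a relation the coordinates along the last s rows vanish and the k-th of the others is
  -- divisible by δ_k, so the geometric factors cancel and only γ^w remains.
  have htau : ∀ w ∈ multRel σ α, monoSeq τE (.ofAdd w) = baseSeq τ₀ (pw D.γ w) := by
    intro w hw
    obtain ⟨h1, h2⟩ := (hmem w).mp hw
    have e1 : monoSeq τE (.ofAdd w) =
        pw (fun k => monoSeq τE (.ofAdd (C k))) (Matrix.vecMul w B) := by
      rw [hom_eq_pw, ← hdecomp w, pw_vecMul, hdecomp w]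
      congr 1
      funext k
      rw [← hom_eq_pw]
    have e2 : pw (fun k => monoSeq τE (.ofAdd (C k))) (Matrix.vecMul w B) =
        pw (fun k => monoSeq τE (.ofAdd (C (Fin.castAdd s k))))
          fun k => Matrix.vecMul w B (Fin.castAdd s k) := by
      rw [pw, Fin.prod_univ_add]
      simp [h2, pw]
    have e3 : (fun k => monoSeq τE (.ofAdd (C (Fin.castAdd s k)))) =
        (fun k => baseSeq τ₀ (γ k)) * fun k => geomHom (η k) := funext hseq
    have e4 : (pw η fun k => Matrix.vecMul w B (Fin.castAdd s k)) = 1 := by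
      refine Finset.prod_eq_one fun k _ => ?_
      obtain ⟨e, he⟩ := h1 k
      change η k ^ Matrix.vecMul w B (Fin.castAdd s k) = 1
      rw [he, zpow_mul, zpow_natCast, hηδ, one_zpow]
    rw [e1, e2, e3, pw_mul, ← map_pw, ← map_pw (geomHom (K := constField σ)), e4, map_one, mul_one, hΓ]
  have hnV : ∀ k, n k ∈ multRel σ α := by
    intro k
    rw [← hn.2]
    exact Submodule.subset_span ⟨k, rfl⟩
  exact
  { basis := hn
    d_pos := hd0
    o_lt := fun i => by
      have h1 := ho i
      have h2 := Int.emod_lt_of_pos (∑ k, B i (Fin.castAdd s k) * c k)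
        (by exact_mod_cast hd0 : (0 : ℤ) < d)
      rw [← h1] at h2
      exact_mod_cast h2
    rho := rfl
    rho_pow := hρ.pow_eq_one
    compat := fun i => by
      have := congrArg Units.val (hcompat i)
      rw [← coe_pw]
      simpa [rootUnit] using this
    m_n := fun k => by
      funext j
      rw [hM]
      exact ((hmem _).mp (hnV k)).2 j
    o_n := fun k => by
      refine (dvd_iff_dvd_of_dvd_sub (hO _)).mpr (Finset.dvd_sum fun i _ => ?_)
      obtain ⟨e, he⟩ := ((hmem _).mp (hnV k)).1 i
      have he' : Matrix.vecMul (D.n k) B (Fin.castAdd s i) = δ i * e := he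
      obtain ⟨e', he''⟩ := hdvd i
      refine ⟨e' * e, ?_⟩
      have : (δ i : ℤ) * c i = d * e' := by exact_mod_cast he''
      rw [he', mul_right_comm, this, mul_assoc]
    m_v := fun j => by
      funext j'
      rw [hM, hCrow]
      by_cases hj : j' = j
      · subst hj; simp
      · have : Fin.natAdd u j' ≠ Fin.natAdd u j := fun h => hj (Fin.natAdd_injective _ _ h)
        simp [hj]
    o_v := fun j => by
      refine (dvd_iff_dvd_of_dvd_sub (hO _)).mpr (Finset.dvd_sum fun i _ => ?_)
      rw [hCrow]
      simp [(hne i j).symm]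
    m_vz := by
      funext j
      rw [hM, hCrow]
      simp [hne last j]
    o_vz := by
      have := hO (C (Fin.castAdd s last))
      rw [hCrow, Finset.sum_eq_single last] at this
      · simpa [hclast] using this
      · intro k _ hk
        simp [hk]
      · simp
    g_eq := fun k => rfl
    tau_n := fun k => congrArg Units.val (htau _ (hnV k))
    tau_vz := by
      have h1 : pw D.γ (C (Fin.castAdd s last)) = γ last := by
        rw [hΓ, hCrow]
        have : (fun k => (Pi.single (Fin.castAdd s last) (1 : ℤ) : Fin (u + s) → ℤ)
            (Fin.castAdd s k)) = Pi.single last 1 := by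
          funext k
          simp [Pi.single_apply]
        rw [this, pw_single, zpow_one]
      rw [h1]
      exact congrArg Units.val (hseq last) }

end DiffRing

end

noncomputable section

namespace DiffRing

/-! ### Smith normal forms of submodules of `ℤ^r` -/

/-- Applied in both directions, this shows that an invertible operation on two members preserves the
span. -/
theorem span_range_le_of_two {ι M : Type*} [AddCommGroup M] {v v' : ι → M} {i j : ι}
    (h : ∀ k, k ≠ i → k ≠ j → v' k = v k) {p q p' q' : ℤ} (hi : v' i = p • v i + q • v j)
    (hj : v' j = p' • v i + q' • v j) :
    Submodule.span ℤ (Set.range v') ≤ Submodule.span ℤ (Set.range v) := by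
  have hv : ∀ k, v k ∈ Submodule.span ℤ (Set.range v) := fun k => Submodule.subset_span ⟨k, rfl⟩
  rw [Submodule.span_le]
  rintro _ ⟨k, rfl⟩
  by_cases h1 : k = i
  · subst h1
    rw [SetLike.mem_coe, hi]
    exact add_mem (Submodule.smul_mem _ _ (hv _)) (Submodule.smul_mem _ _ (hv _))
  by_cases h2 : k = j
  · subst h2
    rw [SetLike.mem_coe, hj]
    exact add_mem (Submodule.smul_mem _ _ (hv _)) (Submodule.smul_mem _ _ (hv _))
  rw [SetLike.mem_coe, h k h1 h2]
  exact hv k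

/-- `V` is spanned by the multiples `a_i C_i` of the first members of a generating family `C` of
`ℤ^r`. -/
def HasDivisors {r u : ℕ} (hu : u ≤ r) (V : Submodule ℤ (Fin r → ℤ)) (a : Fin u → ℕ) : Prop :=
  (∀ i, 0 < a i) ∧ ∃ C : Fin r → Fin r → ℤ, Submodule.span ℤ (Set.range C) = ⊤ ∧
    Submodule.span ℤ (Set.range fun i => (a i : ℤ) • C (Fin.castLE hu i)) = V

/-- A diagonal form is normalised: a permutation moves the occupied positions to the front, and
absolute values remove signs. The chain of divisibilities is obtained afterwards. -/
theorem exists_hasDivisors {r : ℕ} (V : Submodule ℤ (Fin r → ℤ)) :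
    ∃ (u : ℕ) (hu : u ≤ r) (a : Fin u → ℕ), HasDivisors hu V a := by
  classical
  obtain ⟨u, S⟩ := Submodule.smithNormalForm (Pi.basisFun ℤ (Fin r)) V
  have hu : u ≤ r := by simpa using Fintype.card_le_of_embedding S.f
  -- extend the position map to a permutation
  let e₀ : {x // x ∈ Set.range (Fin.castLE hu)} ≃ {x // x ∈ Set.range S.f} :=
    (Equiv.ofInjective _ (Fin.castLE_injective hu)).symm.trans (Equiv.ofInjective _ S.f.injective)
  let e : Equiv.Perm (Fin r) := e₀.extendSubtype
  have he : ∀ i, e (Fin.castLE hu i) = S.f i := by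
    intro i
    have h1 := Equiv.extendSubtype_apply_of_mem e₀ (Fin.castLE hu i) ⟨i, rfl⟩
    rw [h1]
    have h2 : (Equiv.ofInjective _ (Fin.castLE_injective hu)).symm
        ⟨Fin.castLE hu i, ⟨i, rfl⟩⟩ = i :=
      Equiv.ofInjective_symm_apply (Fin.castLE_injective hu) i
    simp only [e₀, Equiv.trans_apply, h2, Equiv.ofInjective_apply]
  have hspan : Submodule.span ℤ (Set.range fun i => S.a i • S.bM (S.f i)) = V := by
    have h1 := congrArg (Submodule.map V.subtype) S.bN.span_eq
    rw [Submodule.map_span, Submodule.map_top, Submodule.range_subtype, ← Set.range_comp] at h1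
    refine Eq.trans ?_ h1
    congr 2
    funext i
    exact (S.snf i).symm
  have ha : ∀ i, S.a i ≠ 0 := by
    intro i h0
    have h1 := S.snf i
    rw [h0, zero_smul] at h1
    exact S.bN.ne_zero i (Subtype.ext h1)
  refine ⟨u, hu, fun i => (S.a i).natAbs, fun i => Int.natAbs_pos.mpr (ha i), fun k => S.bM (e k), ?_, ?_⟩
  · rw [← S.bM.span_eq]
    congr 1
    exact e.surjective.range_comp _
  · refine Eq.trans ?_ hspan
    simp only [he]
    apply le_antisymm <;> rw [Submodule.span_le] <;> rintro _ ⟨i, rfl⟩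
    · rcases Int.natAbs_eq (S.a i) with h | h
      · simp only [← h]
        exact Submodule.subset_span ⟨i, rfl⟩
      · have : ((S.a i).natAbs : ℤ) = - S.a i := by omega
        simp only [this, neg_smul]
        exact neg_mem (Submodule.subset_span ⟨i, rfl⟩)
    · have hm : ((S.a i).natAbs : ℤ) • S.bM (S.f i) ∈
          Submodule.span ℤ (Set.range fun i => ((S.a i).natAbs : ℤ) • S.bM (S.f i)) :=
        Submodule.subset_span ⟨i, rfl⟩
      change S.a i • S.bM (S.f i) ∈ _
      rcases Int.natAbs_eq (S.a i) with h | h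
      · have h' := congrArg (· • S.bM (S.f i)) h
        rwa [h']
      · have h' := congrArg (· • S.bM (S.f i)) h
        simp only [neg_smul] at h'
        rw [h']
        exact neg_mem hm

/-- Two divisors may be replaced by their greatest common divisor and their least common multiple. -/
theorem HasDivisors.gcd_lcm {r u : ℕ} {hu : u ≤ r} {V : Submodule ℤ (Fin r → ℤ)} {a : Fin u → ℕ}
    (h : HasDivisors hu V a) {i j : Fin u} (hij : i ≠ j) :
    HasDivisors hu V
      (Function.update (Function.update a j (Nat.lcm (a i) (a j))) i (Nat.gcd (a i) (a j))) := by
  obtain ⟨hpos, C, hC, hV⟩ := h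
  set g := Nat.gcd (a i) (a j) with hg
  have hg0 : 0 < g := Nat.gcd_pos_of_pos_left _ (hpos i)
  obtain ⟨p, hp⟩ : g ∣ a i := Nat.gcd_dvd_left _ _
  obtain ⟨q, hq⟩ : g ∣ a j := Nat.gcd_dvd_right _ _
  have hl : Nat.lcm (a i) (a j) = g * (p * q) := by
    refine Nat.eq_of_mul_eq_mul_left hg0 ?_
    rw [hg, Nat.gcd_mul_lcm, ← hg, hp, hq]
    ring
  -- With a_i = g p and a_j = g q, Bézout gives p x + q y = 1. This is the determinant of the
  -- operation (C_I, C_J) ↦ (p C_I + q C_J, -y C_I + x C_J), which is therefore invertible over ℤ.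
  obtain ⟨x, y, hxy⟩ : ∃ x y : ℤ, (p : ℤ) * x + q * y = 1 := by
    refine ⟨Nat.gcdA (a i) (a j), Nat.gcdB (a i) (a j), ?_⟩
    have h1 := Nat.gcd_eq_gcd_ab (a i) (a j)
    have hg' : (g : ℤ) ≠ 0 := by exact_mod_cast hg0.ne'
    refine mul_left_cancel₀ hg' ?_
    have h2 : (a i : ℤ) = g * p := by exact_mod_cast hp
    have h3 : (a j : ℤ) = g * q := by exact_mod_cast hq
    calc (g : ℤ) * (p * _ + q * _) = (g * p) * Nat.gcdA (a i) (a j) + (g * q) * Nat.gcdB (a i) (a j) := by ring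
      _ = g * 1 := by rw [← h2, ← h3, ← h1, mul_one]
  have hai : (a i : ℤ) = g * p := by exact_mod_cast hp
  have haj : (a j : ℤ) = g * q := by exact_mod_cast hq
  set I := Fin.castLE hu i with hI
  set J := Fin.castLE hu j with hJ
  have hIJ : I ≠ J := fun h => hij (Fin.castLE_injective hu h)
  let C' : Fin r → Fin r → ℤ :=
    Function.update (Function.update C J ((-y) • C I + x • C J)) I ((p : ℤ) • C I + (q : ℤ) • C J)
  have hCI : C' I = (p : ℤ) • C I + (q : ℤ) • C J := Function.update_self ..
  have hCJ : C' J = (-y) • C I + x • C J := by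
    simp only [C']
    rw [Function.update_of_ne hIJ.symm, Function.update_self]
  have hCk : ∀ k, k ≠ I → k ≠ J → C' k = C k := fun k h1 h2 => by
    simp only [C']
    rw [Function.update_of_ne h1, Function.update_of_ne h2]
  set a' := Function.update (Function.update a j (Nat.lcm (a i) (a j))) i g with ha'
  have hai' : a' i = g := Function.update_self ..
  have haj' : a' j = g * (p * q) := by
    rw [ha', Function.update_of_ne hij.symm, Function.update_self, hl]
  have hak' : ∀ k, k ≠ i → k ≠ j → a' k = a k := fun k h1 h2 => by
    rw [ha', Function.update_of_ne h1, Function.update_of_ne h2]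
  have hCI' : C I = x • C' I + (-(q : ℤ)) • C' J := by
    rw [hCI, hCJ]
    calc C I = ((p : ℤ) * x + q * y) • C I := by rw [hxy, one_smul]
      _ = _ := by module
  have hCJ' : C J = y • C' I + (p : ℤ) • C' J := by
    rw [hCI, hCJ]
    calc C J = ((p : ℤ) * x + q * y) • C J := by rw [hxy, one_smul]
      _ = _ := by module
  refine ⟨fun k => ?_, C', ?_, ?_⟩
  · by_cases h1 : k = i
    · rw [h1, hai']; exact hg0
    by_cases h2 : k = j
    · rw [h2, ha', Function.update_of_ne hij.symm, Function.update_self]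
      exact Nat.lcm_pos (hpos i) (hpos j)
    · rw [hak' k h1 h2]; exact hpos k
  · rw [eq_top_iff, ← hC]
    exact span_range_le_of_two (fun k h1 h2 => (hCk k h1 h2).symm) hCI' hCJ'
  · rw [← hV]
    have hne : ∀ {k l : Fin u}, k ≠ l → Fin.castLE hu k ≠ Fin.castLE hu l :=
      fun h1 h2 => h1 (Fin.castLE_injective hu h2)
    apply le_antisymm
    · refine span_range_le_of_two (i := i) (j := j) (p := 1) (q := 1) (p' := -y * q) (q' := x * p)
        (fun k h1 h2 => ?_) ?_ ?_
      · rw [hak' k h1 h2, hCk _ (hne h1) (hne h2)]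
      · rw [hai', ← hI, ← hJ, hCI, hai, haj]
        module
      · rw [haj', ← hI, ← hJ, hCJ, hai, haj]
        push_cast
        module
    · refine span_range_le_of_two (i := i) (j := j) (p := x * p) (q := -1) (p' := y * q) (q' := 1)
        (fun k h1 h2 => ?_) ?_ ?_
      · rw [hak' k h1 h2, hCk _ (hne h1) (hne h2)]
      · rw [haj', hai', ← hI, ← hJ, hCI', hai]
        push_cast
        module
      · rw [haj', hai', ← hI, ← hJ, hCJ', haj]
        push_cast
        module

/-- Choose the divisors lexicographically minimal. If a_i ∤ a_j for some i < j, then replacing the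
two by gcd and lcm lowers entry i without touching earlier ones, a contradiction. -/
theorem exists_isLargestDivisor {r : ℕ} {V : Submodule ℤ (Fin r → ℤ)} (hV : V ≠ ⊥) :
    ∃ d, IsLargestDivisor V d := by
  obtain ⟨u, hu, a₀, ha₀⟩ := exists_hasDivisors V
  have hwf : WellFounded (Pi.Lex (· < ·) (fun {_ : Fin u} => ((· < ·) : ℕ → ℕ → Prop))) :=
    Pi.Lex.wellFounded _ fun _ => wellFounded_lt
  obtain ⟨a, ha, hmin⟩ := hwf.has_min {a | HasDivisors hu V a} ⟨a₀, ha₀⟩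
  have hchain : ∀ i j, i ≤ j → a i ∣ a j := by
    intro i j hij
    rcases hij.eq_or_lt with rfl | hij
    · exact dvd_rfl
    by_contra hnd
    refine hmin _ (ha.gcd_lcm hij.ne) ⟨i, fun k hk => ?_, ?_⟩
    · rw [Function.update_of_ne hk.ne, Function.update_of_ne (hk.trans hij).ne]
    · rw [Function.update_self]
      refine lt_of_le_of_ne (Nat.gcd_le_left _ (ha.1 i)) fun h => hnd ?_
      rw [← h]
      exact Nat.gcd_dvd_right _ _
  obtain ⟨hpos, C, hC, hV'⟩ := ha
  have hu0 : 0 < u := by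
    rw [pos_iff_ne_zero]
    rintro rfl
    apply hV
    rw [← hV', Set.range_eq_empty, Submodule.span_empty]
  let M : Matrix (Fin r) (Fin r) ℤ := Matrix.of C
  have hB : ∀ k : Fin r, ∃ c : Fin r → ℤ, Matrix.vecMul c M = Pi.single k 1 := by
    intro k
    have : (Pi.single k 1 : Fin r → ℤ) ∈ Submodule.span ℤ (Set.range C) := hC ▸ Submodule.mem_top
    obtain ⟨c, hc⟩ := (Submodule.mem_span_range_iff_exists_fun ℤ).mp this
    refine ⟨c, ?_⟩
    rw [Matrix.vecMul_eq_sum]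
    exact hc
  choose B hB using hB
  have hBM : Matrix.of B * M = 1 := by
    ext k l
    have := congrFun (hB k) l
    rw [Pi.single_apply] at this
    rw [Matrix.one_apply]
    simp only [eq_comm (a := k)]
    exact this
  -- The family C generates ℤ^r, so its matrix has a left inverse, which is two-sided for square
  -- matrices. Thus C is a basis and Z·B is diagonal.
  have hMB : M * Matrix.of B = 1 := mul_eq_one_comm.mp hBM
  let Z : Matrix (Fin u) (Fin r) ℤ := Matrix.of fun i => (a i : ℤ) • C (Fin.castLE hu i)
  have hZB : Z * Matrix.of B =
      Matrix.of (fun (i : Fin u) (j : Fin r) => if i.val = j.val then (a i : ℤ) else 0) := by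
    ext i j
    have h1 : (Z * Matrix.of B) i j = a i * (M * Matrix.of B) (Fin.castLE hu i) j := by
      simp only [Matrix.mul_apply, Finset.mul_sum, Z, M, Matrix.of_apply, Pi.smul_apply, smul_eq_mul,
        mul_assoc]
    rw [h1, hMB, Matrix.one_apply, Matrix.of_apply]
    simp [Fin.ext_iff]
  refine ⟨_, u, hu0, Z, 1, Matrix.of B, a, ⟨?_, hV'⟩, ?_, ?_, ?_, hpos, hchain, rfl⟩
  · rw [Fintype.linearIndependent_iff]
    intro c hc i
    have h1 : Matrix.vecMul c Z = 0 := by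
      rw [Matrix.vecMul_eq_sum]
      exact hc
    have h2 : Matrix.vecMul c (Z * Matrix.of B) (Fin.castLE hu i) = 0 := by
      rw [← Matrix.vecMul_vecMul, h1, Matrix.zero_vecMul]
      rfl
    rw [hZB] at h2
    change ∑ k, c k * (if k.val = i.val then (a k : ℤ) else 0) = 0 at h2
    rw [Finset.sum_eq_single i (fun k _ hk => by
      rw [if_neg fun h => hk (Fin.ext h), mul_zero]) (by simp)] at h2
    simpa [(hpos i).ne'] using h2
  · simp
  · exact (Matrix.isUnit_iff_isUnit_det _).mp (IsUnit.of_mul_eq_one _ hBM)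
  · rw [Matrix.one_mul, hZB]

end DiffRing

end

noncomputable section

/-! ### Computability -/

attribute [fun_prop] Computable Computable.const

namespace DiffRing

open Nat.Partrec

section Basic

variable {X α β γ : Type*} [Primcodable X] [Primcodable α] [Primcodable β] [Primcodable γ]

@[fun_prop]
theorem computable_id' : Computable fun x : α => x := Computable.id

@[fun_prop]
theorem computable_comp' {f : β → γ} {g : α → β} (hf : Computable f) (hg : Computable g) :
    Computable fun x => f (g x) := hf.comp hg

@[fun_prop]
theorem computable_fst' {f : X → α × β} (hf : Computable f) : Computable fun x => (f x).1 :=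
  Computable.fst.comp hf

@[fun_prop]
theorem computable_snd' {f : X → α × β} (hf : Computable f) : Computable fun x => (f x).2 :=
  Computable.snd.comp hf

@[fun_prop]
theorem computable_pair' {f : X → α} {g : X → β} (hf : Computable f) (hg : Computable g) :
    Computable fun x => (f x, g x) := hf.pair hg

@[fun_prop]
theorem computable_getD {f : X → List α} {g : X → ℕ} (d : α) (hf : Computable f)
    (hg : Computable g) : Computable fun x => (f x).getD (g x) d :=
  (Primrec.list_getD d).to_comp.comp hf hg

@[fun_prop]
theorem computable_length {f : X → List α} (hf : Computable f) :
    Computable fun x => (f x).length := Computable.list_length.comp hf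

@[fun_prop]
theorem computable_cons {f : X → α} {g : X → List α} (hf : Computable f) (hg : Computable g) :
    Computable fun x => f x :: g x := Computable.list_cons.comp hf hg

@[fun_prop]
theorem computable_map_fst {f : X → List (α × β)} (hf : Computable f) :
    Computable fun x => (f x).map Prod.fst :=
  (Primrec.list_map Primrec.id (Primrec.fst.comp Primrec.snd).to₂).to_comp.comp hf

@[fun_prop]
theorem computable_encode {f : X → α} (hf : Computable f) :
    Computable fun x => Encodable.encode (f x) := Computable.encode.comp hf

@[fun_prop]
theorem computable_some {f : X → α} (hf : Computable f) :
    Computable fun x => some (f x) := Computable.option_some.comp hf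

@[fun_prop]
theorem computable_optionGetD {f : X → Option α} {g : X → α} (hf : Computable f)
    (hg : Computable g) : Computable fun x => (f x).getD (g x) :=
  Primrec.option_getD.to_comp.comp hf hg

@[fun_prop]
theorem computable_evaln {k : X → ℕ} {c : X → Code} {n : X → ℕ} (hk : Computable k)
    (hc : Computable c) (hn : Computable n) : Computable fun x => (c x).evaln (k x) (n x) :=
  Code.primrec_evaln.to_comp.comp ((hk.pair hc).pair hn)

/-- Addition is computable. -/
class ComputableAdd (M : Type*) [Add M] [Primcodable M] : Prop where
  add : Computable₂ fun a b : M => a + b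

/-- Multiplication is computable. -/
class ComputableMul (M : Type*) [Mul M] [Primcodable M] : Prop where
  mul : Computable₂ fun a b : M => a * b

/-- Exponentiation with exponents in `E` is computable. -/
class ComputablePow (M E : Type*) [Pow M E] [Primcodable M] [Primcodable E] : Prop where
  pow : Computable₂ fun (a : M) (e : E) => a ^ e

@[fun_prop]
theorem computable_add [Add α] [ComputableAdd α] {f g : X → α} (hf : Computable f)
    (hg : Computable g) : Computable fun x => f x + g x := ComputableAdd.add.comp hf hg

@[fun_prop]
theorem computable_mul [Mul α] [ComputableMul α] {f g : X → α} (hf : Computable f)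
    (hg : Computable g) : Computable fun x => f x * g x := ComputableMul.mul.comp hf hg

@[fun_prop]
theorem computable_pow [Pow α β] [ComputablePow α β] {f : X → α} {g : X → β} (hf : Computable f)
    (hg : Computable g) : Computable fun x => f x ^ g x := ComputablePow.pow.comp hf hg

instance : ComputableAdd ℕ := ⟨Primrec.nat_add.to_comp⟩

instance : ComputableMul ℕ := ⟨Primrec.nat_mul.to_comp⟩

@[fun_prop]
theorem computable_natMod {f g : X → ℕ} (hf : Computable f) (hg : Computable g) :
    Computable fun x => f x % g x := Primrec.nat_mod.to_comp.comp hf hg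

end Basic

/-! ### Computable integer arithmetic -/

section Int

variable {X : Type*} [Primcodable X]

theorem encode_int_natCast (n : ℕ) : Encodable.encode (n : ℤ) = 2 * n := rfl

theorem encode_int_negSucc (n : ℕ) : Encodable.encode (Int.negSucc n) = 2 * n + 1 := rfl

/-- The code of n ≥ 0 is 2n and that of -(n + 1) is 2n + 1, so parity reveals the sign. Integer
operations are then reduced to natural numbers through positive and negative parts. -/
theorem primrec_toNat : Primrec Int.toNat := by
  have h : Primrec fun z : ℤ =>
      if Encodable.encode z % 2 = 0 then Encodable.encode z / 2 else 0 :=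
    Primrec.ite (Primrec.eq.comp (Primrec.nat_mod.comp Primrec.encode (Primrec.const 2))
      (Primrec.const 0)) (Primrec.nat_div.comp Primrec.encode (Primrec.const 2)) (Primrec.const 0)
  refine h.of_eq fun z => ?_
  cases z with
  | ofNat n =>
    have := encode_int_natCast n
    rw [Int.ofNat_eq_natCast, this]
    simp
  | negSucc n =>
    rw [encode_int_negSucc]
    simp

theorem primrec_neg_toNat : Primrec fun z : ℤ => (-z).toNat := by
  have h : Primrec fun z : ℤ =>
      if Encodable.encode z % 2 = 0 then 0 else Encodable.encode z / 2 + 1 :=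
    Primrec.ite (Primrec.eq.comp (Primrec.nat_mod.comp Primrec.encode (Primrec.const 2))
      (Primrec.const 0)) (Primrec.const 0)
      (Primrec.succ.comp (Primrec.nat_div.comp Primrec.encode (Primrec.const 2)))
  refine h.of_eq fun z => ?_
  cases z with
  | ofNat n =>
    have := encode_int_natCast n
    rw [Int.ofNat_eq_natCast, this]
    simp
  | negSucc n =>
    rw [encode_int_negSucc]
    have : (2 * n + 1) % 2 = 1 := by omega
    have h2 : (2 * n + 1) / 2 = n := by omega
    rw [this, h2, Int.neg_negSucc]
    simp

theorem primrec_natSub : Primrec₂ fun a b : ℕ => (a : ℤ) - b := by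
  refine Primrec.encode_iff.mp ?_
  have h : Primrec fun p : ℕ × ℕ =>
      if p.2 ≤ p.1 then 2 * (p.1 - p.2) else 2 * (p.2 - p.1 - 1) + 1 :=
    Primrec.ite (Primrec.nat_le.comp Primrec.snd Primrec.fst)
      (Primrec.nat_mul.comp (Primrec.const 2) Primrec.nat_sub)
      (Primrec.succ.comp (Primrec.nat_mul.comp (Primrec.const 2)
        (Primrec.nat_sub.comp (Primrec.nat_sub.comp Primrec.snd Primrec.fst) (Primrec.const 1))))
  refine h.of_eq fun p => ?_
  obtain ⟨a, b⟩ := p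
  dsimp only
  split_ifs with hab
  · have : (a : ℤ) - b = ((a - b : ℕ) : ℤ) := by omega
    rw [this, encode_int_natCast]
  · have : (a : ℤ) - b = Int.negSucc (b - a - 1) := by omega
    rw [this, encode_int_negSucc]

@[fun_prop]
theorem computable_toNat {f : X → ℤ} (hf : Computable f) : Computable fun x => (f x).toNat :=
  primrec_toNat.to_comp.comp hf

@[fun_prop]
theorem computable_neg_toNat {f : X → ℤ} (hf : Computable f) :
    Computable fun x => (-f x).toNat :=
  primrec_neg_toNat.to_comp.comp hf

theorem computable_natSub {f g : X → ℕ} (hf : Computable f) (hg : Computable g) :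
    Computable fun x => (f x : ℤ) - g x :=
  primrec_natSub.to_comp.comp hf hg

@[fun_prop]
theorem computable_intCast {f : X → ℕ} (hf : Computable f) : Computable fun x => (f x : ℤ) :=
  (computable_natSub hf (Computable.const 0)).of_eq fun x => by simp

instance : ComputableAdd ℤ := ⟨by
  refine (computable_natSub (f := fun x : ℤ × ℤ => x.1.toNat + x.2.toNat)
    (g := fun x => (-x.1).toNat + (-x.2).toNat) (by fun_prop) (by fun_prop)).of_eq fun x => ?_
  dsimp only
  omega⟩

instance : ComputableMul ℤ := ⟨by
  refine (computable_natSub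
    (f := fun x : ℤ × ℤ => x.1.toNat * x.2.toNat + (-x.1).toNat * (-x.2).toNat)
    (g := fun x => x.1.toNat * (-x.2).toNat + (-x.1).toNat * x.2.toNat)
    (by fun_prop) (by fun_prop)).of_eq fun x => ?_
  have h1 := Int.toNat_sub_toNat_neg x.1
  have h2 := Int.toNat_sub_toNat_neg x.2
  dsimp only
  conv_rhs => rw [← h1, ← h2]
  push_cast
  ring⟩

@[fun_prop]
theorem computable_ite_eq {f g : X → ℕ} (hf : Computable f) (hg : Computable g) :
    Computable fun x => if f x = g x then (1 : ℤ) else 0 :=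
  ((Primrec.ite (Primrec.eq.comp Primrec.fst Primrec.snd) (Primrec.const 1)
    (Primrec.const 0)).to_comp (f := fun p : ℕ × ℕ => if p.1 = p.2 then (1 : ℤ) else 0)).comp
    (hf.pair hg)

theorem natCast_dvd_iff_toNat (d : ℕ) (z : ℤ) :
    (d : ℤ) ∣ z ↔ (z.toNat + (-z).toNat) % d = 0 := by
  rw [← Nat.dvd_iff_mod_eq_zero, Int.natCast_dvd]
  have : z.natAbs = z.toNat + (-z).toNat := by omega
  rw [this]

end Int

/-! ### Computable finite sums and products -/

section Fold

variable {X M : Type*} [Primcodable X] [Primcodable M]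

@[fun_prop]
theorem computable_sum_range [AddCommMonoid M] [ComputableAdd M] {k : X → ℕ} {f : X → ℕ → M}
    (hk : Computable k) (hf : Computable fun p : X × ℕ => f p.1 p.2) :
    Computable fun x => ∑ i ∈ Finset.range (k x), f x i := by
  have h := Computable.nat_rec (f := k) (g := fun _ => (0 : M))
    (h := fun x p => p.2 + f x p.1) hk (Computable.const 0)
    (ComputableAdd.add.comp (show Computable fun q : X × ℕ × M => q.2.2 by fun_prop)
      (hf.comp (show Computable fun q : X × ℕ × M => (q.1, q.2.1) by fun_prop)))
  refine h.of_eq fun x => ?_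
  induction k x with
  | zero => rfl
  | succ n ih => rw [Finset.sum_range_succ, ← ih]

@[fun_prop]
theorem computable_prod_range [CommMonoid M] [ComputableMul M] {k : X → ℕ} {f : X → ℕ → M}
    (hk : Computable k) (hf : Computable fun p : X × ℕ => f p.1 p.2) :
    Computable fun x => ∏ i ∈ Finset.range (k x), f x i := by
  have h := Computable.nat_rec (f := k) (g := fun _ => (1 : M))
    (h := fun x p => p.2 * f x p.1) hk (Computable.const 1)
    (ComputableMul.mul.comp (show Computable fun q : X × ℕ × M => q.2.2 by fun_prop)
      (hf.comp (show Computable fun q : X × ℕ × M => (q.1, q.2.1) by fun_prop)))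
  refine h.of_eq fun x => ?_
  induction k x with
  | zero => rfl
  | succ n ih => rw [Finset.prod_range_succ, ← ih]

end Fold

/-- A field with computable inversion. -/
class ComputableInv (F : Type*) [Field F] [Primcodable F] : Prop where
  inv : Computable fun a : F => a⁻¹

section Field

variable {X F : Type*} [Primcodable X] [Field F] [Primcodable F] [ComputableInv F]

@[fun_prop]
theorem computable_fieldInv {f : X → F} (hf : Computable f) :
    Computable fun x => (f x)⁻¹ := ComputableInv.inv.comp hf

instance computablePow_nat {M : Type*} [CommMonoid M] [Primcodable M] [ComputableMul M] :
    ComputablePow M ℕ :=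
  ⟨(computable_prod_range (X := M × ℕ) (k := fun x => x.2) (f := fun x _ => x.1) (by fun_prop)
    (by fun_prop)).of_eq fun x => by simp⟩

instance computablePow_int [ComputableMul F] : ComputablePow F ℤ := ⟨by
  refine Computable.of_eq (f := fun x : F × ℤ => x.1 ^ x.2.toNat * x.1⁻¹ ^ (-x.2).toNat)
    (by fun_prop) fun x => ?_
  obtain ⟨n, h | h⟩ := x.2.eq_nat_or_neg
  · simp [h]
  · simp [h]⟩

end Field

/-! ### Decidable predicates -/

section Pred

variable {X α : Type*} [Primcodable X] [Primcodable α] {P Q : X → Prop}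

theorem computablePred_of_bool {b : X → Bool} (hb : Computable b) (h : ∀ x, b x = true ↔ P x) :
    ComputablePred P := by
  classical
  refine ⟨Classical.decPred P, hb.of_eq fun x => ?_⟩
  rw [Bool.eq_iff_iff, h, decide_eq_true_iff]

theorem computablePred_and (hP : ComputablePred P) (hQ : ComputablePred Q) :
    ComputablePred fun x => P x ∧ Q x := by
  obtain ⟨_, hP⟩ := hP
  obtain ⟨_, hQ⟩ := hQ
  exact computablePred_of_bool (Primrec.and.to_comp.comp hP hQ) fun x => by simp

theorem computablePred_eq {f g : X → α} (hf : Computable f) (hg : Computable g) :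
    ComputablePred fun x => f x = g x :=
  computablePred_of_bool (b := fun x => decide (Encodable.encode (f x) = Encodable.encode (g x)))
    ((Primrec.eq (α := ℕ)).decide.to_comp.comp (Computable.encode.comp hf)
      (Computable.encode.comp hg)) fun x => by simp

theorem computablePred_ne {f g : X → α} (hf : Computable f) (hg : Computable g) :
    ComputablePred fun x => f x ≠ g x := (computablePred_eq hf hg).not

theorem computablePred_le {f g : X → ℕ} (hf : Computable f) (hg : Computable g) :
    ComputablePred fun x => f x ≤ g x :=
  computablePred_of_bool (b := fun x => decide (f x ≤ g x))
    (Primrec.nat_le.decide.to_comp.comp hf hg) fun x => by simp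

theorem computablePred_lt {f g : X → ℕ} (hf : Computable f) (hg : Computable g) :
    ComputablePred fun x => f x < g x :=
  computablePred_le (f := fun x => f x + 1) (by fun_prop) hg

theorem computablePred_dvd {f : X → ℕ} {g : X → ℤ} (hf : Computable f) (hg : Computable g) :
    ComputablePred fun x => (f x : ℤ) ∣ g x := by
  simp only [natCast_dvd_iff_toNat]
  exact computablePred_eq (by fun_prop) (by fun_prop)

theorem computablePred_ball {k : X → ℕ} {R : X → ℕ → Prop} (hk : Computable k)
    (hR : ComputablePred fun p : X × ℕ => R p.1 p.2) :
    ComputablePred fun x => ∀ i < k x, R x i := by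
  obtain ⟨inst, hR⟩ := hR
  have h := Computable.nat_rec (f := k) (g := fun _ => true)
    (h := fun x p => p.2 && @decide (R x p.1) (inst (x, p.1))) hk (Computable.const true)
    (Primrec.and.to_comp.comp (show Computable fun q : X × ℕ × Bool => q.2.2 by fun_prop)
      (hR.comp (show Computable fun q : X × ℕ × Bool => (q.1, q.2.1) by fun_prop)))
  refine computablePred_of_bool h fun x => ?_
  induction k x with
  | zero => simp
  | succ n ih =>
    simp only [Bool.and_eq_true, decide_eq_true_eq] at ih ⊢
    rw [ih]
    constructor
    · rintro ⟨h1, h2⟩ i hi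
      rcases Nat.lt_succ_iff_lt_or_eq.mp hi with h | h
      · exact h1 i h
      · exact h ▸ h2
    · intro h
      exact ⟨fun i hi => h i (by omega), h n (by omega)⟩

end Pred

/-- Unbounded search for an object with a computable property. -/
theorem exists_search {X Y Z : Type*} [Primcodable X] [Primcodable Y] [Primcodable Z]
    {P : X × Y → Prop} (hP : ComputablePred P) {out : Y → Z} (hout : Computable out) :
    ∃ alg : X →. Z, Partrec alg ∧
      ∀ x, (∃ y, P (x, y)) → ∃ y, P (x, y) ∧ out y ∈ alg x := by
  obtain ⟨_, hP⟩ := hP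
  let f : X → ℕ → Option Z := fun x n =>
    (Encodable.decode (α := Y) n).bind fun y => bif decide (P (x, y)) then some (out y) else none
  have hf : Computable₂ f := by
    refine Computable.option_bind (f := fun p : X × ℕ => Encodable.decode (α := Y) p.2)
      (g := fun p y => bif decide (P (p.1, y)) then some (out y) else none)
      (Computable.decode.comp Computable.snd) ?_
    exact Computable.cond (hP.comp (g := fun q : (X × ℕ) × Y => (q.1.1, q.2)) (by fun_prop))
      (Computable.option_some.comp (hout.comp Computable.snd)) (Computable.const none)
  refine ⟨fun x => Nat.rfindOpt (f x), Partrec.rfindOpt hf, fun x ⟨y, hy⟩ => ?_⟩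
  have hdom : (Nat.rfindOpt (f x)).Dom := by
    rw [Nat.rfindOpt_dom]
    refine ⟨Encodable.encode y, out y, ?_⟩
    simp [f, hy]
  -- The candidate y only guarantees termination; the search may stop at another y', for which the
  -- property was tested as well.
  obtain ⟨n, hn⟩ := Nat.rfindOpt_spec (Part.get_mem hdom)
  obtain ⟨y', hy', h⟩ := Option.bind_eq_some_iff.mp hn
  by_cases hp : P (x, y')
  · refine ⟨y', hp, ?_⟩
    simp only [hp, decide_true, cond_true, Option.some.injEq] at h
    rw [h]
    exact Part.get_mem hdom
  · simp [hp] at h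

end DiffRing

end

noncomputable section

namespace DiffRing

open Filter AddMonoidAlgebra

variable {F : Type*} [Field F]

/-! ### Optimal representations -/

theorem isUnit_xVar {s l : ℕ} {ord : Fin l → ℕ} (i : Fin s) :
    IsUnit (xVar i : APRing F s ord) :=
  (monoUnit (.ofAdd (Pi.single i 1)) : (APRing F s ord)ˣ).isUnit

/-- Existence of optimal representations, together with their evaluation functions. -/
theorem exists_optimalRep {σ : RingAut F} (hσ : RadicalStable σ)
    {τ₀ : F →+* SeqRing (constField σ)} (hτ₀ : IsKHom σ σ τ₀) {r : ℕ} {α : Fin r → Fˣ}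
    {σE : RingAut (PRing F r)} {τE : PRing F r →+* SeqRing (constField σ)}
    (hE : IsPExtension σ α σE) (hτE : IsKHom σ σE τE)
    (hbase : ∀ f : F, τE (algebraMap F _ f) = τ₀ f) {u d : ℕ}
    (hu : Module.finrank ℤ (multRel σ α) = u) (hd : IsLargestDivisor (multRel σ α) d) :
    ∃ (s : ℕ) (D : RepData F r s u) (σH : RingAut (HRing F s D.d))
      (τH : HRing F s D.d →+* SeqRing (constField σ)) (lam : PRing F r →+* HRing F s D.d),
      s + u = r ∧ D.d = d ∧ IsOptimalRep σ τ₀ σE τE D σH τH lam ∧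
      ∀ ev : F → ℕ → constField σ, Represents ev τ₀ →
        ∃ (κ : Fin s → constField σ) (l : Fin s → ℕ), HasProductEval σ ev D σH τH κ l := by
  obtain ⟨u', _, Z, _, _, _, hZ, -⟩ := id hd
  obtain rfl : u' = u := hZ.finrank_eq.symm.trans hu
  obtain ⟨s, rfl⟩ := Nat.exists_eq_add_of_le hZ.le
  obtain ⟨D, -, hDd, ρ, v, vz, hD⟩ := exists_cert hσ hτ₀ hE hτE hbase hd hZ
  obtain ⟨σH, τH, hH, -, hz⟩ := hD.exists_rep hE hτE hbase
  refine ⟨s, D, σH, τH, IsCert.lam D, Nat.add_comm _ _, hDd, hH, fun ev hev => ?_⟩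
  have hX : ∀ i : Fin s, shift (τH (xVar i)) = toSeq (ev (D.α i : F)) * τH (xVar i) := by
    intro i
    rw [← hH.embedding.map_shift, hH.map_x, map_mul, hH.embedding_base, hev]
  choose κ l hκ hl hx using fun i => exists_product_form ((isUnit_xVar i).map τH) (hX i)
  exact ⟨κ, l, hasProductEval_of_toSeq hev hH.embedding.toIsKHom hH.embedding_base hD.rho hz hκ hl hx⟩

/-- The other representation is itself a competitor in the minimality statement, and the lcm of its
orders divides its d since there is at most one R-monomial. -/
theorem IsMinimal.le_of_isOptimalRep {σ : RingAut F} {τ₀ : F →+* SeqRing (constField σ)} {r : ℕ}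
    {σE : RingAut (PRing F r)} {τE : PRing F r →+* SeqRing (constField σ)} {s d : ℕ}
    (h : IsMinimal σ τ₀ σE τE s d) {s' u' : ℕ} {D : RepData F r s' u'}
    {σH : RingAut (HRing F s' D.d)} {τH : HRing F s' D.d →+* SeqRing (constField σ)}
    {lam : PRing F r →+* HRing F s' D.d} (hH : IsOptimalRep σ τ₀ σE τE D σH τH lam)
    (hD : 0 < D.d) : d ≤ D.d := by
  by_cases hd : 1 < d
  · obtain ⟨-, h2⟩ := h _ _ _ σH τH lam hH.rpi hH.embedding hH.embedding_base hH.lam_shift hH.commutes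
    refine (h2 hd).2.1.trans (Nat.le_of_dvd hD (Finset.lcm_dvd fun _ _ => dvd_rfl))
  · omega

/-- The largest divisor can be read off from any certificate. -/
theorem IsCert.isLargestDivisor {σ : RingAut F} (hσ : RadicalStable σ)
    {τ₀ : F →+* SeqRing (constField σ)} (hτ₀ : IsKHom σ σ τ₀) {r s u : ℕ} {α : Fin r → Fˣ}
    {σE : RingAut (PRing F r)} {τE : PRing F r →+* SeqRing (constField σ)} {D : RepData F r s u}
    {ρ : (constField σ)ˣ} {v : Fin s → Fin r → ℤ} {vz : Fin r → ℤ}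
    (h : IsCert σ α τ₀ τE D ρ v vz) (hE : IsPExtension σ α σE) (hτE : IsKHom σ σE τE)
    (hbase : ∀ f : F, τE (algebraMap F _ f) = τ₀ f) (hV : multRel σ α ≠ ⊥) :
    IsLargestDivisor (multRel σ α) D.d := by
  -- A second certificate is built from the true largest divisor. Each of the two representations
  -- competes with the other, so their values of d agree.
  obtain ⟨d, hd⟩ := exists_isLargestDivisor hV
  obtain ⟨σH, τH, hH, -⟩ := h.exists_rep hE hτE hbase
  obtain ⟨u', _, Z, _, _, _, hZ, -⟩ := id hd
  obtain ⟨s', rfl⟩ := Nat.exists_eq_add_of_le hZ.le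
  obtain ⟨D', -, rfl, ρ', v', vz', h'⟩ := exists_cert hσ hτ₀ hE hτE hbase hd hZ
  obtain ⟨σH', τH', hH', -⟩ := h'.exists_rep hE hτE hbase
  have := le_antisymm (hH.minimal.le_of_isOptimalRep hH' h'.d_pos)
    (hH'.minimal.le_of_isOptimalRep hH h.d_pos)
  rwa [this]

/-! ### Verification of certificates by evaluation -/

section Eval

variable {σ : RingAut F} {r : ℕ} {σE : RingAut (PRing F r)}
  {evE : PRing F r → ℕ → constField σ} {LE : PRing F r → ℕ}

theorem IsOSigmaFun.map_succ (hL : IsOSigmaFun σE evE LE) (y : PRing F r) {n : ℕ} (hn : LE y ≤ n) :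
    evE (σE y) n = evE y (n + 1) := by
  simpa using hL.map_shift y 1 n (by simpa using hn) (n + 1) (by simp)

theorem IsOSigmaFun.eval_const_mul (hL : IsOSigmaFun σE evE LE) {y : PRing F r} {c : PRing F r}
    (hy : σE y = c * y) {n : ℕ} (hyn : LE y ≤ n) (hcn : LE c ≤ n) :
    evE y (n + 1) = evE c n * evE y n := by
  rw [← hL.map_succ y hyn, hy, hL.map_mul _ _ _ (max_le hcn hyn)]

theorem IsOSigmaFun.eval_fixed (hL : IsOSigmaFun σE evE LE) {y : PRing F r} (hy : σE y = y) {N : ℕ}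
    (hN : LE y ≤ N) {n : ℕ} (hn : N ≤ n) : evE y n = evE y N := by
  induction n, hn using Nat.le_induction with
  | base => rfl
  | succ n hn ih => rw [← hL.map_succ y (hN.trans hn), hy, ih]

/-- From its bound on the value at a fixed element no longer changes, and eventually it is c, so it
equals c already from the bound on. -/
theorem IsOSigmaFun.eval_constField (hL : IsOSigmaFun σE evE LE) (hev : IsEvalFun σ σE evE)
    {c : constField σ} (hc : σE (algebraMap F _ (c : F)) = algebraMap F _ (c : F)) {n : ℕ}
    (hn : LE (algebraMap F _ (c : F)) ≤ n) : evE (algebraMap F _ (c : F)) n = c := by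
  obtain ⟨N, hN⟩ := hev.map_const c
  rw [← hL.eval_fixed hc hn (le_max_left n N), hN _ (le_max_right _ _)]

variable {α : Fin r → Fˣ} {s u : ℕ} {D : RepData F r s u} {ρ : (constField σ)ˣ}
  {v : Fin s → Fin r → ℤ} {vz : Fin r → ℤ}

/-- Dividing x̂^w by γ^w leaves an element whose shift quotient is that of a monomial in the x_j and
z. For w = n_k, v j, vz these quotients are 1, α_j and ρ, which yields the recurrences behind the
evaluation tests. -/
theorem IsAlgCert.map_quotient (h : IsAlgCert σ α D ρ v vz) (hE : IsPExtension σ α σE)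
    (w : Fin r → ℤ) :
    σE (algebraMap F _ (((pw D.γ w : Fˣ) : F)⁻¹) * mono w 0) =
      algebraMap F _ ((pw D.α (expM D.m w) * rootUnit ρ ^ expO D.o w : Fˣ) : F) *
        (algebraMap F _ (((pw D.γ w : Fˣ) : F)⁻¹) * mono w 0) := by
  rw [map_mul, hE.map_base, hE.map_mono, ← mul_assoc, ← mul_assoc, ← map_mul, ← map_mul]
  congr 2
  have h1 : onUnits σ (pw D.γ w)⁻¹ * pw α w =
      pw D.α (expM D.m w) * rootUnit ρ ^ expO D.o w * (pw D.γ w)⁻¹ := by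
    rw [map_inv, inv_mul_eq_iff_eq_mul, ← mul_assoc, RepData.compat_pw h.rho h.compat w,
      mul_inv_cancel_right]
  simpa [onUnits] using congrArg Units.val h1

variable {τ₀ : F →+* SeqRing (constField σ)} {τE : PRing F r →+* SeqRing (constField σ)}
  {ev : F → ℕ → constField σ} {κ : Fin s → constField σ} {N : ℕ}

theorem tau_mono_eq (hbase : ∀ f : F, τE (algebraMap F _ f) = τ₀ f) (c : Fˣ) (w : Fin r → ℤ) :
    τE (mono w 0) = τ₀ (c : F) * τE (algebraMap F _ ((c : F)⁻¹) * mono w 0) := by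
  rw [map_mul, hbase, ← mul_assoc, ← map_mul, mul_inv_cancel₀ c.ne_zero, map_one, one_mul]

/-- All recurrences hold from N on, because N exceeds the relevant bounds. Agreement at N therefore
propagates to all n ≥ N, which is equality in the ring of sequences. -/
theorem IsEvalCert.isCert (h : IsEvalCert evE LE D ρ v vz κ N) (hA : IsAlgCert σ α D ρ v vz)
    (hE : IsPExtension σ α σE) (hev : IsEvalFun σ σE evE) (hL : IsOSigmaFun σE evE LE)
    (hrep : Represents evE τE) (hbase : ∀ f : F, τE (algebraMap F _ f) = τ₀ f) :
    IsCert σ α τ₀ τE D ρ v vz where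
  toIsAlgCert := hA
  tau_n k := by
    have h1 := hA.map_quotient hE (D.n k)
    rw [hA.m_n, pw_zero, rootUnit_zpow_of_dvd hA.rho_pow (hA.o_n k), mul_one, Units.val_one,
      map_one, one_mul, ← hA.g_eq] at h1
    have h2 : τE (algebraMap F _ ((D.g k : F)⁻¹) * mono (D.n k) 0) = 1 := by
      rw [hrep, ← toSeq_one, toSeq_eq_iff]
      exact ⟨N, fun n hn => by rw [hL.eval_fixed h1 (h.bound_n k) hn, h.eval_n]⟩
    rw [tau_mono_eq hbase (D.g k), h2, mul_one]
  tau_vz := by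
    have h1 := hA.map_quotient hE vz
    have h0 : rootUnit ρ ^ expO D.o vz = rootUnit ρ := by
      have := rootUnit_zpow_of_dvd hA.rho_pow hA.o_vz
      rwa [zpow_sub_one, mul_inv_eq_one] at this
    have h0' : ((rootUnit ρ : Fˣ) : F) = D.ρ := hA.rho
    rw [hA.m_vz, pw_zero, one_mul, h0, h0'] at h1
    have hfix : σE (algebraMap F _ (((ρ : constField σ)) : F)) =
        algebraMap F _ (((ρ : constField σ)) : F) := by
      rw [hE.map_base]
      exact congrArg _ (ρ : constField σ).2
    rw [tau_mono_eq hbase (pw D.γ vz), val_geom, hrep]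
    congr 1
    rw [toSeq_eq_iff]
    refine ⟨N, fun n hn => ?_⟩
    induction n, hn using Nat.le_induction with
    | base => exact h.eval_vz
    | succ n hn ih =>
      have hb := h.bound_ρ.trans hn
      rw [hL.eval_const_mul h1 (h.bound_vz.trans hn) hb, ih, pow_succ']
      rw [← hA.rho] at hb ⊢
      rw [hL.eval_constField hev hfix hb]

theorem IsEvalCert.tau_v (h : IsEvalCert evE LE D ρ v vz κ N) (hA : IsAlgCert σ α D ρ v vz)
    (hE : IsPExtension σ α σE) (hL : IsOSigmaFun σE evE LE) (hrep : Represents evE τE)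
    (hevE : ∀ (f : F) (n : ℕ), evE (algebraMap F _ f) n = ev f n) (j : Fin s) :
    τE (algebraMap F _ (((pw D.γ (v j))⁻¹ : Fˣ) : F) * mono (v j) 0) =
      toSeq fun n => κ j * ∏ k ∈ Finset.Icc (N + 1) n, ev (D.α j : F) (k - 1) := by
  have h1 := hA.map_quotient hE (v j)
  rw [hA.m_v, pw_single, zpow_one, rootUnit_zpow_of_dvd hA.rho_pow (hA.o_v j), mul_one] at h1
  rw [Units.val_inv_eq_inv_val, hrep, toSeq_eq_iff]
  refine ⟨N, fun n hn => ?_⟩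
  rw [← h.eval_v j]
  refine eq_prod_of_recurrence (fun n hn => ?_) hn
  rw [hL.eval_const_mul h1 ((h.bound_v j).trans hn) ((h.bound_α j).trans hn), hevE]

/-- Correctness of the verification of certificates by evaluation at a single point. -/
theorem IsEvalCert.exists_rep (h : IsEvalCert evE LE D ρ v vz κ N) (hA : IsAlgCert σ α D ρ v vz)
    (hσ : RadicalStable σ) (hτ₀ : IsKHom σ σ τ₀) (hev₀ : Represents ev τ₀)
    (hE : IsPExtension σ α σE) (hτE : IsKHom σ σE τE)
    (hev : IsEvalFun σ σE evE) (hL : IsOSigmaFun σE evE LE)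
    (hrep : Represents evE τE) (hevE : ∀ (f : F) (n : ℕ), evE (algebraMap F _ f) n = ev f n)
    (hV : multRel σ α ≠ ⊥) :
    ∃ (σH : RingAut (HRing F s D.d)) (τH : HRing F s D.d →+* SeqRing (constField σ))
      (lam : PRing F r →+* HRing F s D.d),
      IsLargestDivisor (multRel σ α) D.d ∧ IsOptimalRep σ τ₀ σE τE D σH τH lam ∧
      HasProductEval σ ev D σH τH κ fun _ => N + 1 := by
  have hbase : ∀ f : F, τE (algebraMap F _ f) = τ₀ f := fun f => by
    rw [hrep, hev₀, funext (hevE f)]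
  have hC := h.isCert hA hE hev hL hrep hbase
  obtain ⟨σH, τH, hH, hx, hz⟩ := hC.exists_rep hE hτE hbase
  have hx' := fun j => (hx j).trans (h.tau_v hA hE hL hrep hevE j)
  refine ⟨σH, τH, _, hC.isLargestDivisor hσ hτ₀ hE hτE hbase hV, hH,
    hasProductEval_of_toSeq hev₀ hH.embedding.toIsKHom hH.embedding_base hA.rho hz
      (fun i => ?_) (fun _ => Nat.le_add_left 1 N) hx'⟩
  have := (isUnit_xVar i).map τH
  rw [hx' i] at this
  exact ne_zero_of_isUnit_toSeq_mul this

/-- Completeness of the verification of certificates by evaluation at a single point. -/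
theorem IsCert.exists_evalCert (h : IsCert σ α τ₀ τE D ρ v vz)
    (hbase : ∀ f : F, τE (algebraMap F _ f) = τ₀ f) (hrep : Represents evE τE)
    (LE : PRing F r → ℕ) : ∃ κ N, IsEvalCert evE LE D ρ v vz κ N := by
  have h1 : ∀ k, τE (algebraMap F _ ((D.g k : F)⁻¹) * mono (D.n k) 0) = 1 := by
    intro k
    rw [map_mul, h.tau_n, hbase, ← map_mul, inv_mul_cancel₀ (D.g k).ne_zero, map_one]
  have h2 : τE (algebraMap F _ (((pw D.γ vz : Fˣ) : F)⁻¹) * mono vz 0) = geom ρ := by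
    rw [map_mul, h.tau_vz, hbase, ← mul_assoc, ← map_mul, inv_mul_cancel₀ (Units.ne_zero _),
      map_one, one_mul]
  simp only [hrep _, ← toSeq_one, toSeq_eq_iff, val_geom] at h1 h2
  choose M hM using h1
  obtain ⟨M', hM'⟩ := h2
  -- A sum of natural numbers dominates each of its summands, so this N lies beyond every bound at
  -- once.
  obtain ⟨N, hN⟩ : ∃ N, N = (∑ k, M k) + M' +
    (∑ k, LE (algebraMap F _ ((D.g k : F)⁻¹) * mono (D.n k) 0)) +
    (∑ j, LE (algebraMap F _ (((pw D.γ (v j) : Fˣ) : F)⁻¹) * mono (v j) 0)) +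
    (∑ j, LE (algebraMap F _ (D.α j : F))) +
    LE (algebraMap F _ (((pw D.γ vz : Fˣ) : F)⁻¹) * mono vz 0) + LE (algebraMap F _ D.ρ) := ⟨_, rfl⟩
  refine ⟨fun j => evE (algebraMap F _ (((pw D.γ (v j) : Fˣ) : F)⁻¹) * mono (v j) 0) N, N, ?_⟩
  have hsum : ∀ {t : ℕ} (f : Fin t → ℕ) (i : Fin t), f i ≤ ∑ k, f k := fun f i =>
    Finset.single_le_sum (fun _ _ => Nat.zero_le _) (Finset.mem_univ i)
  exact
  { bound_n := fun k => by
      have := hsum (fun k => LE (algebraMap F _ ((D.g k : F)⁻¹) * mono (D.n k) 0)) k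
      omega
    eval_n := fun k => hM k _ (by have := hsum M k; omega)
    bound_v := fun j => by
      have := hsum (fun j => LE (algebraMap F _ (((pw D.γ (v j) : Fˣ) : F)⁻¹) * mono (v j) 0)) j
      omega
    eval_v := fun j => rfl
    bound_α := fun j => by
      have := hsum (fun j => LE (algebraMap F _ (D.α j : F))) j
      omega
    bound_vz := by omega
    eval_vz := hM' _ (by omega)
    bound_ρ := by omega }

end Eval

end DiffRing

end

noncomputable section

namespace DiffRing

open Filter AddMonoidAlgebra Nat.Partrec

variable {F : Type*} [Field F]

/-! ### Computations with a bounded number of steps -/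

section Bounded

variable {T W : Type*} [Primcodable T] [Primcodable W]

/-- Within `K` steps, the program `c` finds a value of at most `N` at `t`. -/
def EvalnLE (K : ℕ) (c : Code) (t : T) (N : ℕ) : Prop :=
  -- The default N + 1 makes the test fail when there is no result within K steps.
  (c.evaln K (Encodable.encode t)).getD (N + 1) ≤ N

/-- Within `K` steps, the program `c` finds the value `w` at `t`. -/
def EvalnEq (K : ℕ) (c : Code) (t : T) (w : W) : Prop :=
  c.evaln K (Encodable.encode t) = some (Encodable.encode w)

theorem Computes.eventually_evalnEq {c : Code} {f : T → W} (hc : Computes c f) (t : T) :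
    ∀ᶠ K in atTop, EvalnEq K c t (f t) := by
  have h : Encodable.encode (f t) ∈ c.eval (Encodable.encode t) := by
    rw [hc t]
    exact Part.mem_some _
  obtain ⟨k, hk⟩ := Code.evaln_complete.mp h
  exact eventually_atTop.mpr ⟨k, fun K hK => Code.evaln_mono hK hk⟩

theorem EvalnEq.eq {c : Code} {f : T → W} (hc : Computes c f) {K : ℕ} {t : T} {w : W}
    (h : EvalnEq K c t w) : f t = w := by
  have h1 : Encodable.encode w ∈ c.eval (Encodable.encode t) := Code.evaln_sound h
  rw [hc t, Part.mem_some_iff] at h1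
  exact (Encodable.encode_injective h1).symm

theorem Computes.eventually_evalnLE {c : Code} {f : T → ℕ} (hc : Computes c f) {t : T} {N : ℕ}
    (h : f t ≤ N) : ∀ᶠ K in atTop, EvalnLE K c t N := by
  filter_upwards [hc.eventually_evalnEq t] with K hK
  rw [EvalnLE, hK]
  simpa using h

theorem EvalnLE.le {c : Code} {f : T → ℕ} (hc : Computes c f) {K : ℕ} {t : T} {N : ℕ}
    (h : EvalnLE K c t N) : f t ≤ N := by
  rw [EvalnLE] at h
  cases hx : c.evaln K (Encodable.encode t) with
  | none => simp [hx] at h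
  | some x =>
    have : EvalnEq K c t x := hx
    rw [this.eq hc]
    simpa [hx] using h

variable {X : Type*} [Primcodable X]

theorem computablePred_evalnLE {k : X → ℕ} {c : X → Code} {t : X → T} {N : X → ℕ}
    (hk : Computable k) (hc : Computable c) (ht : Computable t) (hN : Computable N) :
    ComputablePred fun x => EvalnLE (k x) (c x) (t x) (N x) :=
  computablePred_le (by fun_prop) hN

theorem computablePred_evalnEq {k : X → ℕ} {c : X → Code} {t : X → T} {w : X → W}
    (hk : Computable k) (hc : Computable c) (ht : Computable t) (hw : Computable w) :
    ComputablePred fun x => EvalnEq (k x) (c x) (t x) (w x) :=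
  computablePred_eq (by fun_prop) (by fun_prop)

end Bounded

/-! ### Certificates as finite data -/

/-- An output of the algorithm together with the exponents `v` and `vz` of preimages of the
generators, the point `N` of evaluation and a bound `K` for the number of steps. -/
abbrev ListCert (F : Type*) : Type _ := AlgOutput F × List (List ℤ) × List ℤ × ℕ × ℕ

namespace ListCert

variable (y : ListCert F)

/-- the number of `Π`-monomials -/
def s : ℕ := y.1.2.2.1.length

/-- the number of generators of the kernel -/
def u : ℕ := y.1.2.2.2.2.1.length

/-- the order of the `R`-monomial -/
def d : ℕ := y.1.1

/-- the root of unity -/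
def ρ : F := y.1.2.1

/-- the quotients of the `Π`-monomials -/
def α (j : ℕ) : F := y.1.2.2.1.getD j 0

/-- the coefficients of the images -/
def γ (i : ℕ) : F := (y.1.2.2.2.1.getD i (0, 0, [])).1

/-- the exponents of the root of unity -/
def o (i : ℕ) : ℕ := (y.1.2.2.2.1.getD i (0, 0, [])).2.1

/-- the lists of exponents of the `Π`-monomials -/
def mList (i : ℕ) : List ℤ := (y.1.2.2.2.1.getD i (0, 0, [])).2.2

/-- the exponents of the `Π`-monomials -/
def m (i j : ℕ) : ℤ := (y.mList i).getD j 0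

/-- the lists of exponents of the relations -/
def nList (k : ℕ) : List ℤ := (y.1.2.2.2.2.1.getD k ([], 0)).1

/-- the exponents of the relations -/
def n (k i : ℕ) : ℤ := (y.nList k).getD i 0

/-- the right hand sides of the relations -/
def g (k : ℕ) : F := (y.1.2.2.2.2.1.getD k ([], 0)).2

/-- the initial values of the products -/
def κ (j : ℕ) : F := (y.1.2.2.2.2.2.getD j (0, 0)).1

/-- the lower bounds of the products -/
def l (j : ℕ) : ℕ := (y.1.2.2.2.2.2.getD j (0, 0)).2

/-- the lists of exponents of preimages of the `Π`-monomials -/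
def vList (j : ℕ) : List ℤ := y.2.1.getD j []

/-- the exponents of preimages of the `Π`-monomials -/
def v (j i : ℕ) : ℤ := (y.vList j).getD i 0

/-- the list of exponents of a preimage of the `R`-monomial -/
def vzList : List ℤ := y.2.2.1

/-- the exponents of a preimage of the `R`-monomial -/
def vz (i : ℕ) : ℤ := y.vzList.getD i 0

/-- the point of evaluation -/
def N : ℕ := y.2.2.2.1

/-- the bound for the number of steps -/
def K : ℕ := y.2.2.2.2

/-- The power product of the coefficients `γ`. -/
def γpow (r : ℕ) (w : ℕ → ℤ) : F := ∏ i ∈ Finset.range r, y.γ i ^ w i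

/-! ### Computability of the components and of the tests -/

section ComputableProjections

variable {X E : Type*} [Primcodable X] [Primcodable E] {f : X → ListCert E} {a b : X → ℕ}

@[fun_prop]
theorem computable_s (hf : Computable f) : Computable fun x => s (f x) := by
  unfold s; fun_prop

@[fun_prop]
theorem computable_u (hf : Computable f) : Computable fun x => u (f x) := by
  unfold u; fun_prop

@[fun_prop]
theorem computable_d (hf : Computable f) : Computable fun x => d (f x) := by
  unfold d; fun_prop

@[fun_prop]
theorem computable_ρ (hf : Computable f) : Computable fun x => ρ (f x) := by
  unfold ρ; fun_prop

@[fun_prop]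
theorem computable_vList (hf : Computable f) (ha : Computable a) :
    Computable fun x => vList (f x) (a x) := by
  unfold vList; fun_prop

@[fun_prop]
theorem computable_vzList (hf : Computable f) : Computable fun x => vzList (f x) := by
  unfold vzList; fun_prop

@[fun_prop]
theorem computable_N (hf : Computable f) : Computable fun x => N (f x) := by
  unfold N; fun_prop

@[fun_prop]
theorem computable_K (hf : Computable f) : Computable fun x => K (f x) := by
  unfold K; fun_prop

@[fun_prop]
theorem computable_v (hf : Computable f) (ha : Computable a) (hb : Computable b) :
    Computable fun x => v (f x) (a x) (b x) := by
  unfold v; fun_prop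

@[fun_prop]
theorem computable_vz (hf : Computable f) (ha : Computable a) :
    Computable fun x => vz (f x) (a x) := by
  unfold vz; fun_prop

end ComputableProjections

section Computable

variable {X : Type*} [Primcodable X] [Primcodable F] {f : X → ListCert F} {a b : X → ℕ}

@[fun_prop]
theorem computable_α (hf : Computable f) (ha : Computable a) :
    Computable fun x => α (f x) (a x) := by
  unfold α; fun_prop

@[fun_prop]
theorem computable_γ (hf : Computable f) (ha : Computable a) :
    Computable fun x => γ (f x) (a x) := by
  unfold γ; fun_prop

@[fun_prop]
theorem computable_o (hf : Computable f) (ha : Computable a) :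
    Computable fun x => o (f x) (a x) := by
  unfold o; fun_prop

@[fun_prop]
theorem computable_mList (hf : Computable f) (ha : Computable a) :
    Computable fun x => mList (f x) (a x) := by
  unfold mList; fun_prop

@[fun_prop]
theorem computable_m (hf : Computable f) (ha : Computable a) (hb : Computable b) :
    Computable fun x => m (f x) (a x) (b x) := by
  unfold m; fun_prop

@[fun_prop]
theorem computable_nList (hf : Computable f) (ha : Computable a) :
    Computable fun x => nList (f x) (a x) := by
  unfold nList; fun_prop

@[fun_prop]
theorem computable_n (hf : Computable f) (ha : Computable a) (hb : Computable b) :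
    Computable fun x => n (f x) (a x) (b x) := by
  unfold n; fun_prop

@[fun_prop]
theorem computable_g (hf : Computable f) (ha : Computable a) :
    Computable fun x => g (f x) (a x) := by
  unfold g; fun_prop

@[fun_prop]
theorem computable_κ (hf : Computable f) (ha : Computable a) :
    Computable fun x => κ (f x) (a x) := by
  unfold κ; fun_prop

@[fun_prop]
theorem computable_l (hf : Computable f) (ha : Computable a) :
    Computable fun x => l (f x) (a x) := by
  unfold l; fun_prop

@[fun_prop]
theorem computable_γpow [ComputableMul F] [ComputableInv F] {w : X → ℕ → ℤ} (hf : Computable f)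
    (ha : Computable a) (hw : Computable fun p : X × ℕ => w p.1 p.2) :
    Computable fun x => γpow (f x) (a x) (w x) := by
  unfold γpow
  exact computable_prod_range ha (computable_pow (by fun_prop) hw)

end Computable

/-- The lists have the right lengths. -/
def ShapeCheck (bas : List F → List (List ℤ)) (αs : List F) (y : ListCert F) : Prop :=
  y.s + y.u = αs.length ∧ y.1.2.2.2.1.length = αs.length ∧ y.1.2.2.2.2.2.length = y.s ∧
  (∀ i < αs.length, (y.mList i).length = y.s) ∧
  -- The exponents of the kernel generators must be the computed basis itself; that they form a
  -- basis then needs no further test.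
  bas αs = y.1.2.2.2.2.1.map Prod.fst ∧ ∀ j < y.s, y.l j = y.N + 1

/-- The equations in `F`. -/
def FieldCheck (σ : F → F) (αs : List F) (y : ListCert F) : Prop :=
  σ y.ρ = y.ρ ∧ y.ρ ^ y.d = 1 ∧ (∀ j < y.s, y.α j ≠ 0) ∧ (∀ i < αs.length, y.γ i ≠ 0) ∧
  (∀ i < αs.length, σ (y.γ i) * ((∏ j ∈ Finset.range y.s, y.α j ^ y.m i j) * y.ρ ^ y.o i) =
    αs.getD i 0 * y.γ i) ∧
  ∀ k < y.u, y.g k = y.γpow αs.length (y.n k)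

/-- The linear equations and congruences. -/
def LinearCheck (r : ℕ) (y : ListCert F) : Prop :=
  0 < y.d ∧ (∀ i < r, y.o i < y.d) ∧
  (∀ k < y.u, ∀ j < y.s, ∑ i ∈ Finset.range r, y.n k i * y.m i j = 0) ∧
  (∀ k < y.u, (y.d : ℤ) ∣ ∑ i ∈ Finset.range r, y.n k i * (y.o i : ℤ)) ∧
  (∀ j < y.s, ∀ j' < y.s,
    ∑ i ∈ Finset.range r, y.v j i * y.m i j' = if j' = j then 1 else 0) ∧
  (∀ j < y.s, (y.d : ℤ) ∣ ∑ i ∈ Finset.range r, y.v j i * (y.o i : ℤ)) ∧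
  (∀ j < y.s, ∑ i ∈ Finset.range r, y.vz i * y.m i j = 0) ∧
  (y.d : ℤ) ∣ ∑ i ∈ Finset.range r, y.vz i * (y.o i : ℤ) + -1

/-- The conditions on the values of the evaluation function. -/
def EvalCheck [Primcodable F] (c₁ c₂ : Code) (r : ℕ) (y : ListCert F) : Prop :=
  (∀ k < y.u, EvalnLE y.K c₂ [((y.g k)⁻¹, y.nList k)] y.N) ∧
  (∀ k < y.u, EvalnEq y.K c₁ ([((y.g k)⁻¹, y.nList k)], y.N) (1 : F)) ∧
  (∀ j < y.s, EvalnLE y.K c₂ [((y.γpow r (y.v j))⁻¹, y.vList j)] y.N) ∧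
  (∀ j < y.s, EvalnEq y.K c₁ ([((y.γpow r (y.v j))⁻¹, y.vList j)], y.N) (y.κ j)) ∧
  (∀ j < y.s, EvalnLE y.K c₂ [(y.α j, ([] : List ℤ))] y.N) ∧
  EvalnLE y.K c₂ [((y.γpow r y.vz)⁻¹, y.vzList)] y.N ∧
  EvalnEq y.K c₁ ([((y.γpow r y.vz)⁻¹, y.vzList)], y.N) (y.ρ ^ y.N) ∧
  EvalnLE y.K c₂ [(y.ρ, ([] : List ℤ))] y.N

/-- The computable test of certificates. -/
def Check [Primcodable F] (σ : F → F) (bas : List F → List (List ℤ))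
    (p : AlgInput F × ListCert F) : Prop :=
  ShapeCheck bas p.1.1 p.2 ∧ FieldCheck σ p.1.1 p.2 ∧ LinearCheck p.1.1.length p.2 ∧
    EvalCheck p.1.2.1 p.1.2.2 p.1.1.length p.2

theorem computablePred_shapeCheck [Primcodable F] {bas : List F → List (List ℤ)}
    (hb : Computable bas) :
    ComputablePred fun p : AlgInput F × ListCert F => ShapeCheck bas p.1.1 p.2 := by
  unfold ShapeCheck
  refine computablePred_and (computablePred_eq (by fun_prop) (by fun_prop)) ?_
  refine computablePred_and (computablePred_eq (by fun_prop) (by fun_prop)) ?_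
  refine computablePred_and (computablePred_eq (by fun_prop) (by fun_prop)) ?_
  refine computablePred_and (computablePred_ball (by fun_prop)
    (computablePred_eq (by fun_prop) (by fun_prop))) ?_
  refine computablePred_and (computablePred_eq (by fun_prop) (by fun_prop)) ?_
  exact computablePred_ball (by fun_prop) (computablePred_eq (by fun_prop) (by fun_prop))

theorem computablePred_fieldCheck [Primcodable F] [ComputableMul F] [ComputableInv F] {σ : F → F}
    (hσ : Computable σ) :
    ComputablePred fun p : AlgInput F × ListCert F => FieldCheck σ p.1.1 p.2 := by
  unfold FieldCheck
  refine computablePred_and (computablePred_eq (by fun_prop) (by fun_prop)) ?_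
  refine computablePred_and (computablePred_eq (by fun_prop) (by fun_prop)) ?_
  refine computablePred_and (computablePred_ball (by fun_prop)
    (computablePred_ne (by fun_prop) (by fun_prop))) ?_
  refine computablePred_and (computablePred_ball (by fun_prop)
    (computablePred_ne (by fun_prop) (by fun_prop))) ?_
  refine computablePred_and (computablePred_ball (by fun_prop)
    (computablePred_eq (by fun_prop) (by fun_prop))) ?_
  exact computablePred_ball (by fun_prop) (computablePred_eq (by fun_prop) (by fun_prop))

theorem computablePred_linearCheck [Primcodable F] :
    ComputablePred fun p : AlgInput F × ListCert F => LinearCheck p.1.1.length p.2 := by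
  unfold LinearCheck
  refine computablePred_and (computablePred_lt (by fun_prop) (by fun_prop)) ?_
  refine computablePred_and (computablePred_ball (by fun_prop)
    (computablePred_lt (by fun_prop) (by fun_prop))) ?_
  refine computablePred_and (computablePred_ball (by fun_prop) (computablePred_ball (by fun_prop)
    (computablePred_eq (by fun_prop) (by fun_prop)))) ?_
  refine computablePred_and (computablePred_ball (by fun_prop)
    (computablePred_dvd (by fun_prop) (by fun_prop))) ?_
  refine computablePred_and (computablePred_ball (by fun_prop) (computablePred_ball (by fun_prop)
    (computablePred_eq (by fun_prop) (by fun_prop)))) ?_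
  refine computablePred_and (computablePred_ball (by fun_prop)
    (computablePred_dvd (by fun_prop) (by fun_prop))) ?_
  refine computablePred_and (computablePred_ball (by fun_prop)
    (computablePred_eq (by fun_prop) (by fun_prop))) ?_
  exact computablePred_dvd (by fun_prop) (by fun_prop)

theorem computablePred_evalCheck [Primcodable F] [ComputableMul F] [ComputableInv F] :
    ComputablePred fun p : AlgInput F × ListCert F =>
      EvalCheck p.1.2.1 p.1.2.2 p.1.1.length p.2 := by
  unfold EvalCheck
  refine computablePred_and (computablePred_ball (by fun_prop) (computablePred_evalnLE
    (by fun_prop) (by fun_prop) (by fun_prop) (by fun_prop))) ?_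
  refine computablePred_and (computablePred_ball (by fun_prop) (computablePred_evalnEq
    (by fun_prop) (by fun_prop) (by fun_prop) (by fun_prop))) ?_
  refine computablePred_and (computablePred_ball (by fun_prop) (computablePred_evalnLE
    (by fun_prop) (by fun_prop) (by fun_prop) (by fun_prop))) ?_
  refine computablePred_and (computablePred_ball (by fun_prop) (computablePred_evalnEq
    (by fun_prop) (by fun_prop) (by fun_prop) (by fun_prop))) ?_
  refine computablePred_and (computablePred_ball (by fun_prop) (computablePred_evalnLE
    (by fun_prop) (by fun_prop) (by fun_prop) (by fun_prop))) ?_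
  refine computablePred_and (computablePred_evalnLE
    (by fun_prop) (by fun_prop) (by fun_prop) (by fun_prop)) ?_
  refine computablePred_and (computablePred_evalnEq
    (by fun_prop) (by fun_prop) (by fun_prop) (by fun_prop)) ?_
  exact computablePred_evalnLE (by fun_prop) (by fun_prop) (by fun_prop) (by fun_prop)

theorem computablePred_check [Primcodable F] [ComputableMul F] [ComputableInv F] {σ : F → F} (hσ : Computable σ)
    {bas : List F → List (List ℤ)} (hb : Computable bas) : ComputablePred (Check σ bas) :=
  computablePred_and (computablePred_shapeCheck hb) (computablePred_and
    (computablePred_fieldCheck hσ) (computablePred_and computablePred_linearCheck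
      computablePred_evalCheck))

end ListCert

end DiffRing

end

noncomputable section

namespace DiffRing

open Filter AddMonoidAlgebra Nat.Partrec

variable {F : Type*} [Field F]

/-! ### Correctness of the test -/

theorem ofFn_getD {A : Type*} {k : ℕ} (l : List A) (x : A) (h : l.length = k) :
    (List.ofFn fun i : Fin k => l.getD i x) = l := by
  subst h
  exact List.ext_getElem (by simp) fun i h1 h2 => by simp

theorem getD_ofFn {A : Type*} {k : ℕ} (f : Fin k → A) (x : A) (i : Fin k) :
    (List.ofFn f).getD i x = f i := by
  rw [List.getD_eq_getElem _ _ (by simp)]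
  simp

theorem ofTerms_singleton (r : ℕ) (c : F) (w : List ℤ) :
    ofTerms F r [(c, w)] = algebraMap F _ c * mono (fun i : Fin r => w.getD i 0) 0 := by
  simp [ofTerms]

theorem ofTerms_const (r : ℕ) (c : F) :
    ofTerms F r [(c, [])] = algebraMap F (PRing F r) c := by
  rw [ofTerms_singleton]
  have : (mono (fun i : Fin r => ([] : List ℤ).getD i 0) 0 : PRing F r) = 1 := rfl
  rw [this, mul_one]

namespace ListCert

theorem coe_pw_eq_γpow {r : ℕ} {y : ListCert F} {γ : Fin r → Fˣ} (hγ : ∀ i, (γ i : F) = y.γ i)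
    (w : ℕ → ℤ) : ((pw γ fun i => w i : Fˣ) : F) = y.γpow r w := by
  rw [coe_pw, γpow, Finset.prod_range]
  exact Finset.prod_congr rfl fun i _ => by rw [hγ]

variable [Primcodable F] {σ : RingAut F} {bas : List F → List (List ℤ)} {r : ℕ}
  {α : Fin r → Fˣ} {evE : PRing F r → ℕ → constField σ} {LE : PRing F r → ℕ} {c₁ c₂ : Code}

/-- Every list that passes is turned into typed data. Positive bounded evaluation results are
trustworthy since a value found in K steps is the value of the program. -/
theorem Check.sound
    (hbas : ∃ (u : ℕ) (Z : Matrix (Fin u) (Fin r) ℤ), RowsAreBasis (multRel σ α) Z ∧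
      bas (List.ofFn fun i => (α i : F)) = List.ofFn fun i => List.ofFn (Z i))
    (hc : ComputesEval σ evE LE c₁ c₂) {y : ListCert F}
    (h : Check σ bas ((List.ofFn fun i => (α i : F), c₁, c₂), y)) :
    y.s + y.u = r ∧ ∃ (D : RepData F r y.s y.u) (ρ : (constField σ)ˣ) (v : Fin y.s → Fin r → ℤ)
      (vz : Fin r → ℤ) (κ : Fin y.s → constField σ), IsAlgCert σ α D ρ v vz ∧
        IsEvalCert evE LE D ρ v vz κ y.N ∧
        D.toOutput (fun i => (κ i : F)) (fun _ => y.N + 1) = y.1 := by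
  obtain ⟨⟨hsu, hγl, hκl, hml, hb, hl⟩, ⟨hρσ, hρd, hα, hγ, hcompat, hg⟩,
    ⟨hd, ho, hmn, hon, hmv, hov, hmz, hoz⟩, ⟨hen, hen', hev, hev', heα, hez, hez', heρ⟩⟩ := h
  simp only [List.length_ofFn] at hsu hγl hml hγ hcompat hg ho hmn hon hmv hov hmz hoz
  simp only [List.length_ofFn] at hev hev' hez hez'
  obtain ⟨u, Z, hZ, hZb⟩ := hbas
  rw [hZb] at hb
  -- The number of kernel generators is not tested separately: it agrees with the size of the
  -- computed basis since the two lists are equal.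
  obtain rfl : u = y.u := by
    have := congrArg List.length hb
    rwa [List.length_ofFn, List.length_map] at this
  have hrow : ∀ k : Fin y.u, y.nList k = List.ofFn (Z k) := by
    intro k
    have h1 := congrArg (fun l => l.getD (k : ℕ) []) hb
    dsimp only at h1
    rw [getD_ofFn] at h1
    rw [h1, nList, List.getD_eq_getElem _ _ k.isLt, List.getD_eq_getElem _ _ (by
      rw [List.length_map]; exact k.isLt), List.getElem_map]
    rfl
  have hZn : ∀ (k : Fin y.u) (i : Fin r), Z k i = y.n k i := by
    intro k i
    rw [n, hrow, getD_ofFn]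
  have hρ0 : y.ρ ≠ 0 := by
    intro h0
    rw [h0, zero_pow hd.ne'] at hρd
    exact zero_ne_one hρd
  let ρ : (constField σ)ˣ := Units.mk0 ⟨y.ρ, hρσ⟩ (by simpa [Subtype.ext_iff] using hρ0)
  have hg0 : ∀ k : Fin y.u, y.g k ≠ 0 := by
    intro k
    rw [hg k k.isLt]
    exact Finset.prod_ne_zero_iff.mpr fun i hi => zpow_ne_zero _ (hγ i (Finset.mem_range.mp hi))
  let D : RepData F r y.s y.u :=
    { d := y.d
      α := fun j => Units.mk0 (y.α j) (hα j j.isLt)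
      ρ := y.ρ
      γ := fun i => Units.mk0 (y.γ i) (hγ i i.isLt)
      o := fun i => y.o i
      m := fun i j => y.m i j
      n := fun k i => y.n k i
      g := fun k => Units.mk0 (y.g k) (hg0 k) }
  have hpw : ∀ w : ℕ → ℤ, ((pw D.γ fun i => w i : Fˣ) : F) = y.γpow r w :=
    coe_pw_eq_γpow fun _ => rfl
  have hD : Matrix.of D.n = Z := by
    ext k i
    exact (hZn k i).symm
  refine ⟨hsu, D, ρ, fun j i => y.v j i, fun i => y.vz i,
    fun j => evE (algebraMap F _ ((y.γpow r (y.v j))⁻¹) * mono (fun i : Fin r => y.v j i) 0) y.N,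
    ?_, ?_, ?_⟩
  · exact
    { basis := hD ▸ hZ
      d_pos := hd
      o_lt := fun i => ho i i.isLt
      rho := rfl
      rho_pow := Units.ext (Subtype.ext hρd)
      compat := fun i => by
        have := hcompat i i.isLt
        rw [getD_ofFn, Finset.prod_range] at this
        exact this
      m_n := fun k => by
        funext j
        have := hmn k k.isLt j j.isLt
        rwa [Finset.sum_range] at this
      o_n := fun k => by
        have := hon k k.isLt
        rwa [Finset.sum_range] at this
      m_v := fun j => by
        funext j'
        have := hmv j j.isLt j' j'.isLt
        rw [Finset.sum_range] at this
        rw [expM_apply, Pi.single_apply]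
        simpa only [Fin.ext_iff] using this
      o_v := fun j => by
        have := hov j j.isLt
        rwa [Finset.sum_range] at this
      m_vz := by
        funext j
        have := hmz j j.isLt
        rwa [Finset.sum_range] at this
      o_vz := by
        rwa [Finset.sum_range, ← sub_eq_add_neg] at hoz
      g_eq := fun k => Units.ext (by rw [hpw]; exact hg k k.isLt) }
  · exact
    { bound_n := fun k => by
        have := (hen k k.isLt).le hc.2
        rwa [ofTerms_singleton] at this
      eval_n := fun k => by
        have := (hen' k k.isLt).eq hc.1
        rw [ofTerms_singleton] at this
        exact Subtype.ext this
      bound_v := fun j => by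
        have := (hev j j.isLt).le hc.2
        rw [ofTerms_singleton] at this
        rw [hpw]
        exact this
      eval_v := fun j => by rw [hpw]
      bound_α := fun j => by
        have := (heα j j.isLt).le hc.2
        rwa [ofTerms_const] at this
      bound_vz := by
        have := hez.le hc.2
        rw [ofTerms_singleton] at this
        rw [hpw]
        exact this
      eval_vz := by
        have := hez'.eq hc.1
        rw [ofTerms_singleton] at this
        rw [hpw]
        exact Subtype.ext this
      bound_ρ := by
        have := heρ.le hc.2
        rwa [ofTerms_const] at this }
  · refine Prod.ext rfl (Prod.ext rfl (Prod.ext ?_ (Prod.ext ?_ (Prod.ext ?_ ?_))))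
    · exact ofFn_getD _ _ rfl
    · refine Eq.trans (congrArg List.ofFn (funext fun i => ?_)) (ofFn_getD _ (0, 0, []) hγl)
      exact Prod.ext rfl (Prod.ext rfl (ofFn_getD _ _ (hml i i.isLt)))
    · refine Eq.trans (congrArg List.ofFn (funext fun k => ?_)) (ofFn_getD _ ([], 0) rfl)
      exact Prod.ext (ofFn_getD _ _ ((congrArg List.length (hrow k)).trans (by simp))) rfl
    · refine Eq.trans (congrArg List.ofFn (funext fun j => ?_)) (ofFn_getD _ (0, 0) hκl)
      refine Prod.ext ?_ (hl j j.isLt).symm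
      have := (hev' j j.isLt).eq hc.1
      rw [ofTerms_singleton] at this
      exact this

theorem eventually_forall_lt {k : ℕ} {P : ℕ → ℕ → Prop}
    (h : ∀ i : Fin k, ∀ᶠ K in atTop, P i K) : ∀ᶠ K in atTop, ∀ i < k, P i K := by
  have := eventually_all.mpr h
  filter_upwards [this] with K hK i hi using hK ⟨i, hi⟩

/-- Only the step bound K is left free. Each of the finitely many program runs succeeds for all
large K, so one K serves all of them. -/
theorem exists_check (hc : ComputesEval σ evE LE c₁ c₂) {s u : ℕ} (hsu : s + u = r)
    {D : RepData F r s u} {ρ : (constField σ)ˣ} {v : Fin s → Fin r → ℤ} {vz : Fin r → ℤ}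
    {κ : Fin s → constField σ} {N : ℕ} (hA : IsAlgCert σ α D ρ v vz)
    (hE : IsEvalCert evE LE D ρ v vz κ N)
    (hbas : bas (List.ofFn fun i => (α i : F)) = List.ofFn fun i => List.ofFn (D.n i)) :
    ∃ y, Check σ bas ((List.ofFn fun i => (α i : F), c₁, c₂), y) := by
  let y : ℕ → ListCert F := fun K =>
    (D.toOutput (fun i => (κ i : F)) (fun _ => N + 1), List.ofFn fun j => List.ofFn (v j),
      List.ofFn vz, N, K)
  have ys : ∀ K, (y K).s = s := fun K => List.length_ofFn
  have yu : ∀ K, (y K).u = u := fun K => List.length_ofFn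
  have yα : ∀ K (j : Fin s), (y K).α j = D.α j := fun K j => getD_ofFn _ _ j
  have yγo : ∀ K (i : Fin r), (y K).1.2.2.2.1.getD i (0, 0, []) =
      ((D.γ i : F), D.o i, List.ofFn (D.m i)) := fun K i => getD_ofFn _ _ i
  have yγ : ∀ K (i : Fin r), (y K).γ i = D.γ i := fun K i => congrArg (·.1) (yγo K i)
  have yo : ∀ K (i : Fin r), (y K).o i = D.o i := fun K i => congrArg (·.2.1) (yγo K i)
  have ymL : ∀ K (i : Fin r), (y K).mList i = List.ofFn (D.m i) := fun K i =>
    congrArg (·.2.2) (yγo K i)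
  have ym : ∀ K (i : Fin r) (j : Fin s), (y K).m i j = D.m i j := fun K i j => by
    rw [m, ymL, getD_ofFn]
  have yng : ∀ K (k : Fin u), (y K).1.2.2.2.2.1.getD k ([], 0) =
      (List.ofFn (D.n k), (D.g k : F)) := fun K k => getD_ofFn _ _ k
  have ynL : ∀ K (k : Fin u), (y K).nList k = List.ofFn (D.n k) := fun K k =>
    congrArg (·.1) (yng K k)
  have yg : ∀ K (k : Fin u), (y K).g k = D.g k := fun K k => congrArg (·.2) (yng K k)
  have yn : ∀ K (k : Fin u) (i : Fin r), (y K).n k i = D.n k i := fun K k i => by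
    rw [n, ynL, getD_ofFn]
  have yκl : ∀ K (j : Fin s), (y K).1.2.2.2.2.2.getD j (0, 0) = ((κ j : F), N + 1) :=
    fun K j => getD_ofFn _ _ j
  have yκ : ∀ K (j : Fin s), (y K).κ j = κ j := fun K j => congrArg (·.1) (yκl K j)
  have yl : ∀ K (j : Fin s), (y K).l j = N + 1 := fun K j => congrArg (·.2) (yκl K j)
  have yvL : ∀ K (j : Fin s), (y K).vList j = List.ofFn (v j) := fun K j => getD_ofFn _ _ j
  have yv : ∀ K (j : Fin s) (i : Fin r), (y K).v j i = v j i := fun K j i => by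
    rw [ListCert.v, yvL, getD_ofFn]
  have yvz : ∀ K (i : Fin r), (y K).vz i = vz i := fun K i => getD_ofFn _ _ i
  have hpw : ∀ K (w : ℕ → ℤ), (y K).γpow r w = ((pw D.γ fun i => w i : Fˣ) : F) := fun K w =>
    (coe_pw_eq_γpow (fun i => (yγ K i).symm) w).symm
  have hpwn : ∀ K (k : Fin u), (y K).γpow r ((y K).n k) = D.g k := fun K k => by
    rw [hpw, hA.g_eq, funext (yn K k)]
  have hpwv : ∀ K (j : Fin s), (y K).γpow r ((y K).v j) = ((pw D.γ (v j) : Fˣ) : F) := fun K j => by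
    rw [hpw, funext (yv K j)]
  have hpwz : ∀ K, (y K).γpow r (y K).vz = ((pw D.γ vz : Fˣ) : F) := fun K => by
    rw [hpw, funext (yvz K)]
  have yρ : ∀ K, (y K).ρ = D.ρ := fun _ => rfl
  have yd : ∀ K, (y K).d = D.d := fun _ => rfl
  have yN : ∀ K, (y K).N = N := fun _ => rfl
  have yK : ∀ K, (y K).K = K := fun _ => rfl
  have yvzL : ∀ K, (y K).vzList = List.ofFn vz := fun _ => rfl
  have hterm : ∀ (c : F) (w : Fin r → ℤ),
      ofTerms F r [(c, List.ofFn w)] = algebraMap F _ c * mono w 0 := fun c w => by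
    rw [ofTerms_singleton]
    simp only [getD_ofFn]
  have hle : ∀ (c : F) (w : Fin r → ℤ), LE (algebraMap F _ c * mono w 0) ≤ N →
      ∀ᶠ K in atTop, EvalnLE K c₂ [(c, List.ofFn w)] N := fun c w h =>
    hc.2.eventually_evalnLE (by rwa [hterm])
  have hle' : ∀ c : F, LE (algebraMap F _ c) ≤ N →
      ∀ᶠ K in atTop, EvalnLE K c₂ [(c, ([] : List ℤ))] N := fun c h =>
    hc.2.eventually_evalnLE (by rwa [ofTerms_const])
  have heq : ∀ (c : F) (w : Fin r → ℤ) (x : constField σ), evE (algebraMap F _ c * mono w 0) N = x →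
      ∀ᶠ K in atTop, EvalnEq K c₁ ([(c, List.ofFn w)], N) (x : F) := fun c w x h => by
    have := hc.1.eventually_evalnEq ([(c, List.ofFn w)], N)
    simpa only [hterm, h] using this
  have hev : ∀ᶠ K in atTop, EvalCheck c₁ c₂ r (y K) := by
    simp only [EvalCheck, ys, yu, yK, yN, yρ, hpwz, yvzL]
    refine Filter.Eventually.and (eventually_forall_lt fun k => ?_) <|
      Filter.Eventually.and (eventually_forall_lt fun k => ?_) <|
      Filter.Eventually.and (eventually_forall_lt fun j => ?_) <|
      Filter.Eventually.and (eventually_forall_lt fun j => ?_) <|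
      Filter.Eventually.and (eventually_forall_lt fun j => ?_) <|
      Filter.Eventually.and ?_ <| Filter.Eventually.and ?_ ?_
    · simp only [yg, ynL]
      exact hle _ _ (hE.bound_n k)
    · simp only [yg, ynL]
      exact heq _ _ 1 (hE.eval_n k)
    · simp only [hpwv, yvL]
      exact hle _ _ (hE.bound_v j)
    · simp only [hpwv, yvL, yκ]
      exact heq _ _ _ (hE.eval_v j)
    · simp only [yα]
      exact hle' _ (hE.bound_α j)
    · exact hle _ _ hE.bound_vz
    · rw [← hA.rho]
      exact heq _ _ _ hE.eval_vz
    · exact hle' _ hE.bound_ρ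
  obtain ⟨K, hK⟩ := hev.exists
  have hρσ : σ D.ρ = D.ρ := hA.rho ▸ (ρ : constField σ).2
  have hρd : D.ρ ^ D.d = 1 := by
    have := congrArg (fun x : (constField σ)ˣ => ((x : constField σ) : F)) hA.rho_pow
    rw [← hA.rho]
    simpa using this
  refine ⟨y K, ?_, ?_, ?_, ?_⟩
  · simp only [ShapeCheck, List.length_ofFn, ys, yu, yN]
    refine ⟨hsu, List.length_ofFn, List.length_ofFn, fun i hi => ?_, ?_, fun j hj => yl K ⟨j, hj⟩⟩
    · rw [ymL K ⟨i, hi⟩, List.length_ofFn]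
    · rw [hbas]
      change _ = (List.ofFn _).map Prod.fst
      rw [List.map_ofFn]
      rfl
  · simp only [FieldCheck, List.length_ofFn, ys, yu, yρ, yd]
    refine ⟨hρσ, hρd, fun j hj => ?_, fun i hi => ?_, fun i hi => ?_, fun k hk => ?_⟩
    · rw [yα K ⟨j, hj⟩]
      exact Units.ne_zero _
    · rw [yγ K ⟨i, hi⟩]
      exact Units.ne_zero _
    · have := hA.compat ⟨i, hi⟩
      rw [Finset.prod_range, yγ K ⟨i, hi⟩, yo K ⟨i, hi⟩, getD_ofFn _ _ ⟨i, hi⟩]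
      simp only [yα, fun j => ym K ⟨i, hi⟩ j]
      exact this
    · rw [yg K ⟨k, hk⟩, hpwn K ⟨k, hk⟩]
  · simp only [LinearCheck, List.length_ofFn, ys, yu, yd, Finset.sum_range, yo, yvz]
    refine ⟨hA.d_pos, fun i hi => ?_, fun k hk j hj => ?_, fun k hk => ?_, fun j hj j' hj' => ?_,
      fun j hj => ?_, fun j hj => ?_, ?_⟩
    · rw [yo K ⟨i, hi⟩]
      exact hA.o_lt _
    · simp only [fun i => yn K ⟨k, hk⟩ i, fun i => ym K i ⟨j, hj⟩]
      exact congrFun (hA.m_n ⟨k, hk⟩) ⟨j, hj⟩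
    · simp only [fun i => yn K ⟨k, hk⟩ i]
      exact hA.o_n ⟨k, hk⟩
    · simp only [fun i => yv K ⟨j, hj⟩ i, fun i => ym K i ⟨j', hj'⟩]
      have := congrFun (hA.m_v ⟨j, hj⟩) ⟨j', hj'⟩
      rw [expM_apply, Pi.single_apply] at this
      simpa only [Fin.mk.injEq] using this
    · simp only [fun i => yv K ⟨j, hj⟩ i]
      exact hA.o_v ⟨j, hj⟩
    · simp only [fun i => ym K i ⟨j, hj⟩]
      exact congrFun hA.m_vz ⟨j, hj⟩
    · rw [← sub_eq_add_neg]
      exact hA.o_vz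
  · simpa only [List.length_ofFn] using hK

end ListCert

/-- The algorithmic version of `exists_optimalRep`. -/
theorem exists_algorithm [Primcodable F] {σ : RingAut F} (hσ : RadicalStable σ)
    {τ₀ : F →+* SeqRing (constField σ)} (hτ₀ : IsKHom σ σ τ₀)
    {ev : F → ℕ → constField σ} {L Z : F → ℕ} (hF : IsAlgorithmic σ τ₀ ev L Z) :
    ∃ alg : AlgInput F →. AlgOutput F, Partrec alg ∧
      ∀ (r : ℕ) (α : Fin r → Fˣ) (σE : RingAut (PRing F r))
        (τE : PRing F r →+* SeqRing (constField σ)) (evE : PRing F r → ℕ → constField σ)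
        (LE : PRing F r → ℕ) (c₁ c₂ : Code),
        IsPExtension σ α σE → IsKHom σ σE τE → IsEvalFun σ σE evE → Represents evE τE →
        (∀ (f : F) (n : ℕ), evE (algebraMap F _ f) n = ev f n) →
        IsOSigmaFun σE evE LE → ComputesEval σ evE LE c₁ c₂ → multRel σ α ≠ ⊥ →
        ∃ (s u : ℕ) (D : RepData F r s u) (σH : RingAut (HRing F s D.d))
          (τH : HRing F s D.d →+* SeqRing (constField σ)) (lam : PRing F r →+* HRing F s D.d)
          (κ : Fin s → constField σ) (l : Fin s → ℕ),
          Module.finrank ℤ (multRel σ α) = u ∧ s + u = r ∧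
          IsLargestDivisor (multRel σ α) D.d ∧ IsOptimalRep σ τ₀ σE τE D σH τH lam ∧
          HasProductEval σ ev D σH τH κ l ∧
          D.toOutput (fun i => (κ i : F)) l ∈ alg (List.ofFn (fun i => (α i : F)), c₁, c₂) := by
  obtain ⟨bas, hbas, hbas'⟩ := hF.basis
  have : ComputableMul F := ⟨hF.mul⟩
  have : ComputableInv F := ⟨hF.inv⟩
  obtain ⟨alg, halg, h⟩ := exists_search (ListCert.computablePred_check hF.aut hbas)
    (Computable.fst (α := AlgOutput F))
  refine ⟨alg, halg, fun r α σE τE evE LE c₁ c₂ hE hτE hev hrep hevE hL hc hV => ?_⟩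
  have hbase : ∀ f : F, τE (algebraMap F _ f) = τ₀ f := fun f => by
    rw [hrep, hF.represents, funext (hevE f)]
  -- Existence of a certificate is needed only for termination; the output is justified by
  -- soundness, whichever certificate the search meets.
  have hex : ∃ y, ListCert.Check σ bas ((List.ofFn fun i => (α i : F), c₁, c₂), y) := by
    obtain ⟨d, hd⟩ := exists_isLargestDivisor hV
    obtain ⟨u, n, hn, hbn⟩ := hbas' r α
    obtain ⟨s, rfl⟩ := Nat.exists_eq_add_of_le hn.le
    obtain ⟨D, rfl, -, ρ, v, vz, hD⟩ := exists_cert hσ hτ₀ hE hτE hbase hd hn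
    obtain ⟨κ, N, hκ⟩ := hD.exists_evalCert hbase hrep LE
    exact ListCert.exists_check hc (Nat.add_comm _ _) hD.toIsAlgCert hκ hbn
  obtain ⟨y, hy, hmem⟩ := h _ hex
  obtain ⟨hsu, D, ρ, v, vz, κ, hA, hev', hout⟩ := hy.sound (hbas' r α) hc
  obtain ⟨σH, τH, lam, hd, hH, hP⟩ :=
    hev'.exists_rep hA hσ hτ₀ hF.represents hE hτE hev hL hrep hevE hV
  exact ⟨y.s, y.u, D, σH, τH, lam, κ, _, hA.basis.finrank_eq, hsu, hd, hH, hP, hout ▸ hmem⟩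

end DiffRing

end

/-! ### The main theorem -/

theorem mainTheorem1 {F : Type*} [Field F] [CharZero F] (σ : RingAut F)
    (hσ : DiffRing.RadicalStable σ)
    (τ₀ : F →+* DiffRing.SeqRing (DiffRing.constField σ))
    (hτ₀ : DiffRing.IsKEmbedding σ σ τ₀) :
    (∀ (r : ℕ) (α : Fin r → Fˣ) (σE : RingAut (DiffRing.PRing F r))
        (τE : DiffRing.PRing F r →+* DiffRing.SeqRing (DiffRing.constField σ)),
      DiffRing.IsPExtension σ α σE →
      DiffRing.IsKHom σ σE τE →
      (∀ f : F, τE (algebraMap F _ f) = τ₀ f) →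
      DiffRing.multRel σ α ≠ ⊥ →
      ∀ (u d : ℕ), Module.finrank ℤ (DiffRing.multRel σ α) = u →
        DiffRing.IsLargestDivisor (DiffRing.multRel σ α) d →
        ∃ (s : ℕ) (D : DiffRing.RepData F r s u) (σH : RingAut (DiffRing.HRing F s D.d))
          (τH : DiffRing.HRing F s D.d →+* DiffRing.SeqRing (DiffRing.constField σ))
          (lam : DiffRing.PRing F r →+* DiffRing.HRing F s D.d),
          s + u = r ∧ D.d = d ∧
          DiffRing.IsOptimalRep σ τ₀ σE τE D σH τH lam ∧
          ∀ ev : F → ℕ → DiffRing.constField σ,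
            DiffRing.IsEvalFun σ σ ev → DiffRing.Represents ev τ₀ →
            ∃ (κ : Fin s → DiffRing.constField σ) (l : Fin s → ℕ),
              DiffRing.HasProductEval σ ev D σH τH κ l) ∧
    (∀ [Primcodable F] (ev : F → ℕ → DiffRing.constField σ) (L Z : F → ℕ),
      DiffRing.IsAlgorithmic σ τ₀ ev L Z →
      ∃ alg : DiffRing.AlgInput F →. DiffRing.AlgOutput F, Partrec alg ∧
        ∀ (r : ℕ) (α : Fin r → Fˣ) (σE : RingAut (DiffRing.PRing F r))
          (τE : DiffRing.PRing F r →+* DiffRing.SeqRing (DiffRing.constField σ))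
          (evE : DiffRing.PRing F r → ℕ → DiffRing.constField σ) (LE : DiffRing.PRing F r → ℕ)
          (c₁ c₂ : Nat.Partrec.Code),
          DiffRing.IsPExtension σ α σE →
          DiffRing.IsKHom σ σE τE →
          DiffRing.IsEvalFun σ σE evE → DiffRing.Represents evE τE →
          (∀ (f : F) (n : ℕ), evE (algebraMap F _ f) n = ev f n) →
          DiffRing.IsOSigmaFun σE evE LE → DiffRing.ComputesEval σ evE LE c₁ c₂ →
          DiffRing.multRel σ α ≠ ⊥ →
          ∃ (s u : ℕ) (D : DiffRing.RepData F r s u) (σH : RingAut (DiffRing.HRing F s D.d))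
            (τH : DiffRing.HRing F s D.d →+* DiffRing.SeqRing (DiffRing.constField σ))
            (lam : DiffRing.PRing F r →+* DiffRing.HRing F s D.d)
            (κ : Fin s → DiffRing.constField σ) (l : Fin s → ℕ),
            Module.finrank ℤ (DiffRing.multRel σ α) = u ∧ s + u = r ∧
            DiffRing.IsLargestDivisor (DiffRing.multRel σ α) D.d ∧
            DiffRing.IsOptimalRep σ τ₀ σE τE D σH τH lam ∧
            DiffRing.HasProductEval σ ev D σH τH κ l ∧
            D.toOutput (fun i => (κ i : F)) l ∈
              alg (List.ofFn (fun i => (α i : F)), c₁, c₂)) := by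
  refine ⟨fun r α σE τE hE hτE hbase _ u d hu hd => ?_, fun ev L Z hF => ?_⟩
  · obtain ⟨s, D, σH, τH, lam, hs, hD, hH, hev⟩ :=
      DiffRing.exists_optimalRep hσ hτ₀.toIsKHom hE hτE hbase hu hd
    exact ⟨s, D, σH, τH, lam, hs, hD, hH, fun ev _ h => hev ev h⟩
  · exact DiffRing.exists_algorithm hσ hτ₀.toIsKHom hF
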